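/- Let $\pi\colon Y\to X$ be a smooth surjective submersion of smooth Hausdorff manifolds, with $\dim X=n$ and $\dim Y=n+m$. Let $\bigwedge^n_rY$ be the bundle of $n$-forms on $Y$ that vanish whenever $r$ of their arguments are $\pi$-vertical, and let $M=\bigwedge^n_2Y/\bigwedge^n_1Y$, with projection $\tau\colon M\to X$. Fibered coordinates $(x^\mu,y^i)$ on $Y$ induce coordinates $(x^\mu,y^i,p^\mu_i)$ on $M$: they label the class of $\sum_{\mu,i}p^\mu_i\,dy^i\wedge d^{n-1}x_\mu$, where $d^nx=dx^1\wedge\dots\wedge dx^n$ and $d^{n-1}x_\mu=\iota_{\partial/\partial x^\mu}d^nx$. The canonical fibered graded Poisson structure on $M$ is the following. Put $$S^n=\Big\langle d^nx,\ dy^i\wedge d^{n-1}x_\mu,\ \sum_\mu dp^\mu_i\wedge d^{n-1}x_\mu\Big\rangle,\qquad S^a=\langle\iota_U\sigma:\sigma\in S^n,\ U\in\textstyle\bigwedge^{n-a}TM\rangle ,$$ and let $K_p\subseteq\bigwedge^pTM$ be the set of $p$-vectors $W$ with $\iota_W\eta=0$ for all $\eta\in S^p$. The map $\sharp_n\colon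 S^n\to TM/K_1$ is given by $$\sharp_n(d^nx)=0,\qquad \sharp_n(dy^i\wedge d^{n-1}x_\mu)=-\frac{\partial}{\partial p^\mu_i},\qquad \sharp_n\Big(\sum_\mu dp^\mu_i\wedge d^{n-1}x_\mu\Big)=\frac{\partial}{\partial y^i},$$ and $\sharp_a\colon S^a\to\bigwedge^{n+1-a}TM/K_{n+1-a}$, $1\le a\le n$, by $\sharp_a(\iota_U\sigma)=\sharp_n(\sigma)\wedge U+K_{n+1-a}$. Contractions follow the convention $(\iota_U\eta)(W)=\eta(U\wedge W)$. These objects do not depend on the fibered coordinates used. For $0\le a\le n-1$, a smooth $a$-form $\alpha$ on $M$ is called Hamiltonian if $d\alpha$ takes values in $S^{a+1}$. The bracket of Hamiltonian forms $\alpha,\beta$ of degrees $a,b$ is the form of degree $a+b-(n-1)$ $$\{\alpha,\beta\}=(-1)^{n-1-b}\,\iota_{\sharp_{b+1}(d\beta)}\,d\alpha$$ (zero if $a+b<n-1$). A Hamiltonian $a$-form $\alpha$ is called special if $\alpha\wedge\varepsilon$ is Hamiltonian for every closed $(n-1-a)$-form $\varepsilon$ on $M$ that is basic, that is, $\varepsilon=\tau^*\varepsilon_0$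 for some form $\varepsilon_0$ on $X$. Theorem. The special Hamiltonian forms form a subalgebra: in each degree $0\le a\le n-1$ they are a real linear subspace, and the bracket of two special Hamiltonian forms is a special Hamiltonian form. Moreover: (i) If $0\le a\le n-2$ and $\alpha$ is a special Hamiltonian $a$-form, then in any coordinates $(x^\mu,y^i,p^\mu_i)$ as above $d\alpha$ takes values in the span of the forms $dx^{\mu_0}\wedge\dots\wedge dx^{\mu_a}$ and $dy^i\wedge dx^{\nu_1}\wedge\dots\wedge dx^{\nu_a}$; in particular it has no $dp$-terms. (ii) In degree $a=n-1$ every Hamiltonian form is special. -/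

import Mathlib

open Set Function
open scoped Manifold ContDiff Topology

noncomputable section
namespace ReducedFieldTheory

/-! ### Multilinear algebra -/

section Algebra
variable {V W : Type*} [AddCommGroup V] [Module ℝ V] [AddCommGroup W] [Module ℝ W]

/-- Alternating `k`-forms on a real vector space. -/
abbrev Alt (V : Type*) [AddCommGroup V] [Module ℝ V] (k : ℕ) : Type _ := V [⋀^Fin k]→ₗ[ℝ] ℝ

/-- The exterior product `θ₁ ∧ ⋯ ∧ θ_k` of covectors. -/
def covecWedge {k : ℕ} (θ : Fin k → Module.Dual ℝ V) : Alt V k :=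
  (Matrix.detRowAlternating (R := ℝ) (n := Fin k)).compLinearMap (LinearMap.pi θ)

theorem covecWedge_apply {k : ℕ} (θ : Fin k → Module.Dual ℝ V) (v : Fin k → V) :
    covecWedge θ v = Matrix.det (Matrix.of fun i j => θ j (v i)) := rfl

/-- The `n`-forms `η` with `ι_{e₁ ∧ ⋯ ∧ e_r} η = 0` for all `e₁, …, e_r ∈ K`: they vanish as soon as
`r` of their arguments lie in `K`. -/
def horizontalForms (K : Submodule ℝ V) (n r : ℕ) : Submodule ℝ (Alt V n) where
  carrier := {η | ∀ (w : Fin n → V) (s : Finset (Fin n)), s.card = r → (∀ i ∈ s, w i ∈ K) → η w = 0}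
  add_mem' := by
    intro a b ha hb w s hs hw
    simp [ha w s hs hw, hb w s hs hw]
  zero_mem' := by intro w s _ _; rfl
  smul_mem' := by
    intro c a ha w s hs hw
    simp [ha w s hs hw]

theorem horizontalForms_comp {K : Submodule ℝ V} {K' : Submodule ℝ W} {n r : ℕ} {η : Alt V n}
    (hη : η ∈ horizontalForms K n r) (A : W →ₗ[ℝ] V) (hA : ∀ w ∈ K', A w ∈ K) :
    η.compLinearMap A ∈ horizontalForms K' n r :=
  fun w s hs hw => hη (fun i => A (w i)) s hs fun i hi => hA _ (hw i hi)

theorem alt_sum_apply {ι : Type*} (s : Finset ι) {k : ℕ} (f : ι → Alt V k) (v : Fin k → V) :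
    (∑ i ∈ s, f i) v = ∑ i ∈ s, f i v := by
  classical
  induction s using Finset.induction_on with
  | empty => simp
  | insert a s ha ih => simp [Finset.sum_insert ha, ih]

/-- The quotient `⋀ⁿ₂ / ⋀ⁿ₁` of the forms killed by two vectors of `K` by the forms killed by one
vector of `K`. -/
abbrev reducedForms (K : Submodule ℝ V) (n : ℕ) : Type _ :=
  horizontalForms K n 2 ⧸ ((horizontalForms K n 1).submoduleOf (horizontalForms K n 2)).toAddSubgroup

/-- The class of a form. -/
def reducedForms.mk {K : Submodule ℝ V} {n : ℕ} (η : horizontalForms K n 2) : reducedForms K n :=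
  QuotientAddGroup.mk η

theorem reducedForms.mk_eq {K : Submodule ℝ V} {n : ℕ} {η ζ : horizontalForms K n 2} :
    reducedForms.mk η = reducedForms.mk ζ ↔ (η - ζ : Alt V n) ∈ horizontalForms K n 1 := by
  rw [eq_comm, reducedForms.mk, reducedForms.mk, QuotientAddGroup.eq]
  change ((-ζ + η : horizontalForms K n 2) : Alt V n) ∈ horizontalForms K n 1 ↔ _
  rw [Submodule.coe_add, Submodule.coe_neg, neg_add_eq_sub]

open Classical in
/-- The class of `η`, for `η ∈ ⋀ⁿ₂` (and the zero class otherwise). -/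
def reducedForms.ofAlt (K : Submodule ℝ V) (n : ℕ) (η : Alt V n) : reducedForms K n :=
  if h : η ∈ horizontalForms K n 2 then .mk ⟨η, h⟩ else .mk 0

end Algebra

section YCoord

/-- The space of fibered coordinates `(x^μ, y^i)`. -/
abbrev YCoord (n m : ℕ) : Type := (Fin n → ℝ) × (Fin m → ℝ)

variable {n m : ℕ}

namespace YCoord
/-- `dx^μ`. -/
def dx (μ : Fin n) : Module.Dual ℝ (YCoord n m) := LinearMap.proj μ ∘ₗ LinearMap.fst ℝ _ _
/-- `dy^i`. -/
def dy (i : Fin m) : Module.Dual ℝ (YCoord n m) := LinearMap.proj i ∘ₗ LinearMap.snd ℝ _ _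
/-- `∂/∂x^μ`. -/
def ex (μ : Fin n) : YCoord n m := (Pi.single μ 1, 0)
/-- `∂/∂y^i`. -/
def ey (i : Fin m) : YCoord n m := (0, Pi.single i 1)
/-- `dy^i ∧ dⁿ⁻¹x_μ`, with `dⁿ⁻¹x_μ = ι_{∂/∂x^μ} dⁿx`: the form `dⁿx = dx¹ ∧ ⋯ ∧ dxⁿ` with its `μ`-th
factor replaced by `dy^i`. -/
def dyx (μ : Fin n) (i : Fin m) : Alt (YCoord n m) n := covecWedge (Function.update dx μ (dy i))
/-- The vectors that are vertical over the base. -/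
def vert (n m : ℕ) : Submodule ℝ (YCoord n m) := LinearMap.ker (LinearMap.fst ℝ _ _)

theorem dyx_mem (μ : Fin n) (i : Fin m) : dyx μ i ∈ horizontalForms (vert n m) n 2 := by
  intro w s hs hw
  obtain ⟨k, l, hkl, rfl⟩ := Finset.card_eq_two.1 hs
  have hz : ∀ k : Fin n, w k ∈ vert n m → ∀ j, j ≠ μ →
      (Function.update dx μ (dy i) : Fin n → Module.Dual ℝ (YCoord n m)) j (w k) = 0 := by
    intro k hk j hj
    have : (w k).1 = 0 := hk
    simp [Function.update_of_ne hj, dx, this]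
  have hk := hz k (hw k (by simp))
  have hl := hz l (hw l (by simp))
  rw [dyx, covecWedge_apply, Matrix.det_apply]
  apply Finset.sum_eq_zero
  intro σ _
  by_cases h1 : σ.symm k = μ
  · have h2 : σ.symm l ≠ μ := by
      intro h; exact hkl (σ.symm.injective (h1.trans h.symm))
    rw [Finset.prod_eq_zero (Finset.mem_univ (σ.symm l)), smul_zero]
    simpa using hl _ h2
  · rw [Finset.prod_eq_zero (Finset.mem_univ (σ.symm k)), smul_zero]
    simpa using hk _ h1

theorem dyx_apply (μ ν : Fin n) (i j : Fin m) :
    dyx μ i (Function.update ex ν (ey j)) = if μ = ν ∧ i = j then 1 else 0 := by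
  rw [dyx, covecWedge_apply]
  by_cases h : μ = ν
  · subst h
    have : (Matrix.of fun a b => (Function.update dx μ (dy i) : Fin n → Module.Dual ℝ (YCoord n m)) b
        ((Function.update ex μ (ey j) : Fin n → YCoord n m) a)) =
        Matrix.diagonal (Function.update (fun _ => (1 : ℝ)) μ (if i = j then 1 else 0)) := by
      ext a b
      by_cases ha : a = μ
      · by_cases hb : b = μ
        · simp [ha, hb, dy, ey, Pi.single_apply]
        · simp [ha, hb, Matrix.diagonal_apply_ne _ (Ne.symm hb), dx, ey]
      · by_cases hb : b = μ
        · simp [update_of_ne ha, hb, Matrix.diagonal_apply_ne _ ha, dy, ex]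
        · simp [update_of_ne ha, update_of_ne hb, Matrix.diagonal_apply, dx, ex, Pi.single_apply,
            eq_comm]
    rw [this, Matrix.det_diagonal, Finset.prod_update_of_mem (Finset.mem_univ _)]
    simp
  · rw [if_neg (by tauto)]
    refine Matrix.det_eq_zero_of_row_eq_zero μ fun b => ?_
    by_cases hb : b = μ
    · subst hb
      simp [Function.update_of_ne h, dy, ex]
    · simp [Function.update_of_ne h, dx, ex, hb]

/-- The coordinate basis. -/
def basis (n m : ℕ) : Module.Basis (Fin n ⊕ Fin m) ℝ (YCoord n m) :=
  (Pi.basisFun ℝ (Fin n)).prod (Pi.basisFun ℝ (Fin m))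

theorem basis_inl (μ : Fin n) : basis n m (.inl μ) = ex μ := by
  simp [basis, ex]
theorem basis_inr (i : Fin m) : basis n m (.inr i) = ey i := by
  simp [basis, ey]

/-- `dⁿx`. -/
def dxs (n m : ℕ) : Alt (YCoord n m) n := covecWedge dx

theorem dxs_mem : dxs n m ∈ horizontalForms (vert n m) n 1 := by
  intro w s hs hw
  obtain ⟨k, rfl⟩ := Finset.card_eq_one.1 hs
  have : (w k).1 = 0 := hw k (by simp)
  exact Matrix.det_eq_zero_of_row_eq_zero k fun b => by simp [dx, this]

theorem dxs_ex : dxs n m ex = 1 := by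
  rw [dxs, covecWedge_apply, ← Matrix.det_one (n := Fin n)]
  congr 1
  ext a b
  simp [dx, ex, Matrix.one_apply, Pi.single_apply, eq_comm]

theorem mem_one_of_coord {η : Alt (YCoord n m) n} (h2 : η ∈ horizontalForms (vert n m) n 2)
    (h0 : ∀ μ i, η (Function.update ex μ (ey i)) = 0) : η ∈ horizontalForms (vert n m) n 1 := by
  have hv : ∀ i : Fin m, (ey i : YCoord n m) ∈ vert n m := fun i => by simp [vert, ey]
  suffices h : η = η ex • dxs n m by
    rw [h]; exact Submodule.smul_mem _ _ dxs_mem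
  refine (basis n m).ext_alternating fun v hv' => ?_
  rw [AlternatingMap.smul_apply]
  by_cases hall : ∀ k, ∃ μ, v k = .inl μ
  · choose τ hτ using hall
    have hinj : Injective τ := fun a b h => hv' (by rw [hτ, hτ, h])
    let σ : Equiv.Perm (Fin n) := Equiv.ofBijective τ (Finite.injective_iff_bijective.1 hinj)
    have : (fun k => basis n m (v k)) = ex ∘ σ := by
      ext1 k; simp [hτ, basis_inl, σ]
    rw [this, η.map_perm, (dxs n m).map_perm, dxs_ex]
    simp [mul_comm]
  · push Not at hall
    obtain ⟨k, hk⟩ := hall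
    obtain ⟨i, hi⟩ : ∃ i, v k = .inr i := by
      cases h : v k with
      | inl a => exact absurd h (hk a)
      | inr b => exact ⟨b, rfl⟩
    have hd : dxs n m (fun k => basis n m (v k)) = 0 :=
      dxs_mem _ {k} (by simp) (by simpa [hi, basis_inr] using hv i)
    rw [hd, smul_zero]
    by_cases hall : ∀ l, l ≠ k → ∃ μ, v l = .inl μ
    · choose! τ hτ using hall
      obtain ⟨μ, hμ⟩ : ∃ μ, ∀ l, l ≠ k → τ l ≠ μ := by
        by_contra! hcon
        choose g hg hg' using hcon
        have hgi : Injective g := fun a b h => by rw [← hg' a, ← hg' b, h]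
        obtain ⟨a, ha⟩ := (Finite.injective_iff_surjective.1 hgi) k
        exact hg a ha
      have hinj : Injective (update τ k μ) := by
        intro a b h
        by_cases ha : a = k <;> by_cases hb : b = k
        · rw [ha, hb]
        · subst ha; simp [update_of_ne hb] at h; exact absurd h.symm (hμ b hb)
        · subst hb; simp [update_of_ne ha] at h; exact absurd h (hμ a ha)
        · simp only [update_of_ne ha, update_of_ne hb] at h
          exact hv' (by rw [hτ a ha, hτ b hb, h])
      let σ : Equiv.Perm (Fin n) := Equiv.ofBijective _ (Finite.injective_iff_bijective.1 hinj)
      have : (fun k => basis n m (v k)) = (update ex μ (ey i)) ∘ σ := by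
        ext1 l
        by_cases hl : l = k
        · subst hl; simp [σ, hi, basis_inr]
        · simp [σ, update_of_ne hl, update_of_ne (hμ l hl), hτ l hl, basis_inl]
      rw [this, η.map_perm, h0, smul_zero]
    · push Not at hall
      obtain ⟨l, hlk, hl⟩ := hall
      obtain ⟨j, hj⟩ : ∃ i, v l = .inr i := by
        cases h : v l with
        | inl a => exact absurd h (hl a)
        | inr b => exact ⟨b, rfl⟩
      refine h2 _ {k, l} (Finset.card_pair hlk.symm) ?_
      intro a ha
      simp only [Finset.mem_insert, Finset.mem_singleton] at ha
      rcases ha with rfl | rfl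
      · simpa [hi, basis_inr] using hv i
      · simpa [hj, basis_inr] using hv j

end YCoord
end YCoord

/-! ### Multivectors and contractions -/

section Multivectors

variable {V : Type*} [AddCommGroup V] [Module ℝ V]

/-- The wedge product `U ∧ W` of multivectors, of total degree `N = p + k`. -/
def wedge {p k N : ℕ} (h : p + k = N) : ⋀[ℝ]^p V →ₗ[ℝ] ⋀[ℝ]^k V →ₗ[ℝ] ⋀[ℝ]^N V :=
  LinearMap.mk₂ ℝ (fun U W => ⟨U.1 * W.1, h ▸ SetLike.mul_mem_graded U.2 W.2⟩)
    (fun _ _ _ => Subtype.ext (add_mul _ _ _)) (fun _ _ _ => Subtype.ext (smul_mul_assoc _ _ _))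
    (fun _ _ _ => Subtype.ext (mul_add _ _ _)) (fun _ _ _ => Subtype.ext (mul_smul_comm _ _ _))

theorem coe_wedge {p k N : ℕ} (h : p + k = N) (U : ⋀[ℝ]^p V) (W : ⋀[ℝ]^k V) :
    (wedge h U W : ExteriorAlgebra ℝ V) = U * W := rfl

/-- A vector as a `1`-vector. -/
def vec : V →ₗ[ℝ] ⋀[ℝ]^1 V :=
  (ExteriorAlgebra.ι ℝ).codRestrict _ fun v => by
    simpa only [ExteriorAlgebra.exteriorPower, pow_one] using LinearMap.mem_range_self _ v

theorem coe_vec (v : V) : (vec v : ExteriorAlgebra ℝ V) = ExteriorAlgebra.ι ℝ v := rfl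

/-- The value of a `k`-form on a `k`-vector. -/
def pair {k : ℕ} : Alt V k ≃ₗ[ℝ] (⋀[ℝ]^k V →ₗ[ℝ] ℝ) := exteriorPower.alternatingMapLinearEquiv

/-- The contraction `ι_U η` of an `N`-form with a `p`-vector: `(ι_U η)(W) = η (U ∧ W)` for every
`k`-vector `W`, `p + k = N`.  So `ι_{u₁ ∧ ⋯ ∧ u_p} η = η (u₁, …, u_p, ·, …, ·)`. -/
def contract {p k N : ℕ} (h : p + k = N) : ⋀[ℝ]^p V →ₗ[ℝ] Alt V N →ₗ[ℝ] Alt V k :=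
  LinearMap.mk₂ ℝ (fun U η => pair.symm (pair η ∘ₗ wedge h U))
    (fun _ _ _ => by rw [map_add, LinearMap.comp_add, map_add])
    (fun _ _ _ => by rw [map_smul, LinearMap.comp_smul, map_smul])
    (fun _ _ _ => by rw [map_add, LinearMap.add_comp, map_add])
    (fun _ _ _ => by rw [map_smul, LinearMap.smul_comp, map_smul])

theorem pair_contract {p k N : ℕ} (h : p + k = N) (U : ⋀[ℝ]^p V) (η : Alt V N) (W : ⋀[ℝ]^k V) :
    pair (contract h U η) W = pair η (wedge h U W) := by
  change pair (pair.symm (pair η ∘ₗ wedge h U)) W = _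
  rw [LinearEquiv.apply_symm_apply]; rfl

theorem pair_neg_apply {k : ℕ} (η : Alt V k) (W : ⋀[ℝ]^k V) : pair (-η) W = -pair η W := by
  have h : pair (-η + η) W = 0 := by rw [neg_add_cancel, map_zero]; rfl
  rw [map_add, LinearMap.add_apply] at h
  linarith

theorem pair_ιMulti {k : ℕ} (η : Alt V k) (v : Fin k → V) :
    pair η (exteriorPower.ιMulti ℝ k v) = η v :=
  exteriorPower.alternatingMapLinearEquiv_apply_ιMulti η v

theorem contract_vec_apply {k : ℕ} (h : 1 + k = k + 1) (v : V) (η : Alt V (k + 1))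
    (r : Fin k → V) : contract h (vec v) η r = η (Matrix.vecCons v r) := by
  rw [← pair_ιMulti, pair_contract, ← pair_ιMulti]
  congr 1
  refine Subtype.ext ?_
  rw [coe_wedge, coe_vec, exteriorPower.ιMulti_apply_coe, exteriorPower.ιMulti_apply_coe,
    ExteriorAlgebra.ιMulti_succ_apply]
  simp

theorem ι_mul_comm {q : ℕ} (v : V) (U : ExteriorAlgebra ℝ V) (hU : U ∈ ⋀[ℝ]^q V) :
    ExteriorAlgebra.ι ℝ v * U = (-1 : ℝ) ^ q • (U * ExteriorAlgebra.ι ℝ v) := by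
  induction hU using Submodule.pow_induction_on_left' with
  | algebraMap r => simp [Algebra.commutes]
  | add x y i hx hy ihx ihy => rw [mul_add, ihx, ihy, add_mul, smul_add]
  | mem_mul w hw i x hx ih =>
    obtain ⟨w, rfl⟩ := hw
    rw [← mul_assoc, eq_neg_of_add_eq_zero_left (ExteriorAlgebra.ι_add_mul_swap v w), neg_mul,
      mul_assoc, ih, pow_succ, mul_smul_comm, mul_assoc]
    simp

theorem mul_comm_graded {p q : ℕ} (U W : ExteriorAlgebra ℝ V) (hU : U ∈ ⋀[ℝ]^p V)
    (hW : W ∈ ⋀[ℝ]^q V) : U * W = (-1 : ℝ) ^ (p * q) • (W * U) := by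
  induction hU using Submodule.pow_induction_on_left' with
  | algebraMap r => simp [Algebra.commutes]
  | add x y i hx hy ihx ihy => rw [add_mul, ihx, ihy, mul_add, smul_add]
  | mem_mul w hw i x hx ih =>
    obtain ⟨w, rfl⟩ := hw
    rw [mul_assoc, ih, mul_smul_comm, ← mul_assoc, ι_mul_comm w W hW, smul_mul_assoc, smul_smul,
      mul_assoc, Nat.succ_mul, pow_add]

end Multivectors

/-! ### The canonical graded structure in coordinates -/

section Canonical

variable {n m : ℕ}

/-- The space of coordinates `(x^μ, y^i, p^μ_i)`. -/
abbrev MCoord (n m : ℕ) : Type := YCoord n m × (Fin n → Fin m → ℝ)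

namespace MCoord

/-- `dx^μ`. -/
def dx (μ : Fin n) : Module.Dual ℝ (MCoord n m) := YCoord.dx μ ∘ₗ LinearMap.fst ℝ _ _
/-- `dy^i`. -/
def dy (i : Fin m) : Module.Dual ℝ (MCoord n m) := YCoord.dy i ∘ₗ LinearMap.fst ℝ _ _
/-- `dp^μ_i`. -/
def dp (μ : Fin n) (i : Fin m) : Module.Dual ℝ (MCoord n m) :=
  LinearMap.proj i ∘ₗ LinearMap.proj μ ∘ₗ LinearMap.snd ℝ _ _

/-- `∂/∂y^i`. -/
def ey (i : Fin m) : MCoord n m := (YCoord.ey i, 0)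
/-- `∂/∂p^μ_i`. -/
def ep (μ : Fin n) (i : Fin m) : MCoord n m := (0, Pi.single μ (Pi.single i 1))

/-- `dⁿx`. -/
def dxs (n m : ℕ) : Alt (MCoord n m) n := covecWedge dx
/-- `dy^i ∧ dⁿ⁻¹x_μ`: `dⁿx` with its `μ`-th factor replaced by `dy^i`. -/
def dyx (μ : Fin n) (i : Fin m) : Alt (MCoord n m) n := covecWedge (Function.update dx μ (dy i))
/-- `dp^μ_i ∧ dⁿ⁻¹x_μ`, summed over `μ`. -/
def dpx (i : Fin m) : Alt (MCoord n m) n :=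
  ∑ μ, covecWedge (Function.update dx μ (dp μ i))

/-- `Sⁿ = ⟨dⁿx, dy^i ∧ dⁿ⁻¹x_μ, dp^μ_i ∧ dⁿ⁻¹x_μ⟩` (sum over `μ` in the last one). -/
def topS (n m : ℕ) : Submodule ℝ (Alt (MCoord n m) n) :=
  Submodule.span ℝ ({dxs n m} ∪ range (fun x : Fin n × Fin m => dyx x.1 x.2) ∪ range dpx)

/-- `S^a`: the `a`-forms obtained from `Sⁿ` by contraction with `n - a` vectors, that is, the span of
the `ι_U σ` with `σ ∈ Sⁿ` and `U` an `(n - a)`-vector. -/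
def S (n m a : ℕ) : Submodule ℝ (Alt (MCoord n m) a) :=
  Submodule.span ℝ {η | ∃ (k : ℕ) (h : k + a = n) (U : ⋀[ℝ]^k (MCoord n m)) (σ : Alt (MCoord n m) n),
    σ ∈ topS n m ∧
      η = contract h U σ}

/-- `K_p`: the `p`-vectors `W` with `ι_W S^p = 0`. -/
def K (n m p : ℕ) : Submodule ℝ (⋀[ℝ]^p (MCoord n m)) where
  carrier := {W | ∀ η ∈ S n m p, contract (add_zero p) W η = 0}
  add_mem' := by
    intro a b ha hb η hη
    rw [map_add, LinearMap.add_apply, ha η hη, hb η hη, add_zero]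
  zero_mem' := by intro η _; rw [map_zero, LinearMap.zero_apply]
  smul_mem' := by
    intro c a ha η hη
    rw [map_smul, LinearMap.smul_apply, ha η hη, smul_zero]

/-- The graph of `♯_n : Sⁿ → TM`, as pairs `(♯_n σ, σ)`: `♯_n (dⁿx) = 0`,
`♯_n (dy^i ∧ dⁿ⁻¹x_μ) = -∂/∂p^μ_i`, `♯_n (dp^μ_i ∧ dⁿ⁻¹x_μ) = ∂/∂y^i`. -/
def sharpTop (n m : ℕ) : Submodule ℝ (MCoord n m × Alt (MCoord n m) n) :=
  Submodule.span ℝ ({(0, dxs n m)} ∪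
    range (fun x : Fin n × Fin m => (-ep x.1 x.2, dyx x.1 x.2)) ∪ range (fun i => (ey i, dpx i)))

/-- The `p`-vectors that represent `♯_a`, `p = n + 1 - a`, as pairs `(W, η)`: the span of the pairs
`(♯_n(σ) ∧ U, ι_U σ)`. -/
def sharpGraph (n m p a : ℕ) : Submodule ℝ (⋀[ℝ]^p (MCoord n m) × Alt (MCoord n m) a) :=
  Submodule.span ℝ {x | ∃ (k : ℕ) (h : k + a = n) (hp : 1 + k = p) (U : ⋀[ℝ]^k (MCoord n m)),
    ∃ w ∈ sharpTop n m, x = (wedge hp (vec w.1) U, contract h U w.2)}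

theorem covecWedge_vecCons_eq_zero {k : ℕ} (θ : Fin (k + 1) → Module.Dual ℝ (MCoord n m))
    (v : MCoord n m) (hv : ∀ j, θ j v = 0) (r : Fin k → MCoord n m) :
    covecWedge θ (Matrix.vecCons v r) = 0 :=
  Matrix.det_eq_zero_of_row_eq_zero 0 fun j => by simpa using hv j

theorem covecWedge_vecCons_congr {k : ℕ} (θ : Fin (k + 1) → Module.Dual ℝ (MCoord n m))
    (μ : Fin (k + 1)) (φ ψ : Module.Dual ℝ (MCoord n m)) (v w : MCoord n m)
    (hv : ∀ j, j ≠ μ → θ j v = 0) (hw : ∀ j, j ≠ μ → θ j w = 0) (h : φ v = ψ w)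
    (r : Fin k → MCoord n m) :
    covecWedge (Function.update θ μ φ) (Matrix.vecCons v r) =
      covecWedge (Function.update θ μ ψ) (Matrix.vecCons w r) := by
  rw [covecWedge_apply, covecWedge_apply, Matrix.det_succ_row_zero, Matrix.det_succ_row_zero]
  refine Finset.sum_congr rfl fun j _ => ?_
  by_cases hj : j = μ
  · subst hj
    simp only [Matrix.of_apply, Matrix.cons_val_zero, Function.update_self, h]
    congr 2
    ext a b
    simp
  · simp [Function.update_of_ne hj, hv j hj, hw j hj]

theorem sharpTop_skew {k : ℕ} (h : 1 + k = n) {w w' : MCoord n m × Alt (MCoord n m) n}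
    (hw : w ∈ sharpTop n m) (hw' : w' ∈ sharpTop n m) :
    contract h (vec w.1) w'.2 = -contract h (vec w'.1) w.2 := by
  obtain rfl : n = k + 1 := by omega
  have x_ep : ∀ (j μ : Fin (k + 1)) (i : Fin m), dx j (ep μ i) = 0 := by
    intros; simp [dx, YCoord.dx, ep]
  have x_ey : ∀ (j : Fin (k + 1)) (i : Fin m), dx j (ey i : MCoord (k + 1) m) = 0 := by
    intros; simp [dx, YCoord.dx, ey, YCoord.ey]
  have y_ep : ∀ (j : Fin m) (μ : Fin (k + 1)) (i : Fin m), dy j (ep μ i) = 0 := by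
    intros; simp [dy, YCoord.dy, ep]
  have y_ey : ∀ (j i : Fin m), dy j (ey i : MCoord (k + 1) m) = if i = j then 1 else 0 := by
    intros; simp [dy, YCoord.dy, ey, YCoord.ey, Pi.single_apply, eq_comm]
  have p_ey : ∀ (μ : Fin (k + 1)) (j i : Fin m), dp μ j (ey i : MCoord (k + 1) m) = 0 := by
    intros; simp [dp, ey]
  have p_ep : ∀ (ν : Fin (k + 1)) (j : Fin m) (μ : Fin (k + 1)) (i : Fin m),
      dp ν j (ep μ i : MCoord (k + 1) m) = if μ = ν ∧ i = j then 1 else 0 := by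
    intro ν j μ i
    by_cases hμ : μ = ν
    · subst hμ; simp [dp, ep, Pi.single_apply, eq_comm]
    · simp [dp, ep, hμ]
  have up : ∀ {φ v} (μ : Fin (k + 1)), (∀ j, dx j v = 0) → φ v = 0 →
      ∀ r, covecWedge (Function.update (dx : Fin (k + 1) → Module.Dual ℝ (MCoord (k + 1) m)) μ φ)
        (Matrix.vecCons v r) = 0 := by
    intro φ v μ hx hφ r
    refine covecWedge_vecCons_eq_zero _ _ (fun j => ?_) r
    by_cases hj : j = μ
    · subst hj; simpa using hφ
    · simpa [Function.update_of_ne hj] using hx j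
  have hxx : ∀ v, (∀ j, dx j v = 0) → contract h (vec v) (dxs (k + 1) m) = 0 := by
    intro v hv; ext r
    rw [contract_vec_apply]; exact covecWedge_vecCons_eq_zero _ _ hv r
  have hyy : ∀ μ i ν j, contract h (vec (ep μ i)) (dyx ν j : Alt (MCoord (k + 1) m) (k + 1)) = 0 := by
    intros; ext r
    rw [contract_vec_apply]; exact up _ (fun _ => x_ep _ _ _) (y_ep _ _ _) r
  have hpp : ∀ i j, contract h (vec (ey i)) (dpx j : Alt (MCoord (k + 1) m) (k + 1)) = 0 := by
    intros; ext r
    rw [contract_vec_apply, dpx, alt_sum_apply]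
    exact Finset.sum_eq_zero fun μ _ => up _ (fun _ => x_ey _ _) (p_ey _ _ _) r
  have hyp : ∀ μ i j, contract h (vec (ep μ i)) (dpx j : Alt (MCoord (k + 1) m) (k + 1)) =
      contract h (vec (ey j)) (dyx μ i) := by
    intro μ i j; ext r
    rw [contract_vec_apply, contract_vec_apply, dpx, alt_sum_apply, dyx]
    rw [Finset.sum_eq_single μ]
    · exact covecWedge_vecCons_congr _ _ _ _ _ _ (fun _ _ => x_ep _ _ _) (fun _ _ => x_ey _ _)
        (by simp [p_ep, y_ey, eq_comm]) r
    · intro ν _ hν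
      exact up _ (fun _ => x_ep _ _ _) (by rw [p_ep, if_neg (fun h => hν h.1.symm)]) r
    · simp
  induction hw using Submodule.span_induction with
  | zero => simp
  | add x y _ _ hx hy =>
    rw [Prod.fst_add, Prod.snd_add, map_add, map_add, LinearMap.add_apply, hx, hy, map_add, neg_add]
  | smul c x _ hx =>
    rw [Prod.smul_fst, Prod.smul_snd, map_smul, map_smul, LinearMap.smul_apply, hx, map_smul, smul_neg]
  | mem w hw =>
    induction hw' using Submodule.span_induction with
    | zero => simp
    | add x y _ _ hx hy =>
      rw [Prod.fst_add, Prod.snd_add, map_add, map_add, map_add, LinearMap.add_apply, hx, hy, neg_add]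
    | smul c x _ hx =>
      rw [Prod.smul_fst, Prod.smul_snd, map_smul, map_smul, map_smul, LinearMap.smul_apply, hx, smul_neg]
    | mem w' hw' =>
      rcases hw with (hw | ⟨⟨μ, i⟩, rfl⟩) | ⟨i, rfl⟩ <;>
      rcases hw' with (hw' | ⟨⟨ν, j⟩, rfl⟩) | ⟨j, rfl⟩
      · obtain rfl := hw; obtain rfl := hw'; simp
      · obtain rfl := hw; simp [hxx _ (fun _ => x_ep _ _ _)]
      · obtain rfl := hw; simp [hxx _ (fun _ => x_ey _ _)]
      · obtain rfl := hw'; simp [hxx _ (fun _ => x_ep _ _ _)]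
      · simp [hyy]
      · simp [hyp]
      · obtain rfl := hw'; simp [hxx _ (fun _ => x_ey _ _)]
      · simp [hyp]
      · simp [hpp]

theorem exists_top {σ : Alt (MCoord n m) n} (hσ : σ ∈ topS n m) :
    ∃ v, (v, σ) ∈ sharpTop n m := by
  induction hσ using Submodule.span_induction with
  | zero => exact ⟨0, Submodule.zero_mem _⟩
  | add x y _ _ hx hy =>
    obtain ⟨v, hv⟩ := hx
    obtain ⟨w, hw⟩ := hy
    exact ⟨v + w, Submodule.add_mem _ hv hw⟩
  | smul c x _ hx =>
    obtain ⟨v, hv⟩ := hx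
    exact ⟨c • v, Submodule.smul_mem _ c hv⟩
  | mem w hw =>
    rcases hw with (rfl | ⟨⟨μ, i⟩, rfl⟩) | ⟨i, rfl⟩
    · exact ⟨0, Submodule.subset_span (.inl (.inl rfl))⟩
    · exact ⟨_, Submodule.subset_span (.inl (.inr ⟨(μ, i), rfl⟩))⟩
    · exact ⟨_, Submodule.subset_span (.inr ⟨i, rfl⟩)⟩

/-- Every form in `S^a` has a representative of its image under `♯_a`. -/
theorem exists_sharp {p a : ℕ} (hpa : p + a = n + 1) {η : Alt (MCoord n m) a} (hη : η ∈ S n m a) :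
    ∃ W, (W, η) ∈ sharpGraph n m p a := by
  induction hη using Submodule.span_induction with
  | zero => exact ⟨0, Submodule.zero_mem _⟩
  | add x y _ _ hx hy =>
    obtain ⟨v, hv⟩ := hx
    obtain ⟨w, hw⟩ := hy
    exact ⟨v + w, Submodule.add_mem _ hv hw⟩
  | smul c x _ hx =>
    obtain ⟨v, hv⟩ := hx
    exact ⟨c • v, Submodule.smul_mem _ c hv⟩
  | mem η hη =>
    obtain ⟨k, h, U, σ, hσ, rfl⟩ := hη
    obtain ⟨v, hv⟩ := exists_top hσ
    exact ⟨_, Submodule.subset_span ⟨k, h, by omega, U, (v, σ), hv, rfl⟩⟩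

theorem sign_aux (k k' : ℕ) : ((-1 : ℝ) ^ k' * (-1) ^ (k' * k)) * (-1) =
    (-1) ^ ((1 + k) * (1 + k')) * (-1) ^ k := by
  rcases Nat.even_or_odd k with hk | hk <;> rcases Nat.even_or_odd k' with hk' | hk' <;>
    simp [pow_mul, pow_add, hk.neg_one_pow, hk'.neg_one_pow]

theorem sharpGraph_skew_aux {p a k k' : ℕ} (h : k + a = n) (hp : 1 + k = p) (h' : k' + p = n)
    (hp' : 1 + k' = a) (U : ⋀[ℝ]^k (MCoord n m)) (U' : ⋀[ℝ]^k' (MCoord n m))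
    {w w' : MCoord n m × Alt (MCoord n m) n} (hw : w ∈ sharpTop n m) (hw' : w' ∈ sharpTop n m) :
    pair (contract h' U' w'.2) (wedge hp (vec w.1) U) =
      (-1) ^ (p * a) * pair (contract h U w.2) (wedge hp' (vec w'.1) U') := by
  have hR : k + k' = n - 1 := by omega
  have h1 : 1 + (n - 1) = n := by omega
  have e1 : wedge h' U' (wedge hp (vec w.1) U) =
      ((-1 : ℝ) ^ k' * (-1) ^ (k' * k)) • wedge h1 (vec w.1) (wedge hR U U') := by
    refine Subtype.ext ?_
    change (U' : ExteriorAlgebra ℝ (MCoord n m)) * ((vec w.1).1 * U) = _ • ((vec w.1).1 * (U * U'))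
    rw [← mul_assoc, mul_comm_graded _ _ U'.2 (vec w.1).2, smul_mul_assoc, mul_assoc,
      mul_comm_graded _ _ U'.2 U.2, mul_smul_comm, smul_smul, mul_one]
  have e2 : wedge h U (wedge hp' (vec w'.1) U') =
      ((-1 : ℝ) ^ k) • wedge h1 (vec w'.1) (wedge hR U U') := by
    refine Subtype.ext ?_
    change (U : ExteriorAlgebra ℝ (MCoord n m)) * ((vec w'.1).1 * U') =
      _ • ((vec w'.1).1 * (U * U'))
    rw [← mul_assoc, mul_comm_graded _ _ U.2 (vec w'.1).2, smul_mul_assoc, mul_assoc, mul_one]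
  have e3 : pair w'.2 (wedge h1 (vec w.1) (wedge hR U U')) =
      -pair w.2 (wedge h1 (vec w'.1) (wedge hR U U')) := by
    rw [← pair_contract h1 (vec w.1) w'.2, sharpTop_skew h1 hw hw', pair_neg_apply, pair_contract]
  have sgn : ((-1 : ℝ) ^ k' * (-1) ^ (k' * k)) * (-1) = (-1) ^ (p * a) * (-1) ^ k := by
    rw [← hp, ← hp', sign_aux]
  have f1 : pair (contract h' U' w'.2) (wedge hp (vec w.1) U) =
      ((-1 : ℝ) ^ k' * (-1) ^ (k' * k)) * pair w'.2 (wedge h1 (vec w.1) (wedge hR U U')) := by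
    rw [pair_contract, e1, map_smul, smul_eq_mul]
  have f2 : pair (contract h U w.2) (wedge hp' (vec w'.1) U') =
      (-1 : ℝ) ^ k * pair w.2 (wedge h1 (vec w'.1) (wedge hR U U')) := by
    rw [pair_contract, e2, map_smul, smul_eq_mul]
  refine f1.trans ?_
  refine Eq.trans ?_ (congrArg (fun t => (-1 : ℝ) ^ (p * a) * t) f2.symm)
  rw [e3]
  linear_combination sgn * pair w.2 (wedge h1 (vec w'.1) (wedge hR U U'))

/-- Skew-symmetry: `ι_{♯η} η' = (-1)^{pa} ι_{♯η'} η` for `η ∈ S^a`, `η' ∈ S^p`, `p + a = n + 1`. -/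
theorem sharpGraph_skew {p a : ℕ} {x : ⋀[ℝ]^p (MCoord n m) × Alt (MCoord n m) a}
    {x' : ⋀[ℝ]^a (MCoord n m) × Alt (MCoord n m) p}
    (hx : x ∈ sharpGraph n m p a) (hx' : x' ∈ sharpGraph n m a p) :
    pair x'.2 x.1 = (-1) ^ (p * a) * pair x.2 x'.1 := by
  induction hx using Submodule.span_induction with
  | zero => simp
  | add x y _ _ hx hy =>
    rw [Prod.fst_add, Prod.snd_add, map_add, map_add, LinearMap.add_apply, hx, hy, mul_add]
  | smul c x _ hx =>
    rw [Prod.smul_fst, Prod.smul_snd, map_smul, map_smul, LinearMap.smul_apply, hx, smul_eq_mul,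
      smul_eq_mul, mul_left_comm]
  | mem x hx =>
    induction hx' using Submodule.span_induction with
    | zero => simp
    | add x y _ _ hx hy =>
      rw [Prod.fst_add, Prod.snd_add, map_add, map_add, LinearMap.add_apply, hx, hy, mul_add]
    | smul c x _ hx =>
      rw [Prod.smul_fst, Prod.smul_snd, map_smul, map_smul, LinearMap.smul_apply, hx, smul_eq_mul,
        smul_eq_mul, mul_left_comm]
    | mem x' hx' =>
      obtain ⟨k, h, hp, U, w, hw, rfl⟩ := hx
      obtain ⟨k', h', hp', U', w', hw', rfl⟩ := hx'
      exact sharpGraph_skew_aux h hp h' hp' U U' hw hw'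

/-- `♯_a` is well defined modulo `K_p`. -/
theorem mem_K_of_graph {p a : ℕ} (hpa : p + a = n + 1) {W : ⋀[ℝ]^p (MCoord n m)}
    (hW : (W, (0 : Alt (MCoord n m) a)) ∈ sharpGraph n m p a) : W ∈ K n m p := by
  intro η hη
  obtain ⟨W', hW'⟩ := exists_sharp (p := a) (a := p) (by omega) hη
  have h := sharpGraph_skew hW hW'
  simp only [map_zero, LinearMap.zero_apply, mul_zero] at h
  ext r
  rw [← pair_ιMulti, pair_contract, AlternatingMap.zero_apply]
  have : exteriorPower.ιMulti ℝ 0 r = (⟨1, SetLike.GradedOne.one_mem⟩ : ⋀[ℝ]^0 (MCoord n m)) :=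
    Subtype.ext (by simp)
  rw [this]
  refine Eq.trans (congrArg _ (Subtype.ext ?_)) h
  rw [coe_wedge, mul_one]

/-- The map `♯_a : S^a → ⋀^p TM / K_p`, `p = n + 1 - a`, with `♯_a(ι_U σ) = ♯_n(σ) ∧ U + K_p` for
`σ ∈ Sⁿ`. -/
def sharp {p a : ℕ} (hpa : p + a = n + 1) : S n m a →ₗ[ℝ] (⋀[ℝ]^p (MCoord n m) ⧸ K n m p) where
  toFun η := (K n m p).mkQ (exists_sharp hpa η.2).choose
  map_add' η ζ := by
    rw [← map_add, ← sub_eq_zero, ← map_sub, Submodule.mkQ_apply, Submodule.Quotient.mk_eq_zero]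
    refine mem_K_of_graph hpa ?_
    have := Submodule.sub_mem _ (exists_sharp hpa (η + ζ).2).choose_spec
      (Submodule.add_mem _ (exists_sharp hpa η.2).choose_spec (exists_sharp hpa ζ.2).choose_spec)
    simpa using this
  map_smul' c η := by
    rw [RingHom.id_apply, ← map_smul, ← sub_eq_zero, ← map_sub, Submodule.mkQ_apply,
      Submodule.Quotient.mk_eq_zero]
    refine mem_K_of_graph hpa ?_
    have := Submodule.sub_mem _ (exists_sharp hpa (c • η).2).choose_spec
      (Submodule.smul_mem _ c (exists_sharp hpa η.2).choose_spec)
    simpa using this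

theorem sharp_eq {p a : ℕ} (hpa : p + a = n + 1) {η : S n m a} {W : ⋀[ℝ]^p (MCoord n m)}
    (hW : (W, (η : Alt (MCoord n m) a)) ∈ sharpGraph n m p a) :
    sharp hpa η = (K n m p).mkQ W := by
  change (K n m p).mkQ _ = _
  rw [← sub_eq_zero, ← map_sub, Submodule.mkQ_apply, Submodule.Quotient.mk_eq_zero]
  refine mem_K_of_graph hpa ?_
  have := Submodule.sub_mem _ (exists_sharp hpa η.2).choose_spec hW
  simpa using this

theorem contract_eq_zero_of_mem_K {p c N : ℕ} (h : p + c = N) {W : ⋀[ℝ]^p (MCoord n m)}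
    (hW : W ∈ K n m p) {η : Alt (MCoord n m) N} (hη : η ∈ S n m N) : contract h W η = 0 := by
  induction hη using Submodule.span_induction with
  | zero => rw [map_zero]
  | add x y _ _ hx hy => rw [map_add, hx, hy, add_zero]
  | smul c x _ hx => rw [map_smul, hx, smul_zero]
  | mem η hη =>
    obtain ⟨k, hk, U, σ, hσ, rfl⟩ := hη
    ext r
    set R := exteriorPower.ιMulti ℝ c r
    have hl : k + c + p = n := by omega
    have h0 := hW _ (Submodule.subset_span ⟨k + c, hl, wedge rfl U R, σ, hσ, rfl⟩)
    have h1 : pair (contract (add_zero p) W (contract hl (wedge rfl U R) σ))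
        ⟨1, SetLike.GradedOne.one_mem⟩ = 0 := by rw [h0, map_zero]; rfl
    rw [pair_contract, pair_contract] at h1
    rw [← pair_ιMulti, pair_contract, pair_contract, AlternatingMap.zero_apply]
    have : wedge hk U (wedge h W R) = ((-1 : ℝ) ^ (p * c)) •
        wedge hl (wedge rfl U R) (wedge (add_zero p) W ⟨1, SetLike.GradedOne.one_mem⟩) := by
      refine Subtype.ext ?_
      change (U : ExteriorAlgebra ℝ (MCoord n m)) * (W * R) = _ • ((U * R) * (W * 1))
      rw [mul_comm_graded _ _ W.2 R.2, mul_one, mul_assoc, mul_smul_comm]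
    rw [this, map_smul, h1, smul_zero]

/-- The contraction of a form in `S^N` with a class of multivectors modulo `K_p`. -/
def contractQ {p c N : ℕ} (h : p + c = N) (η : S n m N) :
    (⋀[ℝ]^p (MCoord n m) ⧸ K n m p) →ₗ[ℝ] Alt (MCoord n m) c :=
  (K n m p).liftQ ((contract h).flip η.1) fun _ hW => contract_eq_zero_of_mem_K h hW η.2

open Classical in
/-- `(-1)^{deg_H β} ι_{♯_{b+1}(B)} A` for `A ∈ S^{a+1}`, `B ∈ S^{b+1}` (the values of `dα`, `dβ` at a
point, `deg α = a`, `deg β = b`), where `deg_H β = n - 1 - b`. -/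
def bracketAt {a b c : ℕ} (hb : b < n) (hc : c + (n - 1) = a + b)
    (A : Alt (MCoord n m) (a + 1)) (B : Alt (MCoord n m) (b + 1)) : Alt (MCoord n m) c :=
  if h : A ∈ S n m (a + 1) ∧ B ∈ S n m (b + 1) then
    (-1 : ℝ) ^ (n - 1 - b) • contractQ (p := n - b) (by omega) ⟨A, h.1⟩
      (sharp (p := n - b) (a := b + 1) (by omega) ⟨B, h.2⟩)
  else 0

/-- The `(a+1)`-forms without `dp`-terms that are at most `1`-vertical: the span of the forms
`dx^{μ₀} ∧ ⋯ ∧ dx^{μ_a}` and `dy^i ∧ dx^{ν₁} ∧ ⋯ ∧ dx^{ν_a}`. -/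
def dxdySpan (n m a : ℕ) : Submodule ℝ (Alt (MCoord n m) (a + 1)) :=
  Submodule.span ℝ (range (fun I : Fin (a + 1) → Fin n => covecWedge fun j => dx (I j)) ∪
    range fun x : Fin m × (Fin a → Fin n) =>
      covecWedge (Matrix.vecCons (dy x.1) fun j => dx (x.2 j)))

end MCoord
end Canonical

/-! ### Fibered manifolds and the reduced bundle -/

section Reduced

/-- The model space `ℝⁿ`. -/
abbrev Euc (n : ℕ) : Type := EuclideanSpace ℝ (Fin n)

variable {n m : ℕ} {X Y : Type*} [TopologicalSpace X] [ChartedSpace (Euc n) X]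
  [TopologicalSpace Y] [ChartedSpace (Euc (n + m)) Y]

variable (n m X Y) in
/-- A fibered manifold `π : Y → X` (surjective submersion) over an `n`-dimensional manifold, with
`m`-dimensional fibers. -/
structure FiberedManifold where
  proj : Y → X
  surjective : Function.Surjective proj
  submersion : Manifold.IsSubmersion 𝓘(ℝ, Euc (n + m)) 𝓘(ℝ, Euc n) ∞ proj

namespace FiberedManifold

variable (P : FiberedManifold n m X Y)

/-- The tangent space `T_y Y`. -/
abbrev TY (_ : FiberedManifold n m X Y) (y : Y) : Type := TangentSpace 𝓘(ℝ, Euc (n + m)) y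

/-- The vertical tangent vectors, `ker dπ`. -/
def vertical (y : Y) : Submodule ℝ (P.TY y) :=
  LinearMap.ker (mfderiv 𝓘(ℝ, Euc (n + m)) 𝓘(ℝ, Euc n) P.proj y).toLinearMap

/-- `⋀ⁿ_r Y` at `y`. -/
abbrev Lam (r : ℕ) (y : Y) : Submodule ℝ (Alt (P.TY y) n) := horizontalForms (P.vertical y) n r

/-- The fiber of `⋀ⁿ₂Y / ⋀ⁿ₁Y` at `y`. -/
abbrev Fiber (y : Y) : Type := reducedForms (P.vertical y) n

/-- The total space `M = ⋀ⁿ₂Y / ⋀ⁿ₁Y`. -/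
def Reduced : Type _ := Σ y : Y, P.Fiber y

/-- Fibered coordinates `(x^μ, y^i)` on an open subset of `Y`, over coordinates `(x^μ)` on `X`. -/
structure AdaptedChart where
  chart : OpenPartialHomeomorph Y (YCoord n m)
  base : OpenPartialHomeomorph X (Fin n → ℝ)
  contMDiffOn_chart : ContMDiffOn 𝓘(ℝ, Euc (n + m)) 𝓘(ℝ, YCoord n m) ∞ chart chart.source
  contMDiffOn_chart_symm :
    ContMDiffOn 𝓘(ℝ, YCoord n m) 𝓘(ℝ, Euc (n + m)) ∞ chart.symm chart.target
  contMDiffOn_base : ContMDiffOn 𝓘(ℝ, Euc n) 𝓘(ℝ, Fin n → ℝ) ∞ base base.source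
  contMDiffOn_base_symm : ContMDiffOn 𝓘(ℝ, Fin n → ℝ) 𝓘(ℝ, Euc n) ∞ base.symm base.target
  proj_mem : ∀ y ∈ chart.source, P.proj y ∈ base.source
  base_proj : ∀ y ∈ chart.source, base (P.proj y) = (chart y).1

theorem exists_adaptedChart (y : Y) : ∃ c : P.AdaptedChart, y ∈ c.chart.source := by
  obtain ⟨F, _, _, hF⟩ := P.submersion
  have h := hF y
  have e1 := h.equiv
  have : FiniteDimensional ℝ (Euc n × F) := e1.toLinearEquiv.finiteDimensional
  have : FiniteDimensional ℝ F := Module.Finite.of_surjective (LinearMap.snd ℝ (Euc n) F) LinearMap.snd_surjective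
  have hfr : Module.finrank ℝ F = Module.finrank ℝ (Fin m → ℝ) := by
    have := e1.toLinearEquiv.finrank_eq
    simp at this ⊢
    omega
  let eF : F ≃L[ℝ] (Fin m → ℝ) := ContinuousLinearEquiv.ofFinrankEq hfr
  let eX : Euc n ≃L[ℝ] (Fin n → ℝ) := EuclideanSpace.equiv (Fin n) ℝ
  let e : Euc (n + m) ≃L[ℝ] YCoord n m := h.equiv.trans (eX.prodCongr eF)
  have hd := h.domChart_mem_maximalAtlas
  have hc := h.codChart_mem_maximalAtlas
  refine ⟨⟨h.domChart.trans e.toHomeomorph.toOpenPartialHomeomorph,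
    h.codChart.trans eX.toHomeomorph.toOpenPartialHomeomorph, ?_, ?_, ?_, ?_, ?_, ?_⟩, ?_⟩
  · have := e.contDiff.contMDiff (n := ∞) |>.comp_contMDiffOn (contMDiffOn_of_mem_maximalAtlas hd)
    exact this.mono (by simp)
  · have := (contMDiffOn_symm_of_mem_maximalAtlas hd).comp
      (e.symm.contDiff.contMDiff (n := ∞)).contMDiffOn (s := e.symm ⁻¹' h.domChart.target) (fun _ h => h)
    exact this.mono (by simp)
  · have := eX.contDiff.contMDiff (n := ∞) |>.comp_contMDiffOn (contMDiffOn_of_mem_maximalAtlas hc)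
    exact this.mono (by simp)
  · have := (contMDiffOn_symm_of_mem_maximalAtlas hc).comp
      (eX.symm.contDiff.contMDiff (n := ∞)).contMDiffOn (s := eX.symm ⁻¹' h.codChart.target) (fun _ h => h)
    exact this.mono (by simp)
  · intro y hy
    simp at hy ⊢
    exact h.mapsto_domChart_source_codChart_source hy
  · intro y hy
    simp at hy ⊢
    have := h.writtenInCharts (show h.domChart y ∈ _ by simpa using h.domChart.map_source hy)
    simp [h.domChart.left_inv hy] at this
    simp [e, this]
  · simpa using h.mem_domChart_source


namespace AdaptedChart

variable {P} (c : P.AdaptedChart)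

/-- The differential of the coordinates at `y`. -/
def dchart (y : Y) : P.TY y →ₗ[ℝ] YCoord n m :=
  (mfderiv 𝓘(ℝ, Euc (n + m)) 𝓘(ℝ, YCoord n m) c.chart y).toLinearMap

/-- The coordinate vectors at `y`: `frame y (ex μ) = ∂/∂x^μ`, `frame y (ey i) = ∂/∂y^i`. -/
def frame (y : Y) : YCoord n m →ₗ[ℝ] P.TY y :=
  (mfderiv 𝓘(ℝ, YCoord n m) 𝓘(ℝ, Euc (n + m)) c.chart.symm (c.chart y)).toLinearMap

theorem mdiff_chart {y : Y} (hy : y ∈ c.chart.source) :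
    MDifferentiableAt 𝓘(ℝ, Euc (n + m)) 𝓘(ℝ, YCoord n m) c.chart y :=
  ((c.contMDiffOn_chart y hy).contMDiffAt (c.chart.open_source.mem_nhds hy)).mdifferentiableAt
    (by simp)

theorem mdiff_symm {z : YCoord n m} (hz : z ∈ c.chart.target) :
    MDifferentiableAt 𝓘(ℝ, YCoord n m) 𝓘(ℝ, Euc (n + m)) c.chart.symm z :=
  ((c.contMDiffOn_chart_symm z hz).contMDiffAt (c.chart.open_target.mem_nhds hz)).mdifferentiableAt
    (by simp)

theorem dchart_frame {y : Y} (hy : y ∈ c.chart.source) (v : YCoord n m) :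
    c.dchart y (c.frame y v) = v := by
  have hz := c.chart.map_source hy
  have h1 := mfderiv_comp_of_eq (x := c.chart y) (c.mdiff_chart hy) (c.mdiff_symm hz)
    (c.chart.left_inv hy)
  have h2 : (c.chart ∘ c.chart.symm) =ᶠ[𝓝 (c.chart y)] id :=
    Filter.eventually_of_mem (c.chart.open_target.mem_nhds hz) fun w hw => c.chart.right_inv hw
  rw [h2.mfderiv_eq, mfderiv_id, c.chart.left_inv hy] at h1
  exact (DFunLike.congr_fun h1 v).symm

theorem frame_dchart {y : Y} (hy : y ∈ c.chart.source) (v : P.TY y) :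
    c.frame y (c.dchart y v) = v := by
  have h1 := mfderiv_comp y (c.mdiff_symm (c.chart.map_source hy)) (c.mdiff_chart hy)
  have h2 : (c.chart.symm ∘ c.chart) =ᶠ[𝓝 y] id :=
    Filter.eventually_of_mem (c.chart.open_source.mem_nhds hy) fun w hw => c.chart.left_inv hw
  rw [h2.mfderiv_eq, mfderiv_id] at h1
  exact (DFunLike.congr_fun h1 v).symm

theorem mem_vertical {y : Y} (hy : y ∈ c.chart.source) (v : P.TY y) :
    v ∈ P.vertical y ↔ c.dchart y v ∈ YCoord.vert n m := by
  have hx := c.proj_mem y hy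
  have hπ : MDifferentiableAt 𝓘(ℝ, Euc (n + m)) 𝓘(ℝ, Euc n) P.proj y :=
    (P.submersion.contMDiff y).mdifferentiableAt (by simp)
  have hb : MDifferentiableAt 𝓘(ℝ, Euc n) 𝓘(ℝ, Fin n → ℝ) c.base (P.proj y) :=
    ((c.contMDiffOn_base _ hx).contMDiffAt (c.base.open_source.mem_nhds hx)).mdifferentiableAt
      (by simp)
  have hb' : MDifferentiableAt 𝓘(ℝ, Fin n → ℝ) 𝓘(ℝ, Euc n) c.base.symm (c.base (P.proj y)) :=
    ((c.contMDiffOn_base_symm _ (c.base.map_source hx)).contMDiffAt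
      (c.base.open_target.mem_nhds (c.base.map_source hx))).mdifferentiableAt (by simp)
  have h1 := mfderiv_comp y hb hπ
  have h2 : (c.base ∘ P.proj) =ᶠ[𝓝 y] Prod.fst ∘ c.chart :=
    Filter.eventually_of_mem (c.chart.open_source.mem_nhds hy) fun w hw => c.base_proj w hw
  have h3 := mfderiv_comp y (I' := 𝓘(ℝ, YCoord n m)) (I'' := 𝓘(ℝ, Fin n → ℝ)) (g := Prod.fst)
    (f := c.chart) differentiableAt_fst.mdifferentiableAt (c.mdiff_chart hy)
  rw [h2.mfderiv_eq, h3] at h1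
  have h4 := mfderiv_comp_of_eq (x := P.proj y) hb' hb rfl
  have h5 : (c.base.symm ∘ c.base) =ᶠ[𝓝 (P.proj y)] id :=
    Filter.eventually_of_mem (c.base.open_source.mem_nhds hx) fun w hw => c.base.left_inv hw
  rw [h5.mfderiv_eq, mfderiv_id] at h4
  have h6 : ∀ v, (c.dchart y v).1 = mfderiv 𝓘(ℝ, Euc n) 𝓘(ℝ, Fin n → ℝ) c.base (P.proj y)
      (mfderiv 𝓘(ℝ, Euc (n + m)) 𝓘(ℝ, Euc n) P.proj y v) := by
    intro v
    have := DFunLike.congr_fun h1 v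
    rw [mfderiv_eq_fderiv, fderiv_fst] at this
    exact this
  constructor
  · intro hv
    have hv' : mfderiv 𝓘(ℝ, Euc (n + m)) 𝓘(ℝ, Euc n) P.proj y v = 0 := hv
    change (c.dchart y v).1 = 0
    rw [h6, hv']
    exact map_zero _
  · intro hv
    have hv' : (c.dchart y v).1 = 0 := hv
    rw [h6] at hv'
    have := DFunLike.congr_fun h4 (mfderiv 𝓘(ℝ, Euc (n + m)) 𝓘(ℝ, Euc n) P.proj y v)
    exact this.trans ((congrArg _ hv').trans (ContinuousLinearMap.map_zero _))

theorem frame_mem_vertical {y : Y} (hy : y ∈ c.chart.source) {v : YCoord n m}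
    (hv : v ∈ YCoord.vert n m) : c.frame y v ∈ P.vertical y := by
  rw [c.mem_vertical hy, c.dchart_frame hy]
  exact hv

/-- The momentum coordinates `p^μ_i` of a class `[η]`, where
`η = p dⁿx + ∑ p^μ_i dy^i ∧ dⁿ⁻¹x_μ`: the coefficient `p^μ_i` is the value of `η` on
`(∂/∂x¹, …, ∂/∂y^i, …, ∂/∂xⁿ)`, with `∂/∂y^i` in the `μ`-th slot. -/
def momentum (x : P.Reduced) : Fin n → Fin m → ℝ := fun μ i =>
  (Quotient.out x.2 : P.Lam 2 x.1).1
    fun ν => c.frame x.1 (Function.update YCoord.ex μ (YCoord.ey i) ν)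

theorem momentum_mk {y : Y} (hy : y ∈ c.chart.source) (η : P.Lam 2 y) (μ : Fin n) (i : Fin m) :
    c.momentum ⟨y, reducedForms.mk η⟩ μ i =
      η.1 fun ν => c.frame y (Function.update YCoord.ex μ (YCoord.ey i) ν) := by
  have h : reducedForms.mk (Quotient.out (reducedForms.mk η) : P.Lam 2 y) = reducedForms.mk η :=
    Quotient.out_eq _
  rw [reducedForms.mk_eq] at h
  have := h (fun ν => c.frame y (Function.update YCoord.ex μ (YCoord.ey i) ν)) {μ} (by simp) (by
    intro k hk
    obtain rfl := Finset.mem_singleton.1 hk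
    simp only [Function.update_self]
    exact c.frame_mem_vertical hy (by simp [YCoord.vert, YCoord.ey]))
  exact sub_eq_zero.1 this

/-- The form `p^μ_i dy^i ∧ dⁿ⁻¹x_μ` at `y`. -/
def formOf (y : Y) (p : Fin n → Fin m → ℝ) : Alt (P.TY y) n :=
  (∑ μ, ∑ i, p μ i • YCoord.dyx μ i).compLinearMap (c.dchart y)

theorem formOf_mem {y : Y} (hy : y ∈ c.chart.source) (p : Fin n → Fin m → ℝ) :
    c.formOf y p ∈ P.Lam 2 y := 
  horizontalForms_comp (K := YCoord.vert n m)
    (Submodule.sum_mem _ fun μ _ => Submodule.sum_mem _ fun i _ =>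
      Submodule.smul_mem _ _ (YCoord.dyx_mem μ i)) _
    fun w hw => (c.mem_vertical hy w).1 hw

theorem sum_dyx_apply (p : Fin n → Fin m → ℝ) (ν : Fin n) (j : Fin m) :
    (∑ μ, ∑ i, p μ i • YCoord.dyx μ i) (Function.update YCoord.ex ν (YCoord.ey j)) = p ν j := by
  simp only [alt_sum_apply, AlternatingMap.smul_apply, YCoord.dyx_apply]
  rw [Finset.sum_eq_single ν (by intro b _ hb; simp [hb]) (by simp),
    Finset.sum_eq_single j (by intro b _ hb; simp [hb]) (by simp)]
  simp

/-- The coordinates `(x^μ, y^i, p^μ_i)` on `M` induced by fibered coordinates on `Y`. -/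
def partialEquiv : PartialEquiv P.Reduced (MCoord n m) where
  toFun x := (c.chart x.1, c.momentum x)
  invFun z := ⟨c.chart.symm z.1, reducedForms.ofAlt _ n (c.formOf (c.chart.symm z.1) z.2)⟩
  source := {x | x.1 ∈ c.chart.source}
  target := c.chart.target ×ˢ univ
  map_source' x hx := ⟨c.chart.map_source hx, trivial⟩
  map_target' z hz := c.chart.map_target hz.1
  left_inv' := by
    rintro ⟨y, q⟩ (hy : y ∈ c.chart.source)
    obtain ⟨η, rfl⟩ : ∃ η, reducedForms.mk η = q := ⟨Quotient.out q, Quotient.out_eq q⟩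
    dsimp only
    rw [c.chart.left_inv hy, reducedForms.ofAlt, dif_pos (c.formOf_mem hy _)]
    congr 1
    rw [reducedForms.mk_eq]
    have key : ((∑ μ, ∑ i, c.momentum ⟨y, reducedForms.mk η⟩ μ i • YCoord.dyx μ i) -
        η.1.compLinearMap (c.frame y)) ∈ horizontalForms (YCoord.vert n m) n 1 := by
      refine YCoord.mem_one_of_coord (Submodule.sub_mem _ ?_ ?_) fun μ i => ?_
      · exact Submodule.sum_mem _ fun μ _ => Submodule.sum_mem _ fun i _ =>
          Submodule.smul_mem _ _ (YCoord.dyx_mem μ i)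
      · exact horizontalForms_comp η.2 _ fun w hw => c.frame_mem_vertical hy hw
      · rw [AlternatingMap.sub_apply, sum_dyx_apply, c.momentum_mk hy]
        exact sub_self _
    have := horizontalForms_comp (K' := P.vertical y) key (c.dchart y)
      fun w hw => (c.mem_vertical hy w).1 hw
    convert this using 1
    ext w
    simp only [formOf, AlternatingMap.sub_apply, AlternatingMap.compLinearMap_apply]
    simp [c.frame_dchart hy]
  right_inv' := by
    rintro ⟨z, p⟩ ⟨hz, -⟩
    have hy := c.chart.map_target hz
    dsimp only
    rw [reducedForms.ofAlt, dif_pos (c.formOf_mem hy _), c.chart.right_inv hz]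
    congr 1
    ext μ i
    rw [c.momentum_mk hy]
    simp only [formOf, AlternatingMap.compLinearMap_apply, c.dchart_frame hy]
    exact sum_dyx_apply p μ i

theorem partialEquiv_trans_source (c c' : P.AdaptedChart) :
    (c.partialEquiv.symm.trans c'.partialEquiv).source =
      (c.chart.symm.trans c'.chart).source ×ˢ univ := by
  ext ⟨z, p⟩
  constructor
  · rintro ⟨⟨h1, -⟩, h2⟩
    exact ⟨⟨h1, h2⟩, trivial⟩
  · rintro ⟨⟨h1, h2⟩, -⟩
    exact ⟨⟨h1, trivial⟩, h2⟩

theorem contDiffOn_transition (c c' : P.AdaptedChart) :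
    ContDiffOn ℝ ∞ (c.chart.symm.trans c'.chart) (c.chart.symm.trans c'.chart).source := by
  rw [← contMDiffOn_iff_contDiffOn]
  exact c'.contMDiffOn_chart.comp
    (c.contMDiffOn_chart_symm.mono (t := (c.chart.symm.trans c'.chart).source) fun z hz => hz.1)
    fun z hz => hz.2

theorem dchart_frame_eq (c c' : P.AdaptedChart) {y : Y} (hy : y ∈ c.chart.source)
    (hy' : y ∈ c'.chart.source) (v : YCoord n m) :
    c.dchart y (c'.frame y v) = fderiv ℝ (c'.chart.symm.trans c.chart) (c'.chart y) v := by
  have h1 := mfderiv_comp_of_eq (x := c'.chart y) (c.mdiff_chart hy)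
    (c'.mdiff_symm (c'.chart.map_source hy')) (c'.chart.left_inv hy')
  rw [c'.chart.left_inv hy'] at h1
  have := DFunLike.congr_fun h1 v
  rw [mfderiv_eq_fderiv] at this
  exact this.symm

theorem transition_apply (c c' : P.AdaptedChart) {z : MCoord n m}
    (hz : z ∈ (c.partialEquiv.symm.trans c'.partialEquiv).source) :
    c.partialEquiv.symm.trans c'.partialEquiv z =
      (c.chart.symm.trans c'.chart z.1, fun ν j => (∑ μ, ∑ i, z.2 μ i • YCoord.dyx μ i) fun k =>
        fderiv ℝ (c'.chart.symm.trans c.chart) (c.chart.symm.trans c'.chart z.1)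
          (Function.update YCoord.ex ν (YCoord.ey j) k)) := by
  rw [partialEquiv_trans_source] at hz
  obtain ⟨z, p⟩ := z
  have hz1 : z ∈ c.chart.target ∧ c.chart.symm z ∈ c'.chart.source := by simpa using hz
  have hy := c.chart.map_target hz1.1
  refine Prod.ext rfl ?_
  change c'.momentum ⟨c.chart.symm z, reducedForms.ofAlt _ n (c.formOf (c.chart.symm z) p)⟩ = _
  ext ν j
  rw [reducedForms.ofAlt, dif_pos (c.formOf_mem hy _), c'.momentum_mk hz1.2]
  simp only [formOf, AlternatingMap.compLinearMap_apply]
  congr 1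
  ext1 k
  exact dchart_frame_eq c c' hy hz1.2 _

theorem contDiffOn_partialEquiv (c c' : P.AdaptedChart) :
    ContDiffOn ℝ ∞ (c.partialEquiv.symm.trans c'.partialEquiv)
      (c.partialEquiv.symm.trans c'.partialEquiv).source := by
  refine ContDiffOn.congr ?_ fun z hz => transition_apply c c' hz
  rw [partialEquiv_trans_source]
  have hτ := (contDiffOn_transition c c').comp (t := (c.chart.symm.trans c'.chart).source)
    (contDiffOn_fst (𝕜 := ℝ) (n := ∞) (s := (c.chart.symm.trans c'.chart).source ×ˢ
      (univ : Set (Fin n → Fin m → ℝ)))) (fun z hz => hz.1)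
  have hd : ContDiffOn ℝ ∞ (fun z => fderiv ℝ (c'.chart.symm.trans c.chart) z)
      (c'.chart.symm.trans c.chart).source :=
    (contDiffOn_transition c' c).fderiv_of_isOpen (OpenPartialHomeomorph.open_source _) (by simp)
  have hA := hd.comp hτ (by
    intro z hz
    have := (c.chart.symm.trans c'.chart).map_source hz.1
    simpa using this)
  refine hτ.prodMk (contDiffOn_pi.2 fun ν => contDiffOn_pi.2 fun j => ?_)
  simp only [alt_sum_apply, AlternatingMap.smul_apply, smul_eq_mul]
  refine ContDiffOn.sum fun μ _ => ContDiffOn.sum fun i _ => ContDiffOn.mul ?_ ?_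
  · exact (contDiff_apply_apply ℝ ℝ μ i).comp_contDiffOn contDiffOn_snd
  · simp only [YCoord.dyx, covecWedge_apply, Matrix.det_apply, Matrix.of_apply]
    refine ContDiffOn.sum fun σ _ => ContDiffOn.const_smul _ (contDiffOn_prod fun k _ => ?_)
    exact (LinearMap.toContinuousLinearMap _).contDiff.comp_contDiffOn
      (hA.clm_apply contDiffOn_const)

end AdaptedChart


/-- The atlas of `M` by the coordinates `(x^μ, y^i, p^μ_i)`. -/
def chartedSpaceCore : ChartedSpaceCore (MCoord n m) P.Reduced where
  atlas := range AdaptedChart.partialEquiv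
  chartAt x := (P.exists_adaptedChart x.1).choose.partialEquiv
  mem_chart_source x := (P.exists_adaptedChart x.1).choose_spec
  chart_mem_atlas x := mem_range_self _
  open_source := by
    rintro _ _ ⟨c, rfl⟩ ⟨c', rfl⟩
    rw [AdaptedChart.partialEquiv_trans_source]
    exact (OpenPartialHomeomorph.open_source _).prod isOpen_univ
  continuousOn_toFun := by
    rintro _ _ ⟨c, rfl⟩ ⟨c', rfl⟩
    exact (AdaptedChart.contDiffOn_partialEquiv c c').continuousOn

instance : TopologicalSpace P.Reduced := P.chartedSpaceCore.toTopologicalSpace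

instance : ChartedSpace (MCoord n m) P.Reduced := P.chartedSpaceCore.toChartedSpace

theorem mem_atlas_iff (e : OpenPartialHomeomorph P.Reduced (MCoord n m)) :
    e ∈ atlas (MCoord n m) P.Reduced ↔ ∃ c : P.AdaptedChart, e.toPartialEquiv = c.partialEquiv := by
  change e ∈ ⋃ (e' : PartialEquiv P.Reduced (MCoord n m)) (he : e' ∈ P.chartedSpaceCore.atlas),
    {P.chartedSpaceCore.openPartialHomeomorph e' he} ↔ _
  simp only [mem_iUnion, mem_singleton_iff]
  constructor
  · rintro ⟨_, ⟨c, rfl⟩, rfl⟩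
    exact ⟨c, rfl⟩
  · rintro ⟨c, hc⟩
    exact ⟨_, ⟨c, rfl⟩, OpenPartialHomeomorph.toPartialEquiv_injective hc⟩

instance : IsManifold 𝓘(ℝ, MCoord n m) ∞ P.Reduced := by
  refine isManifold_of_contDiffOn _ _ _ fun e e' he he' => ?_
  obtain ⟨c, hc⟩ := (P.mem_atlas_iff e).1 he
  obtain ⟨c', hc'⟩ := (P.mem_atlas_iff e').1 he'
  have h : (e.symm.trans e').toPartialEquiv = c.partialEquiv.symm.trans c'.partialEquiv := by
    rw [← hc, ← hc']; rfl
  have := AdaptedChart.contDiffOn_partialEquiv c c'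
  rw [← h] at this
  simpa using this

/-- The projection `τ : M → X`. -/
def toBase (x : P.Reduced) : X := P.proj x.1

end FiberedManifold
end Reduced

/-! ### Differential forms on manifolds, through their local representatives -/

section Forms

variable {E : Type*} [NormedAddCommGroup E] [NormedSpace ℝ E]

theorem alt_continuous [FiniteDimensional ℝ E] {k : ℕ} (η : Alt E k) : Continuous η := by
  let b := Module.finBasis ℝ E
  have h : ∀ v : Fin k → E, η v =
      ∑ s : Fin k → Fin (Module.finrank ℝ E), (∏ i, b.repr (v i) (s i)) • η fun i => b (s i) := by
    intro v
    conv_lhs => rw [show v = fun i => ∑ j, b.repr (v i) j • b j from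
      funext fun i => (b.sum_repr (v i)).symm]
    change η.toMultilinearMap _ = _
    rw [MultilinearMap.map_sum]
    exact Finset.sum_congr rfl fun s _ => η.toMultilinearMap.map_smul_univ _ _
  rw [show (η : (Fin k → E) → ℝ) = _ from funext h]
  simp only [smul_eq_mul]
  refine continuous_finsetSum _ fun s _ => Continuous.mul ?_ continuous_const
  refine continuous_finsetProd _ fun i _ => ?_
  exact (LinearMap.continuous_of_finiteDimensional (b.coord (s i))).comp (continuous_apply i)

/-- An alternating form on a finite-dimensional space, as a continuous alternating form. -/
def toCont [FiniteDimensional ℝ E] {k : ℕ} (η : Alt E k) : E [⋀^Fin k]→L[ℝ] ℝ :=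
  { η with cont := alt_continuous η }

/-- The exterior product of two alternating forms (sum over shuffles). -/
def wedgeForm [FiniteDimensional ℝ E] {a b : ℕ} (α : E [⋀^Fin a]→L[ℝ] ℝ) (β : E [⋀^Fin b]→L[ℝ] ℝ) :
    E [⋀^Fin (a + b)]→L[ℝ] ℝ :=
  toCont (((LinearMap.mul' ℝ ℝ).compAlternatingMap
    (α.toAlternatingMap.domCoprod β.toAlternatingMap)).domDomCongr finSumFinEquiv)

variable {N : Type*} [TopologicalSpace N] [ChartedSpace E N]

variable (E N) in
/-- Families of local representatives of a `k`-form on `N`, one in each chart.  Only the values in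
charts `e` of the atlas and on `e.target` matter. -/
abbrev FormRep (k : ℕ) : Type _ := OpenPartialHomeomorph N E → E → E [⋀^Fin k]→L[ℝ] ℝ

/-- The family `α` represents a smooth differential form on `N`: the representatives are smooth and
are related by pullback along the changes of coordinates. -/
def IsForm {k : ℕ} (α : FormRep E N k) : Prop :=
  (∀ e ∈ atlas E N, ContDiffOn ℝ ∞ (α e) e.target) ∧
  ∀ e ∈ atlas E N, ∀ e' ∈ atlas E N, ∀ z ∈ (e.symm.trans e').source,
    α e z = (α e' (e.symm.trans e' z)).compContinuousLinearMap (fderiv ℝ (e.symm.trans e') z)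

/-- `dα = 0`. -/
def IsClosedForm {k : ℕ} (α : FormRep E N k) : Prop :=
  ∀ e ∈ atlas E N, ∀ z ∈ e.target, extDeriv (α e) z = 0

/-- `α = τ^* β`. -/
def IsPullback {E' N' : Type*} [NormedAddCommGroup E'] [NormedSpace ℝ E'] [TopologicalSpace N']
    [ChartedSpace E' N'] (τ : N → N') {k : ℕ} (β : FormRep E' N' k) (α : FormRep E N k) : Prop :=
  ∀ e ∈ atlas E N, ∀ f ∈ atlas E' N', ∀ z ∈ e.target, τ (e.symm z) ∈ f.source →
    α e z = (β f (f (τ (e.symm z)))).compContinuousLinearMap (fderiv ℝ (f ∘ τ ∘ e.symm) z)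

end Forms

/-! ### Hamiltonian and special Hamiltonian forms -/

namespace FiberedManifold

variable {n m : ℕ} {X Y : Type*} [TopologicalSpace X] [ChartedSpace (Euc n) X]
  [TopologicalSpace Y] [ChartedSpace (Euc (n + m)) Y] (P : FiberedManifold n m X Y)

/-- Families of local representatives of `a`-forms on `M`, in the coordinates `(x, y, p)`. -/
abbrev MForm (a : ℕ) : Type _ := FormRep (MCoord n m) P.Reduced a

variable {P}

/-- `α` is a Hamiltonian form of degree `a`, `0 ≤ a ≤ n - 1`: `dα` takes values in `S^{a+1}`. -/
def IsHamiltonian {a : ℕ} (α : P.MForm a) : Prop :=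
  a < n ∧ IsForm α ∧ ∀ e ∈ atlas (MCoord n m) P.Reduced, ∀ z ∈ e.target,
    (extDeriv (α e) z).toAlternatingMap ∈ MCoord.S n m (a + 1)

/-- `ε = τ^* β` for some form `β` on `X`. -/
def IsBasic {k : ℕ} (ε : P.MForm k) : Prop :=
  IsForm ε ∧ ∃ β : FormRep (Euc n) X k, IsForm β ∧ IsPullback P.toBase β ε

/-- `α` is a special Hamiltonian form: `α` is Hamiltonian and `α ∧ ε` is a Hamiltonian
`(n-1)`-form for every closed basic `(n - 1 - a)`-form `ε`. -/
def IsSpecial {a : ℕ} (α : P.MForm a) : Prop :=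
  IsHamiltonian α ∧ ∀ k : ℕ, a + k + 1 = n → ∀ ε : P.MForm k, IsBasic ε → IsClosedForm ε →
    IsHamiltonian (P := P) (a := a + k) fun e z => wedgeForm (α e z) (ε e z)

/-- The graded Poisson bracket `{α, β} = (-1)^{deg_H β} ι_{♯_{b+1}(dβ)} dα` of an `a`-form and a
`b`-form, a form of degree `c = a + b - (n - 1)`. -/
def bracket {a b c : ℕ} (hb : b < n) (hc : c + (n - 1) = a + b) (α : P.MForm a) (β : P.MForm b) :
    P.MForm c :=
  fun e z => toCont (MCoord.bracketAt hb hc (extDeriv (α e) z).toAlternatingMap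
    (extDeriv (β e) z).toAlternatingMap)

end FiberedManifold
end ReducedFieldTheory
end

noncomputable section
namespace ReducedFieldTheory

/-! ### Exterior products of covectors -/

section CovecWedge

variable {V W : Type*} [AddCommGroup V] [Module ℝ V] [AddCommGroup W] [Module ℝ W]

/-! Everything rests on a pointwise description of special forms: `α` is special exactly when `dα`
takes values in one fixed subspace `specialS`, which is `Sⁿ` in degree `n - 1` and `dxdySpan` in
lower degrees (`isSpecial_iff`). Linearity and the assertions (i) and (ii) can be read off from
this.

Sufficiency: for closed `ε` one has `d(α ∧ ε) = dα ∧ ε`. A basic `ε` is killed by vertical vectors,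
so the product with a form of `dxdySpan` has again no `dp`-terms and is at most 1-vertical, and such
forms lie in `Sⁿ`. In degree `n - 1` the form `ε` is a function and only rescales `dα`.

Necessity: in the generators of `Sⁿ`, `dp^ν_j` occurs only with `dⁿ⁻¹x_ν`, which does not contain
`dx^ν`. Hence forms in `S^a` vanish on arguments that include `∂/∂p^ν_j` and `∂/∂x^ν`
(`S_le_annPair_conj`). If `a ≤ n - 2`, bump functions on `X` give closed basic forms with the value
`dx^{L₁} ∧ ⋯ ∧ dx^{L_k}`, `k ≥ 1`, at a chosen point. Taking `ν` among the `L_i` forces every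
coefficient of `dα` with a `dp^ν_j` to vanish (`mem_dxdySpan_of_wedgeAlt_mem`).

Bracket: if both degrees are below `n - 1`, then `♯(dβ)` is represented by a sum of multivectors
`∂/∂p ∧ U`, which contract to zero with `dα` (`bracketAt_eq_zero`). If `β` has degree `n - 1`, the
bracket is `ι_X dα` with `X = ♯_n(dβ)`; if instead `α` has degree `n - 1`, skew-symmetry of `♯`
gives the same expression with the roles exchanged and a minus sign. By Cartan's formula `d ι_X dα =
L_X dα`, so the flow of `X` must preserve `specialS` infinitesimally. At a point, `L_X` is a
directional derivative, which stays in the subspace, plus the action of the linear part of `X`.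
Since `dβ` is closed with values in `Sⁿ`, this linear part is vertical and, for `n ≥ 2`, sends
`∂/∂p^ν_j` to a combination of the `∂/∂p^ν_k` with the same `ν` (`sharpVec_derivative_ep`); this is
what both `dxdySpan` and `Sⁿ` require.

Globality: the local brackets must also fit together. The graph of `♯_n` consists of the pairs `(v,
σ)` with `v` vertical and `ι_v Ω + σ` a multiple of `dⁿx`, where `Ω = dΘ` and `Θ = p^μ_i dy^i ∧
dⁿ⁻¹x_μ` (`mem_sharpTop_iff`). Changes of coordinates of `M` preserve `Θ` up to a multiple `f dⁿx`,
hence `Ω` up to `df ∧ dⁿx` (`isCanonical_trans`), and therefore preserve `♯` and the bracket. -/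

theorem covecWedge_eq_sum {k : ℕ} (θ : Fin k → Module.Dual ℝ V) (v : Fin k → V) :
    covecWedge θ v = ∑ σ : Equiv.Perm (Fin k), Equiv.Perm.sign σ • ∏ i, θ i (v (σ i)) := by
  rw [covecWedge_apply, Matrix.det_apply]; rfl

theorem covecWedge_perm {k : ℕ} (θ : Fin k → Module.Dual ℝ V) (σ : Equiv.Perm (Fin k)) :
    covecWedge (θ ∘ σ) = Equiv.Perm.sign σ • covecWedge θ := by
  ext v
  rw [AlternatingMap.smul_apply, covecWedge_apply, covecWedge_apply]
  have := Matrix.det_permute' σ (Matrix.of fun i j => θ j (v i))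
  rw [Units.smul_def, zsmul_eq_mul, ← this]
  rfl

theorem covecWedge_eq_zero_of_row {k : ℕ} (θ : Fin k → Module.Dual ℝ V) (v : Fin k → V) (s : Fin k)
    (h : ∀ j, θ j (v s) = 0) : covecWedge θ v = 0 :=
  Matrix.det_eq_zero_of_row_eq_zero s h

theorem covecWedge_eq_zero_of_two_rows {k : ℕ} (θ : Fin k → Module.Dual ℝ V) (v : Fin k → V)
    {s t j₀ : Fin k} (hst : s ≠ t) (hs : ∀ j, j ≠ j₀ → θ j (v s) = 0)
    (ht : ∀ j, j ≠ j₀ → θ j (v t) = 0) : covecWedge θ v = 0 := by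
  rw [covecWedge_eq_sum]
  refine Finset.sum_eq_zero fun σ _ => ?_
  by_cases h : σ.symm s = j₀
  · have h2 : σ.symm t ≠ j₀ := fun h2 => hst (σ.symm.injective (h.trans h2.symm))
    rw [Finset.prod_eq_zero (Finset.mem_univ (σ.symm t)), smul_zero]
    simpa using ht _ h2
  · rw [Finset.prod_eq_zero (Finset.mem_univ (σ.symm s)), smul_zero]
    simpa using hs _ h

theorem covecWedge_eq_zero_of_not_injective {k : ℕ} {ι : Type*} (θ : ι → Module.Dual ℝ V)
    {I : Fin k → ι} (h : ¬ Injective I) : covecWedge (θ ∘ I) = 0 := by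
  simp only [Injective, not_forall] at h
  obtain ⟨a, b, hab, hne⟩ := h
  ext v
  exact Matrix.det_zero_of_column_eq hne fun i => by simp [hab]

theorem covecWedge_vecCons {k : ℕ} (φ : Module.Dual ℝ V) (θ : Fin k → Module.Dual ℝ V)
    (v : Fin (k + 1) → V) :
    covecWedge (Matrix.vecCons φ θ) v =
      ∑ i : Fin (k + 1), (-1) ^ (i : ℕ) * φ (v i) * covecWedge θ (i.removeNth v) := by
  rw [covecWedge_apply, Matrix.det_succ_column_zero]
  rfl

theorem covecWedge_vecCons_vecCons {k : ℕ} (φ : Module.Dual ℝ V) (θ : Fin k → Module.Dual ℝ V)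
    (v : V) (r : Fin k → V) (hv : ∀ j, θ j v = 0) :
    covecWedge (Matrix.vecCons φ θ) (Matrix.vecCons v r) = φ v * covecWedge θ r := by
  rw [covecWedge_vecCons, Finset.sum_eq_single 0]
  · simp [Matrix.vecCons]
  · intro i _ hi
    obtain ⟨i, rfl⟩ := Fin.exists_succ_eq.2 hi
    obtain ⟨k, rfl⟩ : ∃ l, k = l + 1 := ⟨k - 1, by have := i.2; omega⟩
    rw [covecWedge_eq_zero_of_row _ _ 0, mul_zero]
    simpa [Fin.removeNth, Matrix.vecCons] using hv
  · simp

/-- The coordinate expansion of an alternating form. -/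
theorem alt_eq_sum {ι : Type*} [Fintype ι] {c : ι → Module.Dual ℝ V} {b : ι → V}
    (h : ∀ v, ∑ s, c s v • b s = v) {k : ℕ} (η : Alt V k) :
    η = (k.factorial : ℝ)⁻¹ • ∑ s : Fin k → ι, η (b ∘ s) • covecWedge (c ∘ s) := by
  classical
  have hw : ∀ w : Fin k → V, η w = ∑ s : Fin k → ι, (∏ i, c (s i) (w i)) • η (b ∘ s) := by
    intro w
    conv_lhs => rw [show w = fun i => ∑ j, c j (w i) • b j from funext fun i => (h _).symm]
    change η.toMultilinearMap _ = _
    rw [MultilinearMap.map_sum]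
    exact Finset.sum_congr rfl fun s _ => η.toMultilinearMap.map_smul_univ _ _
  ext v
  rw [AlternatingMap.smul_apply, alt_sum_apply, smul_eq_mul, eq_inv_mul_iff_mul_eq₀ (by positivity)]
  simp only [AlternatingMap.smul_apply, covecWedge_eq_sum, Finset.smul_sum]
  rw [Finset.sum_comm]
  -- The factor `k!` counts permutations: each `σ` contributes one copy of `η v`, expanded at `v ∘
  -- σ` and corrected by its sign.
  have hc : (k.factorial : ℝ) * η v = ∑ σ : Equiv.Perm (Fin k), η v := by
    simp [Fintype.card_perm]
  rw [hc]
  refine Finset.sum_congr rfl fun σ _ => ?_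
  have h1 : η (v ∘ σ) = Equiv.Perm.sign σ • η v := η.map_perm v σ
  rw [hw (v ∘ σ)] at h1
  have h2 : η v = Equiv.Perm.sign σ • Equiv.Perm.sign σ • η v := by
    rw [smul_smul, Int.units_mul_self, one_smul]
  rw [h2, ← h1, Finset.smul_sum]
  refine Finset.sum_congr rfl fun s _ => ?_
  simp only [Units.smul_def, zsmul_eq_mul, smul_eq_mul, comp_apply]
  ring

/-- In the coordinate expansion only the index maps that are injective and have a nonzero
coefficient contribute. Membership in a subspace thus becomes a question about the values of `η` on
frame vectors. -/
theorem mem_of_covecWedge_mem {ι : Type*} [Fintype ι] {c : ι → Module.Dual ℝ V} {b : ι → V}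
    (h : ∀ v, ∑ s, c s v • b s = v) {k : ℕ} (S : Submodule ℝ (Alt V k)) (η : Alt V k)
    (hS : ∀ s : Fin k → ι, Injective s → η (b ∘ s) ≠ 0 → covecWedge (c ∘ s) ∈ S) : η ∈ S := by
  rw [alt_eq_sum h η]
  refine Submodule.smul_mem _ _ (Submodule.sum_mem _ fun s _ => ?_)
  by_cases hs : Injective s
  · by_cases h0 : η (b ∘ s) = 0
    · rw [h0, zero_smul]; exact Submodule.zero_mem _
    · exact Submodule.smul_mem _ _ (hS s hs h0)
  · rw [covecWedge_eq_zero_of_not_injective c hs, smul_zero]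
    exact Submodule.zero_mem _

theorem span_covecWedge [FiniteDimensional ℝ V] (k : ℕ) :
    Submodule.span ℝ (range (covecWedge (V := V) (k := k))) = ⊤ := by
  rw [eq_top_iff]
  intro η _
  let b := Module.finBasis ℝ V
  exact mem_of_covecWedge_mem (c := b.coord) (b := b) (fun v => b.sum_repr v) _ η
    fun s _ _ => Submodule.subset_span (mem_range_self _)

instance [FiniteDimensional ℝ V] (k : ℕ) : FiniteDimensional ℝ (Alt V k) := by
  let b := Module.finBasis ℝ V
  refine ⟨⟨(finite_range fun s : Fin k → Fin (Module.finrank ℝ V) =>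
    covecWedge (b.coord ∘ s)).toFinset, ?_⟩⟩
  rw [eq_top_iff]
  intro η _
  refine mem_of_covecWedge_mem (c := b.coord) (b := b) (fun v => b.sum_repr v) _ η
    fun s _ _ => Submodule.subset_span ?_
  simp

/-- A linear relation between forms that holds for exterior products of covectors holds for all
forms. -/
theorem alt_linearMap_ext [FiniteDimensional ℝ V] {F : Type*} [AddCommGroup F] [Module ℝ F] {k : ℕ}
    {f g : Alt V k →ₗ[ℝ] F} (h : ∀ θ, f (covecWedge θ) = g (covecWedge θ)) : f = g :=
  LinearMap.ext_on (span_covecWedge k) (by rintro _ ⟨θ, rfl⟩; exact h θ)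

end CovecWedge

/-! ### The exterior product of forms -/

section WedgeAlt

variable {V W : Type*} [AddCommGroup V] [Module ℝ V] [AddCommGroup W] [Module ℝ W] {a b : ℕ}

/-- The exterior product of alternating forms, as a bilinear map. -/
def wedgeAlt : Alt V a →ₗ[ℝ] Alt V b →ₗ[ℝ] Alt V (a + b) :=
  LinearMap.mk₂ ℝ (fun η ζ => ((LinearMap.mul' ℝ ℝ).compAlternatingMap
      (η.domCoprod ζ)).domDomCongr finSumFinEquiv)
    (fun η η' ζ => by
      rw [← AlternatingMap.domCoprod'_apply, TensorProduct.add_tmul, map_add]; ext; simp)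
    (fun c η ζ => by
      rw [← AlternatingMap.domCoprod'_apply, ← TensorProduct.smul_tmul', map_smul]; ext; simp)
    (fun η ζ ζ' => by
      rw [← AlternatingMap.domCoprod'_apply, TensorProduct.tmul_add, map_add]; ext; simp)
    (fun c η ζ => by
      rw [← AlternatingMap.domCoprod'_apply, TensorProduct.tmul_smul, map_smul]; ext; simp)

/-- An exterior product of covectors is the alternatization of the product of its factors, and
`domCoprod` of two alternatizations is the alternatization of the tensor product, so both sides are
one sum over permutations. -/
theorem wedgeAlt_covecWedge (θ : Fin a → Module.Dual ℝ V) (θ' : Fin b → Module.Dual ℝ V) :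
    wedgeAlt (covecWedge θ) (covecWedge θ') = covecWedge (Fin.append θ θ') := by
  have key : ∀ {k : ℕ} (θ : Fin k → Module.Dual ℝ V), covecWedge θ =
      MultilinearMap.alternatization ((MultilinearMap.mkPiAlgebra ℝ (Fin k) ℝ).compLinearMap θ) := by
    intro k θ
    ext v
    rw [covecWedge_eq_sum, MultilinearMap.alternatization_apply]
    rfl
  ext v
  change (LinearMap.mul' ℝ ℝ) ((covecWedge θ).domCoprod (covecWedge θ') (v ∘ finSumFinEquiv)) = _
  rw [key θ, key θ', ← MultilinearMap.domCoprod_alternization, MultilinearMap.alternatization_apply,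
    map_sum, covecWedge_eq_sum]
  refine Fintype.sum_equiv finSumFinEquiv.permCongr _ _ fun σ => ?_
  rw [Units.smul_def, Units.smul_def, map_zsmul, Equiv.Perm.sign_permCongr]
  congr 1
  rw [← finSumFinEquiv.prod_comp, Fintype.prod_sum_type]
  simp [MultilinearMap.domCoprod_apply]

theorem wedgeAlt_compLinearMap (A : W →ₗ[ℝ] V) (η : Alt V a) (ζ : Alt V b) :
    (wedgeAlt η ζ).compLinearMap A = wedgeAlt (η.compLinearMap A) (ζ.compLinearMap A) := by
  ext v
  change (LinearMap.mul' ℝ ℝ) (η.domCoprod ζ (A ∘ v ∘ finSumFinEquiv)) = (LinearMap.mul' ℝ ℝ)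
    ((η.compLinearMap A).domCoprod (ζ.compLinearMap A) (v ∘ finSumFinEquiv))
  rw [AlternatingMap.domCoprod_apply, AlternatingMap.domCoprod_apply, sum_apply, sum_apply]
  refine congrArg _ (Finset.sum_congr rfl fun σ _ => ?_)
  induction σ using Quotient.inductionOn' with
  | h σ => rfl

/-- Each shuffle distributes the arguments between `η` and `ζ` by some bijection `e` and
contributes, up to sign, the product of the two values. -/
theorem wedgeAlt_eq_zero {η : Alt V a} {ζ : Alt V b} {v : Fin (a + b) → V}
    (h : ∀ e : Fin a ⊕ Fin b ≃ Fin (a + b),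
      η (fun i => v (e (.inl i))) = 0 ∨ ζ (fun i => v (e (.inr i))) = 0) :
    wedgeAlt η ζ v = 0 := by
  change (LinearMap.mul' ℝ ℝ) (η.domCoprod ζ (v ∘ finSumFinEquiv)) = _
  rw [AlternatingMap.domCoprod_apply, sum_apply, map_sum]
  refine Finset.sum_eq_zero fun σ _ => ?_
  induction σ using Quotient.inductionOn' with
  | h σ =>
    rw [AlternatingMap.domCoprod.summand_mk'', smul_apply, Units.smul_def, map_zsmul]
    have : (LinearMap.mul' ℝ ℝ) (((η : MultilinearMap ℝ _ ℝ).domCoprod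
        (ζ : MultilinearMap ℝ _ ℝ)).domDomCongr σ (v ∘ finSumFinEquiv)) =
        η (fun i => v ((σ.trans finSumFinEquiv) (.inl i))) *
          ζ (fun i => v ((σ.trans finSumFinEquiv) (.inr i))) := rfl
    rw [this, mul_eq_zero.2 (h _), smul_zero]

/-- The determinant is block triangular. -/
theorem covecWedge_append_append (θ : Fin a → Module.Dual ℝ V) (θ' : Fin b → Module.Dual ℝ V)
    {u : Fin a → V} {w : Fin b → V} (h : ∀ i j, θ' j (u i) = 0) :
    covecWedge (Fin.append θ θ') (Fin.append u w) = covecWedge θ u * covecWedge θ' w := by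
  rw [covecWedge_apply, covecWedge_apply, covecWedge_apply,
    ← Matrix.det_fromBlocks_zero₁₂ _ (Matrix.of fun i j => θ j (w i)),
    ← Matrix.det_submatrix_equiv_self finSumFinEquiv]
  congr 1
  ext (i | i) (j | j) <;> simp [h]

/-- Linear in `η`, so products of covectors suffice. It isolates one coefficient of `η` by wedging
with a complementary form. -/
theorem wedgeAlt_append [FiniteDimensional ℝ V] (η : Alt V a) (θ' : Fin b → Module.Dual ℝ V)
    {u : Fin a → V} {w : Fin b → V} (h : ∀ i j, θ' j (u i) = 0) :
    wedgeAlt η (covecWedge θ') (Fin.append u w) = η u * covecWedge θ' w := by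
  let ev : ∀ {k : ℕ} (u : Fin k → V), Alt V k →ₗ[ℝ] ℝ := fun u =>
    { toFun := fun η => η u, map_add' := fun _ _ => rfl, map_smul' := fun _ _ => rfl }
  have := alt_linearMap_ext (f := ev (Fin.append u w) ∘ₗ (wedgeAlt (a := a)).flip (covecWedge θ'))
    (g := covecWedge θ' w • ev u) (fun θ => by
      change wedgeAlt (covecWedge θ) (covecWedge θ') (Fin.append u w) =
        covecWedge θ' w * covecWedge θ u
      rw [wedgeAlt_covecWedge, covecWedge_append_append θ θ' h, mul_comm])
  exact (DFunLike.congr_fun this η).trans (mul_comm _ _)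

end WedgeAlt

/-! ### The alternatization of a product -/

section Leibniz

variable {V : Type*} [AddCommGroup V] [Module ℝ V] {a k : ℕ}

open AlternatingMap (alternatizeUncurryFin alternatizeUncurryFinLM)

/-- Laplace expansion along the first column. This is the rule `d(f ω) = df ∧ ω` for constant `ω`.
-/
theorem alternatizeUncurryFin_smulRight (φ : Module.Dual ℝ V) (θ : Fin k → Module.Dual ℝ V) :
    alternatizeUncurryFin (φ.smulRight (covecWedge θ)) = covecWedge (Matrix.vecCons φ θ) := by
  ext v
  rw [AlternatingMap.alternatizeUncurryFin_apply, covecWedge_vecCons]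
  refine Finset.sum_congr rfl fun i _ => ?_
  simp [mul_assoc]

/-- In a basis, `D` is a sum of rank-one maps, and their values are spanned by products of
covectors. The Leibniz rule is thereby reduced to an identity between products of covectors. -/
theorem linearMap_alt_ext [FiniteDimensional ℝ V] {F : Type*} [AddCommGroup F] [Module ℝ F]
    {f g : (V →ₗ[ℝ] Alt V k) →ₗ[ℝ] F}
    (h : ∀ (φ : Module.Dual ℝ V) (θ : Fin k → Module.Dual ℝ V), f (LinearMap.smulRight φ (covecWedge θ)) =
      g (LinearMap.smulRight φ (covecWedge θ))) : f = g := by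
  ext D
  let b := Module.finBasis ℝ V
  have hD : D = ∑ i, (b.coord i).smulRight (D (b i)) := by
    ext1 v
    simp only [LinearMap.sum_apply, LinearMap.smulRight_apply, Module.Basis.coord_apply]
    conv_lhs => rw [← b.sum_repr v, map_sum]
    simp only [map_smul]
  rw [hD, map_sum, map_sum]
  refine Finset.sum_congr rfl fun i _ => ?_
  let r : Alt V k →ₗ[ℝ] (V →ₗ[ℝ] Alt V k) := LinearMap.smulRightₗ (b.coord i)
  exact DFunLike.congr_fun (alt_linearMap_ext (f := f ∘ₗ r) (g := g ∘ₗ r) fun θ => h _ θ) (D (b i))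

/-- `∑ᵢ (-1)ⁱ (D_{vᵢ} ∧ ε)(…)` is the exterior product of the alternatization of `D` with `ε`. -/
theorem alternatizeUncurryFin_wedgeAlt_left [FiniteDimensional ℝ V] (D : V →ₗ[ℝ] Alt V a)
    (ε : Alt V k) : alternatizeUncurryFin ((wedgeAlt (b := k)).flip ε ∘ₗ D) =
      (wedgeAlt (alternatizeUncurryFin D) ε).domDomCongr
        (finCongr (Nat.succ_add_eq_add_succ a k)) := by
  let c : Alt V (a + 1 + k) →ₗ[ℝ] Alt V (a + k + 1) :=
    (AlternatingMap.domDomCongrₗ ℝ (finCongr (Nat.succ_add_eq_add_succ a k))).toLinearMap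
  let A : ∀ j : ℕ, (V →ₗ[ℝ] Alt V j) →ₗ[ℝ] Alt V (j + 1) := fun _ => alternatizeUncurryFinLM
  let f : Alt V k →ₗ[ℝ] (V →ₗ[ℝ] Alt V a) →ₗ[ℝ] Alt V (a + k + 1) :=
    LinearMap.mk₂ ℝ (fun ε D => A _ ((wedgeAlt (b := k)).flip ε ∘ₗ D))
      (fun _ _ _ => by rw [map_add, LinearMap.add_comp, map_add])
      (fun _ _ _ => by rw [map_smul, LinearMap.smul_comp, map_smul])
      (fun _ _ _ => by rw [LinearMap.comp_add, map_add])
      (fun _ _ _ => by rw [LinearMap.comp_smul, map_smul])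
  let g : Alt V k →ₗ[ℝ] (V →ₗ[ℝ] Alt V a) →ₗ[ℝ] Alt V (a + k + 1) :=
    LinearMap.mk₂ ℝ (fun ε D => c (wedgeAlt (A _ D) ε))
      (fun _ _ _ => by rw [map_add, map_add])
      (fun _ _ _ => by rw [map_smul, map_smul])
      (fun _ _ _ => by rw [map_add, map_add, LinearMap.add_apply, map_add])
      (fun _ _ _ => by rw [map_smul, map_smul, LinearMap.smul_apply, map_smul])
  suffices h : f = g from DFunLike.congr_fun (DFunLike.congr_fun h ε) D
  refine alt_linearMap_ext fun θ' => linearMap_alt_ext fun φ θ => ?_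
  have h1 : (wedgeAlt (a := a) (b := k)).flip (covecWedge θ') ∘ₗ
      LinearMap.smulRight φ (covecWedge θ) =
      LinearMap.smulRight φ (covecWedge (Fin.append θ θ')) := by
    ext1 v
    simp [wedgeAlt_covecWedge]
  change alternatizeUncurryFin ((wedgeAlt (a := a) (b := k)).flip (covecWedge θ') ∘ₗ
      LinearMap.smulRight φ (covecWedge θ)) = (wedgeAlt (alternatizeUncurryFin
      (LinearMap.smulRight φ (covecWedge θ))) (covecWedge θ')).domDomCongr _
  rw [h1, alternatizeUncurryFin_smulRight, alternatizeUncurryFin_smulRight, wedgeAlt_covecWedge]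
  have h2 : Matrix.vecCons φ (Fin.append θ θ') =
      Fin.append (Matrix.vecCons φ θ) θ' ∘ Fin.cast (Nat.succ_add_eq_add_succ a k).symm := by
    rw [Matrix.vecCons, Matrix.vecCons, Fin.append_cons]
    rfl
  rw [h2]
  ext v
  rw [AlternatingMap.domDomCongr_apply, covecWedge_apply, covecWedge_apply]
  exact (Matrix.det_submatrix_equiv_self (finCongr (Nat.succ_add_eq_add_succ a k)).symm
    (Matrix.of fun i j => (Fin.append (Matrix.vecCons φ θ) θ') j
      (v (finCongr (Nat.succ_add_eq_add_succ a k) i))))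

theorem alternatizeUncurryFin_wedgeAlt_right [FiniteDimensional ℝ V] (α : Alt V a)
    (D : V →ₗ[ℝ] Alt V k) : alternatizeUncurryFin (wedgeAlt α ∘ₗ D) =
      (-1 : ℝ) ^ a • wedgeAlt α (alternatizeUncurryFin D) := by
  let A : ∀ j : ℕ, (V →ₗ[ℝ] Alt V j) →ₗ[ℝ] Alt V (j + 1) := fun _ => alternatizeUncurryFinLM
  let f : Alt V a →ₗ[ℝ] (V →ₗ[ℝ] Alt V k) →ₗ[ℝ] Alt V (a + k + 1) :=
    LinearMap.mk₂ ℝ (fun α D => A _ (wedgeAlt α ∘ₗ D))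
      (fun _ _ _ => by rw [map_add, LinearMap.add_comp, map_add])
      (fun _ _ _ => by rw [map_smul, LinearMap.smul_comp, map_smul])
      (fun _ _ _ => by rw [LinearMap.comp_add, map_add])
      (fun _ _ _ => by rw [LinearMap.comp_smul, map_smul])
  let g : Alt V a →ₗ[ℝ] (V →ₗ[ℝ] Alt V k) →ₗ[ℝ] Alt V (a + k + 1) :=
    LinearMap.mk₂ ℝ (fun α D => (-1 : ℝ) ^ a • wedgeAlt α (A _ D))
      (fun _ _ _ => by rw [map_add, LinearMap.add_apply, smul_add])
      (fun _ _ _ => by rw [map_smul, LinearMap.smul_apply, smul_comm])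
      (fun _ _ _ => by rw [map_add, map_add, smul_add])
      (fun _ _ _ => by rw [map_smul, map_smul, smul_comm])
  suffices h : f = g from DFunLike.congr_fun (DFunLike.congr_fun h α) D
  refine alt_linearMap_ext fun θ => linearMap_alt_ext fun φ θ' => ?_
  have h1 : wedgeAlt (covecWedge θ) ∘ₗ LinearMap.smulRight φ (covecWedge θ') =
      LinearMap.smulRight φ (covecWedge (Fin.append θ θ')) := by
    ext1 v
    simp [wedgeAlt_covecWedge]
  change alternatizeUncurryFin (wedgeAlt (covecWedge θ) ∘ₗ
      LinearMap.smulRight φ (covecWedge θ')) = (-1 : ℝ) ^ a • wedgeAlt (covecWedge θ)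
      (alternatizeUncurryFin (LinearMap.smulRight φ (covecWedge θ')))
  rw [h1, alternatizeUncurryFin_smulRight, alternatizeUncurryFin_smulRight, wedgeAlt_covecWedge]
  -- The position of `φ` after the `a` factors of `θ`. Bringing it to the front is a cycle of sign
  -- `(-1)^a`, which is the sign of the Leibniz rule.
  let p : Fin (a + k + 1) := ⟨a, by omega⟩
  have h2 : Fin.append θ (Matrix.vecCons φ θ') = p.insertNth φ (Fin.append θ θ') := by
    ext1 j
    refine Fin.addCases (fun i => ?_) (fun i => ?_) j
    · rw [Fin.append_left]
      have h3 : Fin.castAdd (k + 1) i = p.succAbove (Fin.castAdd k i) := by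
        rw [Fin.succAbove_of_castSucc_lt]
        · ext; simp
        · simp [p, Fin.lt_def]
      rw [h3, Fin.insertNth_apply_succAbove, Fin.append_left]
    · rw [Fin.append_right]
      refine Fin.cases ?_ (fun i => ?_) i
      · have h3 : Fin.natAdd a (0 : Fin (k + 1)) = p := by ext; simp [p]
        rw [h3, Fin.insertNth_apply_same]; rfl
      · have h3 : Fin.natAdd a i.succ = p.succAbove (Fin.natAdd a i) := by
          rw [Fin.succAbove_of_le_castSucc]
          · ext; simp; omega
          · simp [p, Fin.le_def]
        rw [h3, Fin.insertNth_apply_succAbove, Fin.append_right]; rfl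
  rw [h2, ← Fin.cons_comp_cycleRange, covecWedge_perm, Fin.sign_cycleRange]
  rw [Units.smul_def, ← Int.cast_smul_eq_zsmul ℝ, smul_smul]
  simp [p, ← mul_pow, Matrix.vecCons]

end Leibniz

/-! ### Contractions evaluated on vectors -/

section Contractions

variable {V W : Type*} [AddCommGroup V] [Module ℝ V] [AddCommGroup W] [Module ℝ W]

theorem wedge_ιMulti {p k : ℕ} (u : Fin p → V) (w : Fin k → V) :
    wedge rfl (exteriorPower.ιMulti ℝ p u) (exteriorPower.ιMulti ℝ k w) =
      exteriorPower.ιMulti ℝ (p + k) (Fin.append u w) := by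
  refine Subtype.ext ?_
  rw [coe_wedge, exteriorPower.ιMulti_apply_coe, exteriorPower.ιMulti_apply_coe,
    exteriorPower.ιMulti_apply_coe, ExteriorAlgebra.ιMulti_apply, ExteriorAlgebra.ιMulti_apply,
    ExteriorAlgebra.ιMulti_apply, ← List.prod_append, ← List.ofFn_fin_append]
  congr 2
  ext1 j
  refine Fin.addCases (fun i => ?_) (fun i => ?_) j <;> simp

theorem contract_ιMulti_apply {p k : ℕ} (u : Fin p → V) (η : Alt V (p + k)) (w : Fin k → V) :
    contract rfl (exteriorPower.ιMulti ℝ p u) η w = η (Fin.append u w) := by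
  rw [← pair_ιMulti, pair_contract, wedge_ιMulti, pair_ιMulti]

theorem multivector_induction {k : ℕ} {P : ⋀[ℝ]^k V → Prop} (h0 : P 0)
    (hadd : ∀ U U', P U → P U' → P (U + U')) (hsmul : ∀ (c : ℝ) U, P U → P (c • U))
    (h : ∀ u, P (exteriorPower.ιMulti ℝ k u)) (U : ⋀[ℝ]^k V) : P U := by
  have hU : U ∈ Submodule.span ℝ (range (exteriorPower.ιMulti ℝ k (M := V))) := by
    rw [exteriorPower.ιMulti_span]; trivial
  induction hU using Submodule.span_induction with
  | zero => exact h0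
  | add x y _ _ hx hy => exact hadd _ _ hx hy
  | smul c x _ hx => exact hsmul _ _ hx
  | mem x hx => obtain ⟨u, rfl⟩ := hx; exact h u

theorem coe_exteriorPower_map {k : ℕ} (A : V →ₗ[ℝ] W) (U : ⋀[ℝ]^k V) :
    (exteriorPower.map k A U : ExteriorAlgebra ℝ W) = ExteriorAlgebra.map A U := by
  induction U using multivector_induction with
  | h0 => simp
  | hadd U U' h h' => simp only [map_add, Submodule.coe_add, h, h']
  | hsmul c U h => simp only [map_smul, Submodule.coe_smul, h]
  | h u => simp [ExteriorAlgebra.map_apply_ιMulti]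

theorem map_wedge {p k N : ℕ} (h : p + k = N) (A : V →ₗ[ℝ] W) (U : ⋀[ℝ]^p V) (U' : ⋀[ℝ]^k V) :
    exteriorPower.map N A (wedge h U U') =
      wedge h (exteriorPower.map p A U) (exteriorPower.map k A U') := by
  refine Subtype.ext ?_
  rw [coe_exteriorPower_map, coe_wedge, coe_wedge, coe_exteriorPower_map, coe_exteriorPower_map,
    map_mul]

theorem map_vec (A : V →ₗ[ℝ] W) (v : V) : exteriorPower.map 1 A (vec v) = vec (A v) := by
  refine Subtype.ext ?_
  rw [coe_exteriorPower_map, coe_vec, coe_vec, ExteriorAlgebra.map_apply_ι]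

theorem pair_compLinearMap {k : ℕ} (A : V →ₗ[ℝ] W) (η : Alt W k) (U : ⋀[ℝ]^k V) :
    pair (η.compLinearMap A) U = pair η (exteriorPower.map k A U) := by
  induction U using multivector_induction with
  | h0 => simp
  | hadd U U' h h' => simp only [map_add, h, h']
  | hsmul c U h => simp only [map_smul, h]
  | h u => rw [exteriorPower.map_apply_ιMulti, pair_ιMulti, pair_ιMulti]; rfl

theorem contract_compLinearMap {p k N : ℕ} (h : p + k = N) (A : V →ₗ[ℝ] W) (η : Alt W N)
    (U : ⋀[ℝ]^p V) : contract h U (η.compLinearMap A) =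
      (contract h (exteriorPower.map p A U) η).compLinearMap A := by
  ext w
  rw [← pair_ιMulti, ← pair_ιMulti, pair_contract, pair_compLinearMap, pair_compLinearMap,
    pair_contract, map_wedge]

theorem pair_injective {k : ℕ} {η ζ : Alt V k} (h : ∀ U, pair η U = pair ζ U) : η = ζ :=
  pair.injective (LinearMap.ext h)

theorem wedge_one_left {k : ℕ} (h : 0 + k = k) (U : ⋀[ℝ]^k V) :
    wedge h ⟨1, SetLike.GradedOne.one_mem⟩ U = U := by
  refine Subtype.ext ?_
  rw [coe_wedge, one_mul]

end Contractions

/-! ### The forms `S^a` in coordinates -/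

section Annihilators

variable {V : Type*} [AddCommGroup V] [Module ℝ V]

/-- The forms that vanish as soon as two of their arguments are related by `R`. -/
def annPair (R : V → V → Prop) (k : ℕ) : Submodule ℝ (Alt V k) where
  carrier := {η | ∀ (v : Fin k → V) (s t : Fin k), s ≠ t → R (v s) (v t) → η v = 0}
  add_mem' := by
    intro a b ha hb v s t hst h
    simp [ha v s t hst h, hb v s t hst h]
  zero_mem' := by intro v s t _ _; rfl
  smul_mem' := by
    intro c a ha v s t hst h
    simp [ha v s t hst h]

/-- The forms that vanish as soon as one of their arguments satisfies `R`. -/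
def annVec (R : V → Prop) (k : ℕ) : Submodule ℝ (Alt V k) where
  carrier := {η | ∀ (v : Fin k → V) (s : Fin k), R (v s) → η v = 0}
  add_mem' := by
    intro a b ha hb v s h
    simp [ha v s h, hb v s h]
  zero_mem' := by intro v s _; rfl
  smul_mem' := by
    intro c a ha v s h
    simp [ha v s h]

end Annihilators

namespace MCoord

variable {n m : ℕ}

/-- `∂/∂x^μ`. -/
def ex (μ : Fin n) : MCoord n m := (YCoord.ex μ, 0)

theorem dx_apply (μ : Fin n) (v : MCoord n m) : dx μ v = v.1.1 μ := rfl
theorem dy_apply (i : Fin m) (v : MCoord n m) : dy i v = v.1.2 i := rfl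
theorem dp_apply (μ : Fin n) (i : Fin m) (v : MCoord n m) : dp μ i v = v.2 μ i := rfl

theorem dx_ex (μ ν : Fin n) : dx μ (ex ν : MCoord n m) = if μ = ν then 1 else 0 := by
  simp [dx_apply, ex, YCoord.ex, Pi.single_apply]
theorem dx_ey (μ : Fin n) (i : Fin m) : dx μ (ey i : MCoord n m) = 0 := rfl
theorem dx_ep (μ ν : Fin n) (i : Fin m) : dx μ (ep ν i : MCoord n m) = 0 := rfl
theorem dy_ey (i j : Fin m) : dy i (ey j : MCoord n m) = if i = j then 1 else 0 := by
  simp [dy_apply, ey, YCoord.ey, Pi.single_apply]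
theorem dy_ep (i : Fin m) (ν : Fin n) (j : Fin m) : dy i (ep ν j : MCoord n m) = 0 := rfl
theorem dp_ex (μ : Fin n) (i : Fin m) (ν : Fin n) : dp μ i (ex ν : MCoord n m) = 0 := rfl
theorem dp_ey (μ : Fin n) (i j : Fin m) : dp μ i (ey j : MCoord n m) = 0 := rfl
theorem dp_ep (μ : Fin n) (i : Fin m) (ν : Fin n) (j : Fin m) :
    dp μ i (ep ν j : MCoord n m) = if μ = ν ∧ i = j then 1 else 0 := by
  by_cases h : μ = ν
  · subst h; simp [dp_apply, ep, Pi.single_apply]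
  · simp [dp_apply, ep, h]

/-- The coordinate covectors. -/
def coframe : Fin n ⊕ Fin m ⊕ Fin n × Fin m → Module.Dual ℝ (MCoord n m) :=
  Sum.elim dx (Sum.elim dy fun x => dp x.1 x.2)

/-- The coordinate vectors. -/
def frame : Fin n ⊕ Fin m ⊕ Fin n × Fin m → MCoord n m :=
  Sum.elim ex (Sum.elim ey fun x => ep x.1 x.2)

theorem eq_sum (v : MCoord n m) : v = ∑ μ, dx μ v • ex μ + (∑ i, dy i v • ey i +
    ∑ μ, ∑ i, dp μ i v • ep μ i) := by
  refine Prod.ext (Prod.ext ?_ ?_) ?_ <;> ext a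
  · simp [Prod.fst_sum, dx_apply, ex, ey, ep, YCoord.ex, YCoord.ey, Pi.single_apply]
  · simp [Prod.fst_sum, Prod.snd_sum, dy_apply, ex, ey, ep, YCoord.ex, YCoord.ey, Pi.single_apply]
  · simp [Prod.snd_sum, dp_apply, ex, ey, ep, Pi.single_apply]

theorem sum_frame (v : MCoord n m) : ∑ s, coframe s v • frame s = v := by
  conv_rhs => rw [eq_sum v]
  rw [Fintype.sum_sum_type, Fintype.sum_sum_type, Fintype.sum_prod_type]
  rfl

/-- Vectors that are vertical over the base. -/
def IsVert (v : MCoord n m) : Prop := v.1.1 = 0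
/-- Vectors that are vertical over the manifold with coordinates `(x^μ, y^i)`. -/
def IsMomVert (v : MCoord n m) : Prop := v.1 = 0

theorem isVert_ey (i : Fin m) : IsVert (ey i : MCoord n m) := rfl
theorem isVert_ep (μ : Fin n) (i : Fin m) : IsVert (ep μ i : MCoord n m) := rfl
theorem isMomVert_ep (μ : Fin n) (i : Fin m) : IsMomVert (ep μ i : MCoord n m) := rfl
theorem IsVert.dx {v : MCoord n m} (h : IsVert v) (μ : Fin n) : dx μ v = 0 := congrFun h μ
theorem IsMomVert.isVert {v : MCoord n m} (h : IsMomVert v) : IsVert v := congrArg Prod.fst h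
theorem IsMomVert.dy {v : MCoord n m} (h : IsMomVert v) (i : Fin m) : dy i v = 0 :=
  congrFun (congrArg Prod.snd h) i
theorem isVert_of_dx {v : MCoord n m} (h : ∀ μ, MCoord.dx μ v = 0) : IsVert v := funext h

/-- The forms killed by any two vertical vectors. -/
def horiz2 (n m k : ℕ) : Submodule ℝ (Alt (MCoord n m) k) :=
  annPair (fun v w => IsVert v ∧ IsVert w) k

theorem covecWedge_mem_horiz2 {k : ℕ} (θ : Fin k → Module.Dual ℝ (MCoord n m)) (j₀ : Fin k)
    (h : ∀ j, j ≠ j₀ → ∃ μ, θ j = dx μ) : covecWedge θ ∈ horiz2 n m k := by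
  intro v s t hst hR
  refine covecWedge_eq_zero_of_two_rows θ v (j₀ := j₀) hst ?_ ?_ <;> intro j hj <;>
    obtain ⟨μ, hμ⟩ := h j hj <;> rw [hμ]
  exacts [hR.1.dx _, hR.2.dx _]

theorem topS_le_annPair {R : MCoord n m → MCoord n m → Prop} (h1 : dxs n m ∈ annPair R n)
    (h2 : ∀ μ i, dyx μ i ∈ annPair R n) (h3 : ∀ i, dpx i ∈ annPair R n) :
    topS n m ≤ annPair R n := by
  refine Submodule.span_le.2 ?_
  rintro σ ((rfl | ⟨⟨μ, i⟩, rfl⟩) | ⟨i, rfl⟩)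
  exacts [h1, h2 _ _, h3 _]

/-- Contraction only inserts further vectors in front, so a related pair among the remaining
arguments is still a pair of arguments of `σ`. -/
theorem S_le_annPair {R : MCoord n m → MCoord n m → Prop} (h : topS n m ≤ annPair R n) (k : ℕ) :
    S n m k ≤ annPair R k := by
  refine Submodule.span_le.2 ?_
  rintro η ⟨l, rfl, U, σ, hσ, rfl⟩
  induction U using multivector_induction with
  | h0 => rw [map_zero]; exact Submodule.zero_mem _
  | hadd U U' hU hU' => rw [map_add]; exact Submodule.add_mem _ hU hU'
  | hsmul c U hU => rw [map_smul]; exact Submodule.smul_mem _ _ hU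
  | h u =>
    intro v s t hst hR
    rw [contract_ιMulti_apply]
    refine h hσ _ (Fin.natAdd l s) (Fin.natAdd l t) ?_ (by simpa using hR)
    simpa using hst

theorem update_dx_mem_horiz2 (μ : Fin n) (φ : Module.Dual ℝ (MCoord n m)) :
    covecWedge (Function.update dx μ φ) ∈ horiz2 n m n :=
  covecWedge_mem_horiz2 _ μ fun j hj => ⟨j, Function.update_of_ne hj _ _⟩

theorem topS_le_horiz2 : topS n m ≤ horiz2 n m n := by
  refine topS_le_annPair ?_ (fun μ i => update_dx_mem_horiz2 μ _)
    fun i => Submodule.sum_mem _ fun μ _ => update_dx_mem_horiz2 μ _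
  intro v s t hst hR
  exact covecWedge_eq_zero_of_row _ _ s hR.1.dx

theorem S_le_horiz2 (k : ℕ) : S n m k ≤ horiz2 n m k := S_le_annPair topS_le_horiz2 k

/-- The relation between `∂/∂p^ν_j` and `∂/∂x^ν`. -/
def Conj (v w : MCoord n m) : Prop := ∃ ν j, v = ep ν j ∧ w = ex ν

/-- The factor `dp^μ_i` comes only with `dⁿ⁻¹x_μ`, from which `dx^μ` is missing; the other
generators contain no `dp` at all. This vanishing later forces the `dp`-terms of special forms to be
zero. -/
theorem S_le_annPair_conj (k : ℕ) : S n m k ≤ annPair Conj k := by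
  refine S_le_annPair (topS_le_annPair ?_ ?_ ?_) k
  · rintro v s t hst ⟨ν, j, hs, ht⟩
    exact covecWedge_eq_zero_of_row _ _ s fun l => by rw [hs, dx_ep]
  · rintro μ i v s t hst ⟨ν, j, hs, ht⟩
    refine covecWedge_eq_zero_of_row _ _ s fun l => ?_
    rw [hs]
    by_cases hl : l = μ
    · rw [hl, Function.update_self, dy_ep]
    · rw [Function.update_of_ne hl, dx_ep]
  · rintro i v s t hst ⟨ν, j, hs, ht⟩
    rw [dpx, alt_sum_apply]
    refine Finset.sum_eq_zero fun μ _ => ?_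
    -- For `μ = ν` the factor `dx^ν` has been replaced, so every factor kills `∂/∂x^ν`. For `μ ≠ ν`
    -- every factor kills `∂/∂p^ν_j`.
    by_cases hμ : μ = ν
    · subst hμ
      refine covecWedge_eq_zero_of_row _ _ t fun l => ?_
      rw [ht]
      by_cases hl : l = μ
      · rw [hl, Function.update_self, dp_ex]
      · rw [Function.update_of_ne hl, dx_ex, if_neg hl]
    · refine covecWedge_eq_zero_of_row _ _ s fun l => ?_
      rw [hs]
      by_cases hl : l = μ
      · rw [hl, Function.update_self, dp_ep, if_neg fun h => hμ h.1]
      · rw [Function.update_of_ne hl, dx_ep]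

/-- Contraction with a 0-vector is multiplication by a scalar. -/
theorem S_self : S n m n = topS n m := by
  refine le_antisymm (Submodule.span_le.2 ?_) fun σ hσ => Submodule.subset_span
    ⟨0, zero_add n, ⟨1, SetLike.GradedOne.one_mem⟩, σ, hσ, ?_⟩
  · rintro η ⟨k, h, U, σ, hσ, rfl⟩
    obtain rfl : k = 0 := by omega
    obtain ⟨c, hc⟩ : ∃ c : ℝ, U = c • ⟨1, SetLike.GradedOne.one_mem⟩ := by
      have : (U : ExteriorAlgebra ℝ (MCoord n m)) ∈ (1 : Submodule ℝ _) := by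
        simpa [ExteriorAlgebra.exteriorPower] using U.2
      obtain ⟨c, hc⟩ := Submodule.mem_one.1 this
      exact ⟨c, Subtype.ext (by rw [← hc]; simp [Algebra.algebraMap_eq_smul_one])⟩
    have : contract h U σ = c • σ := by
      refine pair_injective fun W => ?_
      rw [pair_contract, hc, map_smul, LinearMap.smul_apply, wedge_one_left, map_smul, map_smul]
      rfl
    rw [this]
    exact Submodule.smul_mem _ _ hσ
  · refine pair_injective fun W => ?_
    rw [pair_contract, wedge_one_left]

/-! ### Forms without `dp`-terms -/

/-- A surviving index map has no `dp`, and at most one `dy` because two vertical arguments give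
zero. -/
theorem mem_dxdySpan_of_frame {a : ℕ} {η : Alt (MCoord n m) (a + 1)} (h2 : η ∈ horiz2 n m (a + 1))
    (hη : ∀ s, Injective s → ∀ t x, s t = .inr (.inr x) → η (frame ∘ s) = 0) :
    η ∈ dxdySpan n m a := by
  refine mem_of_covecWedge_mem (c := coframe) (b := frame) sum_frame _ η fun s hs h0 => ?_
  have hp : ∀ t x, s t ≠ .inr (.inr x) := fun t x ht =>
    h0 (hη s hs t x ht)
  by_cases hx : ∀ t, ∃ μ, s t = .inl μ
  · choose I hI using hx
    refine Submodule.subset_span (.inl ⟨I, ?_⟩)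
    dsimp only
    congr 1
    ext1 t
    rw [comp_apply, hI]; rfl
  · push Not at hx
    obtain ⟨t, ht⟩ := hx
    have hy : ∀ t, (∀ μ, s t ≠ .inl μ) → ∃ i, s t = .inr (.inl i) := by
      intro t ht
      rcases h : s t with μ | i | x
      exacts [absurd h (ht μ), ⟨i, rfl⟩, absurd h (hp t x)]
    obtain ⟨i, hi⟩ := hy t ht
    have hJ : ∀ r, r ≠ t → ∃ μ, s r = .inl μ := by
      intro r hr
      by_contra! hcon
      obtain ⟨j, hj⟩ := hy r hcon
      refine h0 (h2 _ r t hr ⟨?_, ?_⟩)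
      · rw [comp_apply, hj]; exact isVert_ey _
      · rw [comp_apply, hi]; exact isVert_ey _
    -- The transposition of `0` and `t` brings the unique `dy`-factor to the front; the other
    -- positions then carry only `dx`-factors.
    have hJ' : ∀ r : Fin a, ∃ μ, s (Equiv.swap 0 t r.succ) = .inl μ := by
      intro r
      refine hJ _ fun h => ?_
      rw [Equiv.swap_apply_eq_iff, Equiv.swap_apply_right] at h
      exact Fin.succ_ne_zero r h
    choose J hJ' using hJ'
    have key : coframe ∘ s = (Matrix.vecCons (dy i) fun j => dx (J j)) ∘ Equiv.swap 0 t := by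
      have : (coframe ∘ s) ∘ Equiv.swap 0 t = Matrix.vecCons (dy i) fun j => dx (J j) := by
        ext1 r
        refine Fin.cases ?_ (fun r => ?_) r
        · simp [hi, coframe]
        · simp only [comp_apply, hJ', coframe]; rfl
      rw [← this]
      ext1 r
      simp
    rw [key, covecWedge_perm, Units.smul_def, ← Int.cast_smul_eq_zsmul ℝ]
    exact Submodule.smul_mem _ _ (Submodule.subset_span (.inr ⟨(i, J), rfl⟩))

/-- Describes the span by conditions on single arguments and pairs of arguments. In this form,
stability under exterior products and under replacing arguments is immediate. -/
theorem mem_dxdySpan_iff {a : ℕ} {η : Alt (MCoord n m) (a + 1)} :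
    η ∈ dxdySpan n m a ↔ η ∈ annVec IsMomVert (a + 1) ∧ η ∈ horiz2 n m (a + 1) := by
  rw [← Submodule.mem_inf]
  refine ⟨fun h => (Submodule.span_le.2 ?_ : dxdySpan n m a ≤ _) h, fun h => ?_⟩
  · rintro η (⟨I, rfl⟩ | ⟨⟨i, J⟩, rfl⟩)
    · exact ⟨fun v s hs => covecWedge_eq_zero_of_row _ _ s fun j => hs.isVert.dx _,
        covecWedge_mem_horiz2 _ 0 fun j _ => ⟨_, rfl⟩⟩
    · refine ⟨fun v s hs => covecWedge_eq_zero_of_row _ _ s fun j => ?_,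
        covecWedge_mem_horiz2 _ 0 fun j hj => ?_⟩
      · refine Fin.cases ?_ (fun j => ?_) j
        · simpa using hs.dy i
        · simpa using hs.isVert.dx _
      · obtain ⟨j, rfl⟩ := Fin.exists_succ_eq.2 hj
        exact ⟨J j, rfl⟩
  · exact mem_dxdySpan_of_frame h.2 fun s _ t x ht =>
      h.1 _ t (by rw [comp_apply, ht]; exact isMomVert_ep _ _)

end MCoord

/-! ### The map `♯` and the bracket at a point -/

namespace MCoord

variable {n m : ℕ}

/-- The `n - 1` values away from `k` miss some index, which is assigned to `k`. -/
theorem exists_perm_of_injOn {τ : Fin n → Fin n} {k : Fin n}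
    (hτ : ∀ a b, a ≠ k → b ≠ k → τ a = τ b → a = b) :
    ∃ σ : Equiv.Perm (Fin n), ∀ l, l ≠ k → σ l = τ l := by
  obtain ⟨μ, hμ⟩ : ∃ μ, ∀ l, l ≠ k → τ l ≠ μ := by
    by_contra! hcon
    choose g hg hg' using hcon
    have hgi : Injective g := fun a b h => by rw [← hg' a, ← hg' b, h]
    obtain ⟨a, ha⟩ := (Finite.injective_iff_surjective.1 hgi) k
    exact hg a ha
  have hinj : Injective (update τ k μ) := by
    intro a b h
    by_cases ha : a = k <;> by_cases hb : b = k
    · rw [ha, hb]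
    · subst ha; simp [update_of_ne hb] at h; exact absurd h.symm (hμ b hb)
    · subst hb; simp [update_of_ne ha] at h; exact absurd h (hμ a ha)
    · simp only [update_of_ne ha, update_of_ne hb] at h
      exact hτ a b ha hb h
  exact ⟨Equiv.ofBijective _ (Finite.injective_iff_bijective.1 hinj),
    fun l hl => by simp [update_of_ne hl]⟩

theorem covecWedge_update_update {μ ν : Fin n} {φ : Module.Dual ℝ (MCoord n m)}
    {w : MCoord n m} (hφ : ∀ ρ, φ (ex ρ) = 0) (hw : IsVert w) :
    covecWedge (Function.update dx μ φ) (Function.update ex ν w) = if μ = ν then φ w else 0 := by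
  rw [covecWedge_apply]
  by_cases h : μ = ν
  · subst h
    have : (Matrix.of fun a b => (Function.update dx μ φ : Fin n → Module.Dual ℝ (MCoord n m)) b
        ((Function.update ex μ w : Fin n → MCoord n m) a)) =
        Matrix.diagonal (Function.update (fun _ => (1 : ℝ)) μ (φ w)) := by
      ext a b
      by_cases ha : a = μ
      · by_cases hb : b = μ
        · simp [ha, hb]
        · simp [ha, hb, Matrix.diagonal_apply_ne _ (Ne.symm hb), hw.dx]
      · by_cases hb : b = μ
        · simp [update_of_ne ha, hb, Matrix.diagonal_apply_ne _ ha, hφ]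
        · simp [update_of_ne ha, update_of_ne hb, Matrix.diagonal_apply, dx_ex, eq_comm]
    rw [this, Matrix.det_diagonal, Finset.prod_update_of_mem (Finset.mem_univ _)]
    simp
  · rw [if_neg h]
    refine Matrix.det_eq_zero_of_row_eq_zero μ fun b => ?_
    by_cases hb : b = μ
    · subst hb
      simp [Function.update_of_ne h, hφ]
    · simp [Function.update_of_ne h, dx_ex, hb]

theorem dxs_update {ν : Fin n} {w : MCoord n m} (hw : IsVert w) :
    dxs n m (Function.update ex ν w) = 0 :=
  covecWedge_eq_zero_of_row _ _ ν fun j => by rw [Function.update_self, hw.dx]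

theorem dyx_update (μ ν : Fin n) (i : Fin m) {w : MCoord n m} (hw : IsVert w) :
    dyx μ i (Function.update ex ν w) = if μ = ν then dy i w else 0 :=
  covecWedge_update_update (fun _ => rfl) hw

theorem dpx_update (i : Fin m) (ν : Fin n) {w : MCoord n m} (hw : IsVert w) :
    dpx i (Function.update ex ν w) = dp ν i w := by
  rw [dpx, alt_sum_apply]
  simp [fun μ => covecWedge_update_update (μ := μ) (ν := ν) (φ := dp μ i) (fun _ => rfl) hw]

/-- The `dp`-part of a form in `Sⁿ` is a combination `∑ A_j dp^ν_j ∧ dⁿ⁻¹x_ν` of traces over `ν`: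
the coefficients are diagonal in the indices `μ, ν` and constant along the diagonal. -/
theorem exists_of_mem_topS {σ : Alt (MCoord n m) n} (hσ : σ ∈ topS n m) : ∃ A : Fin m → ℝ,
    ∀ μ ν j, σ (Function.update ex μ (ep ν j)) = if μ = ν then A j else 0 := by
  induction hσ using Submodule.span_induction with
  | zero => exact ⟨0, by simp⟩
  | add x y _ _ hx hy =>
    obtain ⟨A, hA⟩ := hx
    obtain ⟨B, hB⟩ := hy
    refine ⟨A + B, fun μ ν j => ?_⟩
    rw [AlternatingMap.add_apply, hA, hB]
    split_ifs <;> simp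
  | smul c x _ hx =>
    obtain ⟨A, hA⟩ := hx
    refine ⟨c • A, fun μ ν j => ?_⟩
    rw [AlternatingMap.smul_apply, hA]
    split_ifs <;> simp
  | mem σ hσ =>
    rcases hσ with (rfl | ⟨⟨μ, i⟩, rfl⟩) | ⟨i, rfl⟩
    · exact ⟨0, fun μ ν j => by simp [dxs_update (isVert_ep ν j)]⟩
    · exact ⟨0, fun μ ν j => by simp [dyx_update _ _ _ (isVert_ep ν j), dy_ep]⟩
    · refine ⟨fun j => if i = j then 1 else 0, fun μ ν j => ?_⟩
      rw [dpx_update _ _ (isVert_ep ν j), dp_ep]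
      split_ifs <;> simp_all

/-! Forms without `dp`-terms as contractions. -/

/-- Contract with the `∂/∂x^ν` for the indices `ν` complementary to `I`. The remaining factors kill
these vectors, so the determinant splits into blocks. -/
theorem exists_contract {a k : ℕ} (h : k + (a + 1) = n) {I : Fin (a + 1) → Fin n}
    (hI : Injective I) (t : Fin (a + 1)) {φ : Module.Dual ℝ (MCoord n m)}
    (hφ : ∀ ν, ν ≠ I t → φ (ex ν) = 0) :
    ∃ U : ⋀[ℝ]^k (MCoord n m), contract h U (covecWedge (Function.update dx (I t) φ)) =
      covecWedge (Function.update dx (I t) φ ∘ I) := by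
  subst h
  have hcard : Fintype.card {x // x ∉ range I} = k := by
    have h1 : Fintype.card {x // x ∈ range I} = a + 1 :=
      (Set.card_range_of_injective hI).trans (Fintype.card_fin _)
    rw [Fintype.card_subtype_compl, h1, Fintype.card_fin, Nat.add_sub_cancel]
  let e := Fintype.equivFinOfCardEq hcard
  let J : Fin k → Fin (k + (a + 1)) := fun i => (e.symm i).1
  have hJ : Injective J := Subtype.val_injective.comp e.symm.injective
  have hJI : ∀ i j, J i ≠ I j := fun i j hij => (e.symm i).2 ⟨j, hij.symm⟩
  have happ : Injective (Fin.append J I) := by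
    rw [Fin.append_injective_iff]
    exact ⟨hJ, hI, hJI⟩
  let τ : Equiv.Perm (Fin (k + (a + 1))) :=
    Equiv.ofBijective _ (Finite.injective_iff_bijective.1 happ)
  set f : Fin (k + (a + 1)) → Module.Dual ℝ (MCoord (k + (a + 1)) m) :=
    Function.update dx (I t) φ with hf
  have hfτ : f ∘ τ = Fin.append (f ∘ J) (f ∘ I) := by
    ext1 j
    refine Fin.addCases (fun i => ?_) (fun i => ?_) j <;> simp [τ]
  have h1 := covecWedge_perm f τ
  have hfJ : f ∘ J = dx ∘ J := by
    ext1 i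
    simp [hf, update_of_ne (hJI i t)]
  have hJJ : covecWedge (f ∘ J) (ex ∘ J : Fin k → MCoord (k + (a + 1)) m) = 1 := by
    rw [hfJ, covecWedge_apply, ← Matrix.det_one (n := Fin k)]
    congr 1
    ext i j
    simp [dx_ex, Matrix.one_apply, hJ.eq_iff, eq_comm]
  -- The sign undoes the reordering of the `n` factors into the complementary ones followed by those
  -- of `I`.
  refine ⟨(Equiv.Perm.sign τ : ℤ) • exteriorPower.ιMulti ℝ k (ex ∘ J), ?_⟩
  have h2 : covecWedge f = (Equiv.Perm.sign τ : ℤ) • covecWedge (f ∘ τ) := by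
    rw [h1, ← Units.smul_def, smul_smul, Int.units_mul_self, one_smul]
  rw [h2, map_zsmul, map_zsmul, LinearMap.smul_apply, smul_smul, ← Units.val_mul,
    Int.units_mul_self, Units.val_one, one_smul]
  ext w
  rw [contract_ιMulti_apply, hfτ, covecWedge_append_append, hJJ, one_mul]
  intro i j
  rw [comp_apply, comp_apply, hf]
  by_cases hj : I j = I t
  · rw [hj, Function.update_self, hφ _ (hJI i t)]
  · rw [Function.update_of_ne hj, dx_ex, if_neg (hJI i j).symm]

theorem snd_mem_topS {w : MCoord n m × Alt (MCoord n m) n} (hw : w ∈ sharpTop n m) :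
    w.2 ∈ topS n m := by
  suffices h : sharpTop n m ≤ (topS n m).comap (LinearMap.snd ℝ _ _) from h hw
  refine Submodule.span_le.2 ?_
  rintro _ ((rfl | ⟨x, rfl⟩) | ⟨i, rfl⟩)
  exacts [Submodule.subset_span (.inl (.inl rfl)), Submodule.subset_span (.inl (.inr ⟨x, rfl⟩)),
    Submodule.subset_span (.inr ⟨i, rfl⟩)]

theorem snd_mem_S {p a : ℕ} {x : ⋀[ℝ]^p (MCoord n m) × Alt (MCoord n m) a}
    (hx : x ∈ sharpGraph n m p a) : x.2 ∈ S n m a := by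
  suffices h : sharpGraph n m p a ≤ (S n m a).comap (LinearMap.snd ℝ _ _) from h hx
  refine Submodule.span_le.2 ?_
  rintro _ ⟨k, h, hp, U, w, hw, rfl⟩
  exact Submodule.subset_span ⟨k, h, U, w.2, snd_mem_topS hw, rfl⟩

theorem contract_wedge_vec {p k c N : ℕ} (hp : 1 + k = p) (h : p + c = N) (h1 : 1 + (k + c) = N)
    (v : MCoord n m) (U : ⋀[ℝ]^k (MCoord n m)) (η : Alt (MCoord n m) N) (R : ⋀[ℝ]^c (MCoord n m)) :
    pair (contract h (wedge hp (vec v) U) η) R = pair (contract h1 (vec v) η) (wedge rfl U R) := by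
  rw [pair_contract, pair_contract]
  congr 1
  exact Subtype.ext (mul_assoc _ _ _)

/-- The vector `v` becomes an argument of `η`, and `η` has no `dp`-terms. -/
theorem contract_wedge_vec_eq_zero {p k c a : ℕ} (hp : 1 + k = p) (h : p + c = a + 1)
    {v : MCoord n m} (hv : IsMomVert v) (U : ⋀[ℝ]^k (MCoord n m)) {η : Alt (MCoord n m) (a + 1)}
    (hη : η ∈ dxdySpan n m a) : contract h (wedge hp (vec v) U) η = 0 := by
  obtain rfl : a = k + c := by omega
  have : contract (Nat.add_comm 1 (k + c)) (vec v) η = 0 := by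
    ext r
    rw [contract_vec_apply]
    exact (mem_dxdySpan_iff.1 hη).1 _ 0 hv
  refine pair_injective fun R => ?_
  rw [contract_wedge_vec hp h (Nat.add_comm 1 (k + c)), this, map_zero, map_zero]
  rfl

/-- The generators of `dxdySpan` are contractions of `dⁿx` and `dy^i ∧ dⁿ⁻¹x_μ`, whose images under
`♯_n` are `0` and `-∂/∂p^μ_i`. The resulting representative therefore contains a momentum direction
in each term. One `W` serves all degrees `a`. -/
theorem exists_sharp_of_mem_dxdySpan {b : ℕ} (hb : b < n) {B : Alt (MCoord n m) (b + 1)}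
    (hB : B ∈ dxdySpan n m b) : ∃ W, (W, B) ∈ sharpGraph n m (n - b) (b + 1) ∧
      ∀ {a c : ℕ} (h : n - b + c = a + 1), ∀ A ∈ dxdySpan n m a, contract h W A = 0 := by
  have key : ∀ (I : Fin (b + 1) → Fin n) (t : Fin (b + 1)) (φ : Module.Dual ℝ (MCoord n m))
      (v : MCoord n m), (∀ ν, ν ≠ I t → φ (ex ν) = 0) → Injective I →
      (v, covecWedge (Function.update dx (I t) φ)) ∈ sharpTop n m → IsMomVert v →
      ∃ W, (W, covecWedge (Function.update dx (I t) φ ∘ I)) ∈ sharpGraph n m (n - b) (b + 1) ∧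
      ∀ {a c : ℕ} (h : n - b + c = a + 1), ∀ A ∈ dxdySpan n m a, contract h W A = 0 := by
    intro I t φ v hφ hI hv hv0
    obtain ⟨U, hU⟩ := exists_contract (k := n - (b + 1)) (by omega) hI t hφ
    refine ⟨wedge (by omega) (vec v) U,
      Submodule.subset_span ⟨_, _, by omega, U, _, hv, by rw [← hU]⟩, ?_⟩
    intro a c h A hA
    exact contract_wedge_vec_eq_zero _ h hv0 U hA
  have zero : ∃ W, (W, (0 : Alt (MCoord n m) (b + 1))) ∈ sharpGraph n m (n - b) (b + 1) ∧
      ∀ {a c : ℕ} (h : n - b + c = a + 1), ∀ A ∈ dxdySpan n m a, contract h W A = 0 :=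
    ⟨0, Submodule.zero_mem _, fun h A _ => by rw [map_zero]; rfl⟩
  induction hB using Submodule.span_induction with
  | zero => exact zero
  | add x y _ _ hx hy =>
    obtain ⟨W, hW, hW0⟩ := hx
    obtain ⟨W', hW', hW'0⟩ := hy
    refine ⟨W + W', Submodule.add_mem _ hW hW', fun h A hA => ?_⟩
    rw [map_add, LinearMap.add_apply, hW0 h A hA, hW'0 h A hA, add_zero]
  | smul c x _ hx =>
    obtain ⟨W, hW, hW0⟩ := hx
    refine ⟨c • W, Submodule.smul_mem _ c hW, fun h A hA => ?_⟩
    rw [map_smul, LinearMap.smul_apply, hW0 h A hA, smul_zero]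
  | mem B hB =>
    rcases hB with ⟨I, rfl⟩ | ⟨⟨i, J⟩, rfl⟩
    · by_cases hI : Injective I
      · have h0 : Function.update dx (I 0) (dx (I 0)) = (dx : Fin n → Module.Dual ℝ (MCoord n m)) :=
          Function.update_eq_self _ _
        have := key I 0 (dx (I 0)) 0 (fun ν hν => by rw [dx_ex, if_neg hν.symm]) hI
          (Submodule.subset_span (.inl (.inl (by rw [h0]; rfl)))) rfl
        rw [h0] at this
        exact this
      · have := covecWedge_eq_zero_of_not_injective (V := MCoord n m) dx hI
        simp only [comp_def] at this
        simp only [this]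
        exact zero
    · by_cases hJ : Injective J
      · obtain ⟨μ, hμ⟩ : ∃ μ, μ ∉ range J := by
          by_contra! hcon
          have := Fintype.card_le_of_surjective J hcon
          simp at this
          omega
        have hI : Injective (Matrix.vecCons μ J) := Fin.cons_injective_iff.2 ⟨hμ, hJ⟩
        have := key (Matrix.vecCons μ J) 0 (dy i) (-ep μ i) (fun ν _ => rfl) hI
          (Submodule.subset_span (.inl (.inr ⟨(μ, i), rfl⟩))) (by simp [IsMomVert, ep])
        have h0 : Function.update dx (Matrix.vecCons μ J 0) (dy i) ∘ Matrix.vecCons μ J =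
            (Matrix.vecCons (dy i) fun j => dx (J j) : Fin (b + 1) → Module.Dual ℝ (MCoord n m)) := by
          ext1 j
          refine Fin.cases ?_ (fun j => ?_) j
          · simp
          · have : J j ≠ μ := fun h => hμ ⟨j, h⟩
            simp [Function.update_of_ne this]
        rw [h0] at this
        exact this
      · have : covecWedge (Matrix.vecCons (dy i) fun j => dx (J j)) =
            (0 : Alt (MCoord n m) (b + 1)) := by
          simp only [Injective, not_forall] at hJ
          obtain ⟨r, s, hrs, hne⟩ := hJ
          ext v
          refine Matrix.det_zero_of_column_eq (i := r.succ) (j := s.succ) ?_ fun k => ?_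
          · simpa using hne
          · simp [hrs]
        dsimp only
        rw [this]
        exact zero

theorem dxdySpan_le_S {a : ℕ} (ha : a < n) : dxdySpan n m a ≤ S n m (a + 1) := fun η hη => by
  obtain ⟨W, hW, -⟩ := exists_sharp_of_mem_dxdySpan ha hη
  exact snd_mem_S hW

/-- A criterion for a form to lie in `Sⁿ`. -/
theorem mem_S_top {b : ℕ} {σ : Alt (MCoord (b + 1) m) (b + 1)} (h2 : σ ∈ horiz2 (b + 1) m (b + 1))
    (A : Fin m → ℝ)
    (hA : ∀ μ ν j, σ (Function.update ex μ (ep ν j)) = if μ = ν then A j else 0) :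
    σ ∈ S (b + 1) m (b + 1) := by
  have hdp : ∀ j, dpx j ∈ S (b + 1) m (b + 1) := fun j => by
    rw [S_self]; exact Submodule.subset_span (.inr ⟨j, rfl⟩)
  have hsum : ∑ j, A j • dpx j ∈ S (b + 1) m (b + 1) :=
    Submodule.sum_mem _ fun j _ => Submodule.smul_mem _ _ (hdp j)
  -- Subtracting the trace part removes all `dp`-terms, and the rest falls into `dxdySpan`.
  set η := σ - ∑ j, A j • dpx j with hη
  have h0 : ∀ μ ν j, η (Function.update ex μ (ep ν j)) = 0 := by
    intro μ ν j
    rw [hη, AlternatingMap.sub_apply, hA, alt_sum_apply]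
    simp only [AlternatingMap.smul_apply, dpx_update _ _ (isVert_ep ν j), dp_ep]
    split_ifs with h <;> simp [h]
  have hη2 : η ∈ horiz2 (b + 1) m (b + 1) := Submodule.sub_mem _ h2 (S_le_horiz2 _ hsum)
  suffices h : η ∈ dxdySpan (b + 1) m b by
    rw [show σ = η + ∑ j, A j • dpx j by rw [hη, sub_add_cancel]]
    exact Submodule.add_mem _ (dxdySpan_le_S (by omega) h) hsum
  refine mem_dxdySpan_of_frame hη2 fun s hs t x ht => ?_
  by_cases hall : ∀ r, r ≠ t → ∃ μ, s r = .inl μ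
  · choose! I hI using hall
    obtain ⟨τ, hτ⟩ := exists_perm_of_injOn (τ := I) (k := t) fun a b ha hb hab =>
      hs (by rw [hI a ha, hI b hb, hab])
    have : frame ∘ s = Function.update ex (τ t) (ep x.1 x.2) ∘ τ := by
      ext1 r
      by_cases hr : r = t
      · subst hr; simp [ht, frame]
      · have : τ r ≠ τ t := fun h => hr (τ.injective h)
        rw [comp_apply, comp_apply, update_of_ne this, hI r hr, hτ r hr]; rfl
    rw [this, η.map_perm, h0, smul_zero]
  · push Not at hall
    obtain ⟨r, hr, hr'⟩ := hall
    refine hη2 _ r t hr ⟨?_, ?_⟩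
    · rw [comp_apply]
      rcases h : s r with μ | i | y
      exacts [absurd h (hr' μ), isVert_ey i, isVert_ep _ _]
    · rw [comp_apply, ht]; exact isVert_ep _ _

/-! The bracket at a point. -/

/-- Any representative of `♯` may be used, since the class modulo `K` alone determines the
contraction. -/
theorem bracketAt_eq {a b c : ℕ} (hb : b < n) (hc : c + (n - 1) = a + b)
    {A : Alt (MCoord n m) (a + 1)} {B : Alt (MCoord n m) (b + 1)} (hA : A ∈ S n m (a + 1))
    {W : ⋀[ℝ]^(n - b) (MCoord n m)} (hW : (W, B) ∈ sharpGraph n m (n - b) (b + 1)) :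
    bracketAt hb hc A B =
      (-1 : ℝ) ^ (n - 1 - b) • contract (show n - b + c = a + 1 by omega) W A := by
  have hB : B ∈ S n m (b + 1) := snd_mem_S hW
  rw [bracketAt, dif_pos ⟨hA, hB⟩, sharp_eq (η := ⟨B, hB⟩) (W := W) _ hW]
  rfl

theorem bracketAt_eq_zero {a b c : ℕ} (hb : b < n) (ha : a < n) (hc : c + (n - 1) = a + b)
    {A : Alt (MCoord n m) (a + 1)} {B : Alt (MCoord n m) (b + 1)} (hA : A ∈ dxdySpan n m a)
    (hB : B ∈ dxdySpan n m b) : bracketAt hb hc A B = 0 := by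
  obtain ⟨W, hW, hW0⟩ := exists_sharp_of_mem_dxdySpan hb hB
  rw [bracketAt_eq hb hc (dxdySpan_le_S ha hA) hW, hW0 _ A hA, smul_zero]

/-- In top degree `U` is the scalar `1` and the sign exponent `n - 1 - b` is zero. -/
theorem bracketAt_top_right {a b : ℕ} (hb : b < b + 1) (hc : a + (b + 1 - 1) = a + b)
    {A : Alt (MCoord (b + 1) m) (a + 1)} (hA : A ∈ S (b + 1) m (a + 1))
    {w : MCoord (b + 1) m × Alt (MCoord (b + 1) m) (b + 1)} (hw : w ∈ sharpTop (b + 1) m) :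
    bracketAt hb hc A w.2 = contract (Nat.add_comm 1 a) (vec w.1) A := by
  have hp : 1 + 0 = b + 1 - b := by omega
  have hW : (wedge hp (vec w.1) ⟨1, SetLike.GradedOne.one_mem⟩, w.2) ∈
      sharpGraph (b + 1) m (b + 1 - b) (b + 1) := by
    refine Submodule.subset_span ⟨0, zero_add _, hp,
      ⟨1, SetLike.GradedOne.one_mem⟩, w, hw, ?_⟩
    refine Prod.ext rfl (pair_injective fun W => ?_)
    rw [pair_contract, wedge_one_left]
  rw [bracketAt_eq hb hc hA hW, show b + 1 - 1 - b = 0 by omega, pow_zero, one_smul]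
  refine pair_injective fun R => ?_
  rw [pair_contract, pair_contract]
  congr 1
  refine Subtype.ext ?_
  rw [coe_wedge, coe_wedge, coe_wedge, mul_one]

/-- Skew-symmetry of `♯_n` exchanges the two vectors, and moving a vector past the `k`-vector `U`
costs `(-1)^k`. -/
theorem contract_sharp_eq {k p b : ℕ} (hp : 1 + k = p) (h : k + (b + 1) = n) (h2 : p + b = n)
    {w w' : MCoord n m × Alt (MCoord n m) n} (hw : w ∈ sharpTop n m) (hw' : w' ∈ sharpTop n m)
    (U : ⋀[ℝ]^k (MCoord n m)) : contract h2 (wedge hp (vec w'.1) U) w.2 =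
      (-(-1 : ℝ) ^ k) • contract (Nat.add_comm 1 b) (vec w.1) (contract h U w'.2) := by
  refine pair_injective fun R => ?_
  have hN : 1 + (k + b) = n := by omega
  have e : wedge h U (wedge (Nat.add_comm 1 b) (vec w.1) R) =
      (-1 : ℝ) ^ k • wedge hN (vec w.1) (wedge rfl U R) := by
    refine Subtype.ext ?_
    change (U : ExteriorAlgebra ℝ (MCoord n m)) * ((vec w.1).1 * R) =
      _ • ((vec w.1).1 * (U * R))
    rw [← mul_assoc, mul_comm_graded _ _ U.2 (vec w.1).2, mul_one, smul_mul_assoc, mul_assoc]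
  have f1 : pair (contract (Nat.add_comm 1 b) (vec w.1) (contract h U w'.2)) R =
      (-1 : ℝ) ^ k * pair (contract hN (vec w.1) w'.2) (wedge rfl U R) := by
    rw [pair_contract, pair_contract, e, map_smul, pair_contract, smul_eq_mul]
  rw [contract_wedge_vec hp h2 hN, sharpTop_skew hN hw' hw, pair_neg_apply, map_smul,
    LinearMap.smul_apply, f1, smul_eq_mul]
  have h3 : (-1 : ℝ) ^ k * (-1) ^ k = 1 := by rw [← mul_pow]; simp
  linear_combination (-pair (contract hN (vec w.1) w'.2) (wedge rfl U R)) * -h3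

theorem bracketAt_top_left {a b : ℕ} (hb : b < a + 1) (hc : b + (a + 1 - 1) = a + b)
    {B : Alt (MCoord (a + 1) m) (b + 1)} (hB : B ∈ S (a + 1) m (b + 1))
    {w : MCoord (a + 1) m × Alt (MCoord (a + 1) m) (a + 1)} (hw : w ∈ sharpTop (a + 1) m) :
    bracketAt hb hc w.2 B = -contract (Nat.add_comm 1 b) (vec w.1) B := by
  obtain ⟨W, hW⟩ := exists_sharp (p := a + 1 - b) (a := b + 1) (by omega) hB
  have hA : w.2 ∈ S (a + 1) m (a + 1) := by rw [S_self]; exact snd_mem_topS hw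
  rw [bracketAt_eq hb hc hA hW]
  have key : ∀ x ∈ sharpGraph (a + 1) m (a + 1 - b) (b + 1),
      contract (show a + 1 - b + b = a + 1 by omega) x.1 w.2 =
        (-(-1 : ℝ) ^ (a - b)) • contract (Nat.add_comm 1 b) (vec w.1) x.2 := by
    intro x hx
    induction hx using Submodule.span_induction with
    | zero => simp
    | add x y _ _ hx hy =>
      rw [Prod.fst_add, Prod.snd_add, map_add, map_add, LinearMap.add_apply, hx, hy, smul_add]
    | smul c x _ hx =>
      rw [Prod.smul_fst, Prod.smul_snd, map_smul, map_smul, LinearMap.smul_apply, hx, smul_comm]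
    | mem x hx =>
      obtain ⟨k, h, hp, U, w', hw', rfl⟩ := hx
      obtain rfl : k = a - b := by omega
      exact contract_sharp_eq hp h _ hw hw' U
  -- The sign in the definition of the bracket cancels the sign `(-1)^(a - b)` from commuting with
  -- `U`; only the sign of skew-symmetry remains.
  have hs : ((-1 : ℝ) ^ (a + 1 - 1 - b)) * -(-1 : ℝ) ^ (a - b) = -1 := by
    rw [Nat.add_sub_cancel, mul_neg, ← mul_pow]; simp
  rw [key _ hW, smul_smul, hs, neg_one_smul]

/-- The vector `♯_n σ`. -/
def sharpVec (b m : ℕ) : Alt (MCoord (b + 1) m) (b + 1) →ₗ[ℝ] MCoord (b + 1) m where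
  -- Slot `0` is an arbitrary choice: for `σ ∈ Sⁿ` the coefficient of `dp^μ_i ∧ dⁿ⁻¹x_μ` is the same
  -- for every `μ`. The formula is linear on all forms, hence smooth in `σ`.
  toFun σ := ∑ i, σ (Function.update ex 0 (ep 0 i)) • ey i -
    ∑ μ, ∑ i, σ (Function.update ex μ (ey i)) • ep μ i
  map_add' σ σ' := by
    simp only [AlternatingMap.add_apply, add_smul, Finset.sum_add_distrib]
    abel
  map_smul' c σ := by
    simp only [AlternatingMap.smul_apply, smul_assoc, ← Finset.smul_sum, smul_sub, RingHom.id_apply]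

theorem sharpVec_mem {b : ℕ} {σ : Alt (MCoord (b + 1) m) (b + 1)} (hσ : σ ∈ S (b + 1) m (b + 1)) :
    (sharpVec b m σ, σ) ∈ sharpTop (b + 1) m := by
  rw [S_self] at hσ
  suffices h : topS (b + 1) m ≤ (sharpTop (b + 1) m).comap ((sharpVec b m).prod LinearMap.id) from h hσ
  refine Submodule.span_le.2 ?_
  rintro σ ((rfl | ⟨⟨μ, i⟩, rfl⟩) | ⟨i, rfl⟩) <;> refine Submodule.subset_span ?_ <;>
    simp only [LinearMap.prod_apply, Function.prod, LinearMap.id_apply]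
  · refine .inl (.inl (Prod.ext ?_ rfl))
    simp [sharpVec, dxs_update (isVert_ep _ _), dxs_update (isVert_ey _)]
  · refine .inl (.inr ⟨(μ, i), Prod.ext ?_ rfl⟩)
    simp [sharpVec, dyx_update _ _ _ (isVert_ep _ _), dyx_update _ _ _ (isVert_ey _), dy_ep, dy_ey,
      ite_smul]
  · refine .inr ⟨i, Prod.ext ?_ rfl⟩
    simp [sharpVec, dpx_update _ _ (isVert_ep _ _), dpx_update _ _ (isVert_ey _), dp_ep, dp_ey]

theorem isVert_sharpVec {b : ℕ} (σ : Alt (MCoord (b + 1) m) (b + 1)) : IsVert (sharpVec b m σ) := by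
  refine isVert_of_dx fun μ => ?_
  simp [sharpVec, dx_ey, dx_ep]

end MCoord

/-! ### Naturality of `♯` and of the bracket -/

theorem covecWedge_vecCons_update {V : Type*} [AddCommGroup V] [Module ℝ V] {k : ℕ}
    (θ : Fin k → Module.Dual ℝ V) (μ : Fin k) (φ ψ : Module.Dual ℝ V) :
    covecWedge (Matrix.vecCons φ (Function.update θ μ ψ)) =
      -covecWedge (Matrix.vecCons ψ (Function.update θ μ φ)) := by
  have h : Matrix.vecCons φ (Function.update θ μ ψ) =
      Matrix.vecCons ψ (Function.update θ μ φ) ∘ Equiv.swap 0 μ.succ := by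
    ext1 j
    by_cases h0 : j = 0
    · subst h0; simp
    · obtain ⟨j, rfl⟩ := Fin.exists_succ_eq.2 h0
      by_cases hj : j = μ
      · subst hj; simp
      · rw [comp_apply, Equiv.swap_apply_of_ne_of_ne h0 (by simpa using hj)]
        simp [Function.update_of_ne hj]
  rw [h, covecWedge_perm, Equiv.Perm.sign_swap (Fin.succ_ne_zero μ).symm, Units.neg_smul, one_smul]

theorem alt_sub_smul {V : Type*} [AddCommGroup V] [Module ℝ V] {k : ℕ} (c d : ℝ) (η : Alt V k) :
    (c - d) • η = c • η - d • η := by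
  ext r
  simp [sub_mul]

theorem covecWedge_vecCons_curryLeft {V : Type*} [AddCommGroup V] [Module ℝ V] {k : ℕ}
    (φ : Module.Dual ℝ V) (θ : Fin k → Module.Dual ℝ V) {v : V} (hv : ∀ j, θ j v = 0) :
    (covecWedge (Matrix.vecCons φ θ)).curryLeft v = φ v • covecWedge θ := by
  ext r
  exact covecWedge_vecCons_vecCons φ θ v r hv

namespace MCoord

variable {n m : ℕ}

/-- The form `dp^μ_i ∧ dy^i ∧ dⁿ⁻¹x_μ` (summed). -/
def Omega (n m : ℕ) : Alt (MCoord n m) (n + 1) :=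
  ∑ μ, ∑ i, covecWedge (Matrix.vecCons (dp μ i) (Function.update dx μ (dy i)))

theorem curryLeft_sum {V ι : Type*} [AddCommGroup V] [Module ℝ V] (s : Finset ι) {k : ℕ}
    (f : ι → Alt V (k + 1)) (v : V) : (∑ i ∈ s, f i).curryLeft v = ∑ i ∈ s, (f i).curryLeft v := by
  ext r
  rw [AlternatingMap.curryLeft_apply_apply, alt_sum_apply, alt_sum_apply]
  rfl

theorem Omega_curryLeft_ep (ν : Fin n) (j : Fin m) : (Omega n m).curryLeft (ep ν j) = dyx ν j := by
  have h : ∀ μ i, (covecWedge (Matrix.vecCons (dp μ i) (Function.update dx μ (dy i)))).curryLeft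
      (ep ν j : MCoord n m) = if μ = ν ∧ i = j then dyx μ i else 0 := by
    intro μ i
    rw [covecWedge_vecCons_curryLeft, dp_ep, ite_smul, one_smul, zero_smul]
    · rfl
    · intro l
      by_cases hl : l = μ
      · rw [hl, Function.update_self, dy_ep]
      · rw [Function.update_of_ne hl, dx_ep]
  simp only [Omega, curryLeft_sum, h]
  rw [Finset.sum_eq_single ν (by intro b _ hb; simp [hb]) (by simp),
    Finset.sum_eq_single j (by intro b _ hb; simp [hb]) (by simp)]
  simp

theorem Omega_curryLeft_ey (j : Fin m) : (Omega n m).curryLeft (ey j) = -dpx j := by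
  have h : ∀ μ i, (covecWedge (Matrix.vecCons (dp μ i) (Function.update dx μ (dy i)))).curryLeft
      (ey j : MCoord n m) = if i = j then -covecWedge (Function.update dx μ (dp μ i)) else 0 := by
    intro μ i
    rw [covecWedge_vecCons_update]
    have h1 : (-covecWedge (Matrix.vecCons (dy i) (Function.update dx μ (dp μ i)))).curryLeft
        (ey j : MCoord n m) =
        -(covecWedge (Matrix.vecCons (dy i) (Function.update dx μ (dp μ i)))).curryLeft (ey j) := by
      ext r; rfl
    rw [h1, covecWedge_vecCons_curryLeft, dy_ey, ite_smul, one_smul, zero_smul]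
    · split_ifs <;> simp
    · intro l
      by_cases hl : l = μ
      · rw [hl, Function.update_self, dp_ey]
      · rw [Function.update_of_ne hl, dx_ey]
  simp only [Omega, curryLeft_sum, h]
  rw [dpx, ← Finset.sum_neg_distrib]
  refine Finset.sum_congr rfl fun μ _ => ?_
  rw [Finset.sum_eq_single j (by intro b _ hb; simp [hb]) (by simp)]
  simp

/-- Only `dx`-factors survive, and `n` distinct ones form a permutation of all of them. -/
theorem eq_smul_dxs {η : Alt (MCoord n m) n} (hη : η ∈ annVec IsVert n) : ∃ c : ℝ, η = c • dxs n m := by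
  suffices h : η ∈ Submodule.span ℝ {dxs n m} by
    obtain ⟨c, hc⟩ := Submodule.mem_span_singleton.1 h
    exact ⟨c, hc.symm⟩
  refine mem_of_covecWedge_mem (c := coframe) (b := frame) sum_frame _ η fun s hs h0 => ?_
  have hI : ∀ t, ∃ μ, s t = .inl μ := by
    intro t
    rcases h : s t with μ | i | x
    · exact ⟨μ, rfl⟩
    · exact absurd (hη _ t (by rw [comp_apply, h]; exact isVert_ey i)) h0
    · exact absurd (hη _ t (by rw [comp_apply, h]; exact isVert_ep _ _)) h0
  choose I hI using hI
  have hinj : Injective I := fun a b h => hs (by rw [hI, hI, h])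
  let σ : Equiv.Perm (Fin n) := Equiv.ofBijective I (Finite.injective_iff_bijective.1 hinj)
  have : coframe ∘ s = (dx : Fin n → Module.Dual ℝ (MCoord n m)) ∘ σ := by
    ext1 t
    rw [comp_apply, hI]; rfl
  rw [this, covecWedge_perm, Units.smul_def, ← Int.cast_smul_eq_zsmul ℝ]
  exact Submodule.smul_mem _ _ (Submodule.mem_span_singleton_self _)

theorem dxs_curryLeft {v : MCoord n m} (hv : IsVert v) (r : Fin n → MCoord n m) (t : Fin n)
    (ht : r t = v) : dxs n m r = 0 :=
  covecWedge_eq_zero_of_row _ _ t fun j => by rw [ht, hv.dx]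

/-- A description of the graph of `♯_n` by `Ω` and the vertical vectors alone; it makes the
behaviour under changes of coordinates visible. -/
theorem mem_sharpTop_iff {w : MCoord n m × Alt (MCoord n m) n} : w ∈ sharpTop n m ↔
    IsVert w.1 ∧ ∃ c : ℝ, (Omega n m).curryLeft w.1 + w.2 = c • dxs n m := by
  have forward : ∀ w ∈ sharpTop n m,
      IsVert w.1 ∧ ∃ c : ℝ, (Omega n m).curryLeft w.1 + w.2 = c • dxs n m := by
    intro w hw
    induction hw using Submodule.span_induction with
    | zero => exact ⟨rfl, 0, by simp⟩
    | add x y _ _ hx hy =>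
      obtain ⟨hx, c, hc⟩ := hx
      obtain ⟨hy, d, hd⟩ := hy
      refine ⟨isVert_of_dx fun μ => ?_, c + d, ?_⟩
      · rw [Prod.fst_add, map_add, hx.dx, hy.dx, add_zero]
      · rw [Prod.fst_add, Prod.snd_add, map_add, add_smul, ← hc, ← hd]
        abel
    | smul c x _ hx =>
      obtain ⟨hx, d, hd⟩ := hx
      refine ⟨isVert_of_dx fun μ => ?_, c * d, ?_⟩
      · rw [Prod.smul_fst, map_smul, hx.dx, smul_zero]
      · rw [Prod.smul_fst, Prod.smul_snd, map_smul, mul_smul, ← hd, smul_add]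
    | mem w hw =>
      rcases hw with (rfl | ⟨⟨μ, i⟩, rfl⟩) | ⟨i, rfl⟩
      · exact ⟨rfl, 1, by simp⟩
      · exact ⟨by simp [IsVert, ep], 0, by simp [Omega_curryLeft_ep]⟩
      · exact ⟨isVert_ey i, 0, by simp [Omega_curryLeft_ey]⟩
  refine ⟨forward w, ?_⟩
  rintro ⟨hv, c, hc⟩
  -- This is `-ι_v Ω` for the vertical vector `v = w.1`, written in the generators. The given form
  -- differs from it by a multiple of `dⁿx`, which is paired with the zero vector in the graph.
  set σ : Alt (MCoord n m) n := ∑ i, dy i w.1 • dpx i + ∑ μ, ∑ i, dp μ i w.1 • -dyx μ i with hσ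
  have h1 : (w.1, σ) ∈ sharpTop n m := by
    have : (w.1, σ) = ∑ i, dy i w.1 • (ey i, dpx i) +
        ∑ μ, ∑ i, dp μ i w.1 • -(-ep μ i, dyx μ i) := by
      refine Prod.ext ?_ ?_
      · conv_lhs => rw [eq_sum w.1]
        simp only [hv.dx, zero_smul, Finset.sum_const_zero, zero_add, Prod.fst_add, Prod.fst_sum,
          Prod.smul_fst, Prod.fst_neg, neg_neg]
      · simp only [hσ, Prod.snd_add, Prod.snd_sum, Prod.smul_snd, Prod.snd_neg]
    rw [this]
    refine Submodule.add_mem _ (Submodule.sum_mem _ fun i _ => Submodule.smul_mem _ _ ?_)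
      (Submodule.sum_mem _ fun μ _ => Submodule.sum_mem _ fun i _ => Submodule.smul_mem _ _
        (Submodule.neg_mem _ ?_))
    · exact Submodule.subset_span (.inr ⟨i, rfl⟩)
    · exact Submodule.subset_span (.inl (.inr ⟨(μ, i), rfl⟩))
  obtain ⟨-, d, hd⟩ := forward _ h1
  have h2 : w = (w.1, σ) + (c - d) • (0, dxs n m) := by
    refine Prod.ext (by simp) ?_
    dsimp only at hd
    rw [Prod.snd_add, Prod.smul_snd, alt_sub_smul, ← hc, ← hd]
    dsimp only
    abel
  rw [h2]
  exact Submodule.add_mem _ h1 (Submodule.smul_mem _ _ (Submodule.subset_span (.inl (.inl rfl))))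

/-- Linear changes of coordinates that preserve the vertical vectors, and `Omega` up to terms
`φ ∧ dⁿx`. -/
def IsCanonical (A : MCoord n m ≃ₗ[ℝ] MCoord n m) : Prop :=
  (∀ v, IsVert (A v) ↔ IsVert v) ∧ ∃ φ : Module.Dual ℝ (MCoord n m),
    (Omega n m).compLinearMap A.toLinearMap = Omega n m + covecWedge (Matrix.vecCons φ dx)

namespace IsCanonical

variable {A : MCoord n m ≃ₗ[ℝ] MCoord n m} (hA : IsCanonical A)
include hA

/-- Pulling back `ι_v Ω` gives `ι_{A⁻¹v} A^*Ω`. The correction `φ ∧ dⁿx` contributes only a multiple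
of `dⁿx`, because `A⁻¹v` is vertical, and the graph ignores such multiples. -/
theorem sharpTop {w : MCoord n m × Alt (MCoord n m) n} (hw : w ∈ sharpTop n m) :
    (A.symm w.1, w.2.compLinearMap A.toLinearMap) ∈ MCoord.sharpTop n m := by
  obtain ⟨hv, c, hc⟩ := mem_sharpTop_iff.1 hw
  obtain ⟨hA, φ, hφ⟩ := hA
  have hv' : IsVert (A.symm w.1) := by rw [← hA, A.apply_symm_apply]; exact hv
  obtain ⟨d, hd⟩ : ∃ d : ℝ, (dxs n m).compLinearMap A.toLinearMap = d • dxs n m :=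
    eq_smul_dxs fun v s hs => dxs_curryLeft ((hA _).2 hs) _ s rfl
  refine mem_sharpTop_iff.2 ⟨hv', c * d - φ (A.symm w.1), ?_⟩
  have h1 : (Omega n m).curryLeft (A.symm w.1) = ((Omega n m).compLinearMap A.toLinearMap).curryLeft
      (A.symm w.1) - φ (A.symm w.1) • dxs n m := by
    rw [hφ, AlternatingMap.curryLeft_add, LinearMap.add_apply,
      covecWedge_vecCons_curryLeft _ _ hv'.dx]
    exact (add_sub_cancel_right _ _).symm
  have h2 : ((Omega n m).compLinearMap A.toLinearMap).curryLeft (A.symm w.1) =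
      ((Omega n m).curryLeft w.1).compLinearMap A.toLinearMap := by
    ext r
    rw [AlternatingMap.curryLeft_apply_apply, AlternatingMap.compLinearMap_apply,
      AlternatingMap.compLinearMap_apply, AlternatingMap.curryLeft_apply_apply]
    congr 1
    ext1 j
    refine Fin.cases ?_ (fun j => ?_) j <;> simp
  rw [h1, h2]
  have h3 : ((Omega n m).curryLeft w.1).compLinearMap A.toLinearMap +
      w.2.compLinearMap A.toLinearMap = (c * d) • dxs n m := by
    rw [mul_smul, ← hd, ← AlternatingMap.add_compLinearMap, hc]
    rfl
  dsimp only
  rw [alt_sub_smul, ← h3]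
  abel

theorem sharpGraph {p a : ℕ} {x : ⋀[ℝ]^p (MCoord n m) × Alt (MCoord n m) a}
    (hx : x ∈ sharpGraph n m p a) :
    (exteriorPower.map p A.symm.toLinearMap x.1, x.2.compLinearMap A.toLinearMap) ∈
      MCoord.sharpGraph n m p a := by
  have hcomp : ∀ {k : ℕ} (U : ⋀[ℝ]^k (MCoord n m)),
      exteriorPower.map k A.toLinearMap (exteriorPower.map k A.symm.toLinearMap U) = U := by
    intro k U
    rw [← LinearMap.comp_apply, ← exteriorPower.map_comp]
    simp
  induction hx using Submodule.span_induction with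
  | zero =>
    rw [Prod.fst_zero, Prod.snd_zero, map_zero, AlternatingMap.zero_compLinearMap]
    exact Submodule.zero_mem _
  | add x y _ _ hx hy =>
    rw [Prod.fst_add, Prod.snd_add, map_add, AlternatingMap.add_compLinearMap]
    exact Submodule.add_mem _ hx hy
  | smul c x _ hx =>
    rw [Prod.smul_fst, Prod.smul_snd, map_smul]
    exact Submodule.smul_mem _ c hx
  | mem x hx =>
    obtain ⟨k, h, hp, U, w, hw, rfl⟩ := hx
    refine Submodule.subset_span ⟨k, h, hp, exteriorPower.map k A.symm.toLinearMap U, _,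
      hA.sharpTop hw, Prod.ext ?_ ?_⟩
    · exact (map_wedge _ _ _ _).trans (by rw [map_vec]; rfl)
    · dsimp only
      rw [contract_compLinearMap, hcomp]

theorem mem_S {a : ℕ} (ha : a ≤ n) {η : Alt (MCoord n m) a} (hη : η ∈ S n m a) :
    η.compLinearMap A.toLinearMap ∈ S n m a := by
  obtain ⟨W, hW⟩ := exists_sharp (p := n + 1 - a) (by omega) hη
  exact snd_mem_S (hA.sharpGraph hW)

theorem bracketAt {a b c : ℕ} (hb : b < n) (ha : a < n) (hc : c + (n - 1) = a + b)
    {η : Alt (MCoord n m) (a + 1)} {ζ : Alt (MCoord n m) (b + 1)} (hη : η ∈ S n m (a + 1))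
    (hζ : ζ ∈ S n m (b + 1)) :
    bracketAt hb hc (η.compLinearMap A.toLinearMap) (ζ.compLinearMap A.toLinearMap) =
      (MCoord.bracketAt hb hc η ζ).compLinearMap A.toLinearMap := by
  obtain ⟨W, hW⟩ := exists_sharp (p := n - b) (by omega) hζ
  rw [bracketAt_eq hb hc hη hW, bracketAt_eq hb hc (hA.mem_S ha hη) (hA.sharpGraph hW),
    contract_compLinearMap, ← LinearMap.comp_apply (exteriorPower.map _ _), ← exteriorPower.map_comp]
  simp
  rfl

end IsCanonical

end MCoord

/-! ### Calculus of local representatives -/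

section Calculus

variable {E F : Type*} [NormedAddCommGroup E] [NormedSpace ℝ E] [NormedAddCommGroup F]
  [NormedSpace ℝ F]

theorem minSmoothness_two_le : minSmoothness ℝ 2 ≤ (∞ : WithTop ℕ∞) := by
  rw [minSmoothness_of_isRCLikeNormedField]
  exact WithTop.coe_le_coe.2 le_top

/-- `toCont` as a linear equivalence. -/
def toContL [FiniteDimensional ℝ E] {k : ℕ} : Alt E k ≃ₗ[ℝ] E [⋀^Fin k]→L[ℝ] ℝ where
  toFun := toCont
  map_add' _ _ := rfl
  map_smul' _ _ := rfl
  invFun η := η.toAlternatingMap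
  left_inv _ := rfl
  right_inv _ := rfl

instance [FiniteDimensional ℝ E] (k : ℕ) : FiniteDimensional ℝ (E [⋀^Fin k]→L[ℝ] ℝ) :=
  (toContL (E := E) (k := k)).finiteDimensional

/-- The derivative of a form, with values in the algebraic forms. -/
def altDeriv {k : ℕ} (α : E → E [⋀^Fin k]→L[ℝ] ℝ) (z : E) : E →ₗ[ℝ] Alt E k :=
  (ContinuousAlternatingMap.toAlternatingMapLinear (R := ℝ)) ∘ₗ (fderiv ℝ α z).toLinearMap

theorem extDeriv_toAlternatingMap {k : ℕ} (α : E → E [⋀^Fin k]→L[ℝ] ℝ) (z : E) :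
    (extDeriv α z).toAlternatingMap = AlternatingMap.alternatizeUncurryFin (altDeriv α z) :=
  ContinuousAlternatingMap.toAlternatingMap_alternatizeUncurryFin _

theorem fderiv_apply_eq_zero_of_eventually {f : E → F} {z v : E}
    (h : ∀ᶠ t : ℝ in 𝓝 0, f (z + t • v) = f z) : fderiv ℝ f z v = 0 := by
  by_cases hf : DifferentiableAt ℝ f z
  · rw [← hf.lineDeriv_eq_fderiv, lineDeriv]
    exact (Filter.EventuallyEq.deriv_eq h).trans (deriv_const _ _)
  -- Without differentiability `fderiv` is zero by default, so no hypothesis is needed.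
  · rw [fderiv_zero_of_not_differentiableAt hf]; rfl

theorem eventually_add_smul_mem {s : Set E} (hs : IsOpen s) {z : E} (hz : z ∈ s) (v : E) :
    ∀ᶠ t : ℝ in 𝓝 0, z + t • v ∈ s := by
  have : Filter.Tendsto (fun t : ℝ => z + t • v) (𝓝 0) (𝓝 z) := by
    have h : Continuous fun t : ℝ => z + t • v := by fun_prop
    simpa using h.tendsto 0
  exact this.eventually (hs.mem_nhds hz)

variable {N : Type*} [TopologicalSpace N]

omit [NormedSpace ℝ E] in
theorem chart_trans_mem {e e' : OpenPartialHomeomorph N E} {z : E}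
    (hz : z ∈ (e.symm.trans e').source) : e.symm.trans e' z ∈ (e'.symm.trans e).source := by
  have := (e.symm.trans e').map_source hz
  simpa using this

omit [NormedSpace ℝ E] in
theorem chart_trans_trans {e e' : OpenPartialHomeomorph N E} {z : E}
    (hz : z ∈ (e.symm.trans e').source) : e'.symm.trans e (e.symm.trans e' z) = z := by
  simp at hz
  simp [hz.1, hz.2]

variable [ChartedSpace E N]

theorem IsForm.contDiffAt {k : ℕ} {α : FormRep E N k} (hα : IsForm α)
    {e : OpenPartialHomeomorph N E} (he : e ∈ atlas E N) {z : E} (hz : z ∈ e.target) :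
    ContDiffAt ℝ ∞ (α e) z :=
  (hα.1 e he).contDiffAt (e.open_target.mem_nhds hz)

theorem IsForm.contDiffOn_extDeriv {k : ℕ} {α : FormRep E N k} (hα : IsForm α)
    {e : OpenPartialHomeomorph N E} (he : e ∈ atlas E N) :
    ContDiffOn ℝ ∞ (extDeriv (α e)) e.target :=
  (ContinuousAlternatingMap.alternatizeUncurryFinCLM ℝ E ℝ).contDiff.comp_contDiffOn
    ((hα.1 e he).fderiv_of_isOpen e.open_target (by simp))

variable [IsManifold 𝓘(ℝ, E) ∞ N]

theorem contDiffOn_chart_trans {e e' : OpenPartialHomeomorph N E} (he : e ∈ atlas E N)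
    (he' : e' ∈ atlas E N) : ContDiffOn ℝ ∞ (e.symm.trans e') (e.symm.trans e').source := by
  rw [← contMDiffOn_iff_contDiffOn]
  exact contMDiffOn_of_mem_contDiffGroupoid
    (HasGroupoid.compatible (G := contDiffGroupoid ∞ 𝓘(ℝ, E)) he he')

theorem contDiffAt_chart_trans {e e' : OpenPartialHomeomorph N E} (he : e ∈ atlas E N)
    (he' : e' ∈ atlas E N) {z : E} (hz : z ∈ (e.symm.trans e').source) :
    ContDiffAt ℝ ∞ (e.symm.trans e') z :=
  (contDiffOn_chart_trans he he').contDiffAt ((OpenPartialHomeomorph.open_source _).mem_nhds hz)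

theorem differentiableAt_chart_trans {e e' : OpenPartialHomeomorph N E} (he : e ∈ atlas E N)
    (he' : e' ∈ atlas E N) {z : E} (hz : z ∈ (e.symm.trans e').source) :
    DifferentiableAt ℝ (e.symm.trans e') z :=
  (contDiffAt_chart_trans he he' hz).differentiableAt (by simp)

theorem fderiv_chart_trans_comp {e e' : OpenPartialHomeomorph N E} (he : e ∈ atlas E N)
    (he' : e' ∈ atlas E N) {z : E} (hz : z ∈ (e.symm.trans e').source) (v : E) :
    fderiv ℝ (e'.symm.trans e) (e.symm.trans e' z) (fderiv ℝ (e.symm.trans e') z v) = v := by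
  have h1 := fderiv_comp z (differentiableAt_chart_trans he' he (chart_trans_mem hz))
    (differentiableAt_chart_trans he he' hz)
  have h2 : (e'.symm.trans e) ∘ (e.symm.trans e') =ᶠ[𝓝 z] id :=
    Filter.eventually_of_mem ((OpenPartialHomeomorph.open_source _).mem_nhds hz)
      fun w hw => chart_trans_trans hw
  rw [h2.fderiv_eq, fderiv_id] at h1
  exact (DFunLike.congr_fun h1 v).symm

/-- The differential of a change of coordinates. -/
def chartTransEquiv {e e' : OpenPartialHomeomorph N E} (he : e ∈ atlas E N)
    (he' : e' ∈ atlas E N) {z : E} (hz : z ∈ (e.symm.trans e').source) : E ≃ₗ[ℝ] E where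
  __ := (fderiv ℝ (e.symm.trans e') z).toLinearMap
  invFun := fderiv ℝ (e'.symm.trans e) (e.symm.trans e' z)
  left_inv v := fderiv_chart_trans_comp he he' hz v
  right_inv v := by
    have := fderiv_chart_trans_comp he' he (chart_trans_mem hz) v
    rw [chart_trans_trans hz] at this
    exact this

theorem extDeriv_chart_trans {k : ℕ} {α : FormRep E N k} (hα : IsForm α)
    {e e' : OpenPartialHomeomorph N E} (he : e ∈ atlas E N) (he' : e' ∈ atlas E N) {z : E}
    (hz : z ∈ (e.symm.trans e').source) : extDeriv (α e) z =
      (extDeriv (α e') (e.symm.trans e' z)).compContinuousLinearMap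
        (fderiv ℝ (e.symm.trans e') z) := by
  have hev : α e =ᶠ[𝓝 z] fun z => (α e' (e.symm.trans e' z)).compContinuousLinearMap
      (fderiv ℝ (e.symm.trans e') z) :=
    Filter.eventually_of_mem ((OpenPartialHomeomorph.open_source _).mem_nhds hz)
      fun w hw => hα.2 e he e' he' w hw
  have hz' : e.symm.trans e' z ∈ e'.target := by
    have := (e.symm.trans e').map_source hz
    simp at this
    simpa using this.1
  rw [hev.extDeriv_eq]
  exact extDeriv_pullback (((hα.1 e' he').contDiffAt (e'.open_target.mem_nhds hz')).differentiableAt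
    (by simp)) (contDiffAt_chart_trans he he' hz) minSmoothness_two_le

end Calculus

/-! ### The changes of coordinates of `M` are canonical -/

section Transitions

variable {n m : ℕ}

namespace YCoord

/-- `p^μ_i dy^i ∧ dⁿ⁻¹x_μ`. -/
def momForm (p : Fin n → Fin m → ℝ) : Alt (YCoord n m) n := ∑ μ, ∑ i, p μ i • dyx μ i

theorem momForm_mem (p : Fin n → Fin m → ℝ) : momForm p ∈ horizontalForms (vert n m) n 2 :=
  Submodule.sum_mem _ fun μ _ => Submodule.sum_mem _ fun i _ =>
    Submodule.smul_mem _ _ (dyx_mem μ i)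

end YCoord

namespace MCoord

/-- The form `p^μ_i dy^i ∧ dⁿ⁻¹x_μ` on the space of coordinates. -/
def thetaL (n m : ℕ) : MCoord n m →ₗ[ℝ] MCoord n m [⋀^Fin n]→L[ℝ] ℝ :=
  ∑ μ, ∑ i, (dp μ i).smulRight (toCont (dyx μ i))

theorem thetaL_toAlternatingMap (z : MCoord n m) : (thetaL n m z).toAlternatingMap =
    (YCoord.momForm z.2).compLinearMap (LinearMap.fst ℝ _ _) := by
  have h1 : thetaL n m z = toContL (∑ μ, ∑ i, dp μ i z • dyx μ i) := by
    simp only [thetaL, LinearMap.sum_apply, LinearMap.smulRight_apply, map_sum, map_smul]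
    rfl
  rw [h1]
  change ∑ μ, ∑ i, dp μ i z • dyx μ i = _
  ext v
  simp only [YCoord.momForm, alt_sum_apply, AlternatingMap.compLinearMap_apply,
    AlternatingMap.smul_apply]
  refine Finset.sum_congr rfl fun μ _ => Finset.sum_congr rfl fun i _ => ?_
  rw [dp_apply]
  congr 1
  rw [dyx, YCoord.dyx, covecWedge_apply, covecWedge_apply]
  congr 1
  ext a b
  by_cases hb : b = μ
  · subst hb; simp [dy]
  · simp [Function.update_of_ne hb, dx]

/-- The form of `thetaL` as a smooth family. -/
def theta (n m : ℕ) (z : MCoord n m) : MCoord n m [⋀^Fin n]→L[ℝ] ℝ :=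
  (thetaL n m).toContinuousLinearMap z

theorem hasFDerivAt_theta (z : MCoord n m) :
    HasFDerivAt (theta n m) (thetaL n m).toContinuousLinearMap z :=
  (thetaL n m).toContinuousLinearMap.hasFDerivAt

/-- `Θ` is linear in the point, with constant forms as coefficients of the `p^μ_i`. It is therefore
its own derivative, and `dΘ = Ω` everywhere. -/
theorem alternatize_thetaL : AlternatingMap.alternatizeUncurryFin
    ((ContinuousAlternatingMap.toAlternatingMapLinear (R := ℝ)) ∘ₗ thetaL n m) = Omega n m := by
  have h : (ContinuousAlternatingMap.toAlternatingMapLinear (R := ℝ)) ∘ₗ thetaL n m =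
      ∑ μ, ∑ i, (dp μ i).smulRight (dyx μ i) := by
    refine LinearMap.ext fun z => ?_
    simp only [thetaL, LinearMap.comp_apply, LinearMap.sum_apply, LinearMap.smulRight_apply,
      map_sum, map_smul]
    rfl
  change AlternatingMap.alternatizeUncurryFinLM _ = _
  rw [h]
  simp only [map_sum]
  exact Finset.sum_congr rfl fun μ _ => Finset.sum_congr rfl fun i _ =>
    alternatizeUncurryFin_smulRight _ _

end MCoord

/-! ### Changes of coordinates preserve `Θ` up to multiples of `dⁿx`. -/

namespace FiberedManifold

variable {X Y : Type*} [TopologicalSpace X] [ChartedSpace (Euc n) X]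
  [TopologicalSpace Y] [ChartedSpace (Euc (n + m)) Y] {P : FiberedManifold n m X Y}

open MCoord (IsVert)

theorem AdaptedChart.proj_symm (c : P.AdaptedChart) {y : YCoord n m} (hy : y ∈ c.chart.target) :
    P.proj (c.chart.symm y) = c.base.symm y.1 := by
  have h := c.chart.map_target hy
  rw [← c.base.left_inv (c.proj_mem _ h), c.base_proj _ h, c.chart.right_inv hy]

section

variable {e e' : OpenPartialHomeomorph P.Reduced (MCoord n m)} {c c' : P.AdaptedChart}
  (hc : e.toPartialEquiv = c.partialEquiv) (hc' : e'.toPartialEquiv = c'.partialEquiv)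
include hc

theorem mem_target_iff {z : MCoord n m} : z ∈ e.target ↔ z.1 ∈ c.chart.target := by
  have h : e.target = c.chart.target ×ˢ univ := by rw [hc]; rfl
  rw [h]
  simp

theorem toBase_symm {z : MCoord n m} (hz : z ∈ e.target) :
    P.toBase (e.symm z) = c.base.symm z.1.1 := by
  rw [← c.proj_symm ((mem_target_iff hc).1 hz)]
  change P.toBase (e.toPartialEquiv.symm z) = _
  rw [hc]
  rfl

include hc'

theorem trans_eq : ⇑(e.symm.trans e') = c.partialEquiv.symm.trans c'.partialEquiv := by
  rw [← hc, ← hc']; rfl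

theorem trans_source_eq :
    (e.symm.trans e').source = (c.partialEquiv.symm.trans c'.partialEquiv).source := by
  rw [← hc, ← hc']; rfl

theorem mem_trans_source_iff {z : MCoord n m} : z ∈ (e.symm.trans e').source ↔
    z.1 ∈ c.chart.target ∧ c.chart.symm z.1 ∈ c'.chart.source := by
  rw [trans_source_eq hc hc', AdaptedChart.partialEquiv_trans_source]
  simp

theorem trans_fst {z : MCoord n m} (hz : z ∈ (e.symm.trans e').source) :
    (e.symm.trans e' z).1 = c'.chart (c.chart.symm z.1) := by
  rw [trans_eq hc hc', AdaptedChart.transition_apply c c' (by rwa [← trans_source_eq hc hc'])]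
  rfl

theorem trans_fst_fst {z : MCoord n m} (hz : z ∈ (e.symm.trans e').source) :
    (e.symm.trans e' z).1.1 = c'.base (c.base.symm z.1.1) := by
  have h := (mem_trans_source_iff hc hc').1 hz
  rw [trans_fst hc hc' hz, ← c'.base_proj _ h.2, c.proj_symm h.1]

/-- The new base coordinates depend on the old base coordinates only. -/
theorem isVert_fderiv_trans (he : e ∈ atlas (MCoord n m) P.Reduced)
    (he' : e' ∈ atlas (MCoord n m) P.Reduced) {z : MCoord n m} (hz : z ∈ (e.symm.trans e').source)
    {v : MCoord n m} (hv : IsVert v) : IsVert (fderiv ℝ (e.symm.trans e') z v) := by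
  have h1 := (differentiableAt_chart_trans he he' hz).hasFDerivAt.fst.fst.fderiv
  have h2 : fderiv ℝ (fun z => (e.symm.trans e' z).1.1) z v = 0 := by
    refine fderiv_apply_eq_zero_of_eventually ?_
    filter_upwards [eventually_add_smul_mem (OpenPartialHomeomorph.open_source _) hz v] with t ht
    rw [trans_fst_fst hc hc' ht, trans_fst_fst hc hc' hz]
    have hv' : v.1.1 = 0 := hv
    simp [hv']
  rw [h1] at h2
  exact h2

theorem fderiv_trans_fst (he : e ∈ atlas (MCoord n m) P.Reduced)
    (he' : e' ∈ atlas (MCoord n m) P.Reduced) {z : MCoord n m} (hz : z ∈ (e.symm.trans e').source)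
    (v : MCoord n m) : (fderiv ℝ (e.symm.trans e') z v).1 =
      c'.dchart (c.chart.symm z.1) (c.frame (c.chart.symm z.1) v.1) := by
  have h := (mem_trans_source_iff hc hc').1 hz
  have hy := c.chart.map_target h.1
  rw [AdaptedChart.dchart_frame_eq c' c h.2 hy, c.chart.right_inv h.1]
  have h1 := (differentiableAt_chart_trans he he' hz).hasFDerivAt.fst.fderiv
  have h2 : (fun z => (e.symm.trans e' z).1) =ᶠ[𝓝 z] (c.chart.symm.trans c'.chart) ∘ Prod.fst :=
    Filter.eventually_of_mem ((OpenPartialHomeomorph.open_source _).mem_nhds hz)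
      fun w hw => trans_fst hc hc' hw
  have hmem : z.1 ∈ (c.chart.symm.trans c'.chart).source := by simpa using h
  have h3 : DifferentiableAt ℝ (c.chart.symm.trans c'.chart) z.1 :=
    ((AdaptedChart.contDiffOn_transition c c').contDiffAt
      ((OpenPartialHomeomorph.open_source _).mem_nhds hmem)).differentiableAt (by simp)
  rw [h2.fderiv_eq, fderiv_comp z h3 differentiableAt_fst, fderiv_fst] at h1
  exact (DFunLike.congr_fun h1 v).symm

/-- `Θ` at a point of `M` is a lift of the class which that point represents, and different
coordinates choose lifts that differ by a form killed by one vertical vector. -/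
theorem theta_trans (he : e ∈ atlas (MCoord n m) P.Reduced)
    (he' : e' ∈ atlas (MCoord n m) P.Reduced) {z : MCoord n m} (hz : z ∈ (e.symm.trans e').source) :
    (MCoord.theta n m (e.symm.trans e' z)).toAlternatingMap.compLinearMap
        (fderiv ℝ (e.symm.trans e') z).toLinearMap - (MCoord.theta n m z).toAlternatingMap ∈
      annVec IsVert n := by
  have h := (mem_trans_source_iff hc hc').1 hz
  set y := c.chart.symm z.1 with hy_def
  have hy := c.chart.map_target h.1
  let B : YCoord n m →ₗ[ℝ] YCoord n m := c.dchart y ∘ₗ c'.frame y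
  let A : YCoord n m →ₗ[ℝ] YCoord n m := c'.dchart y ∘ₗ c.frame y
  have hBA : ∀ v, B (A v) = v := fun v => by
    change c.dchart y (c'.frame y (c'.dchart y (c.frame y v))) = v
    rw [c'.frame_dchart h.2, c.dchart_frame hy]
  have hA : ∀ v ∈ YCoord.vert n m, A v ∈ YCoord.vert n m := fun v hv =>
    (c'.mem_vertical h.2 _).1 (c.frame_mem_vertical hy hv)
  have hB : ∀ v ∈ YCoord.vert n m, B v ∈ YCoord.vert n m := fun v hv =>
    (c.mem_vertical hy _).1 (c'.frame_mem_vertical h.2 hv)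
  set p' := (e.symm.trans e' z).2 with hp'
  have hp : ∀ ν j, p' ν j = (YCoord.momForm z.2).compLinearMap B
      (Function.update YCoord.ex ν (YCoord.ey j)) := by
    intro ν j
    rw [hp', trans_eq hc hc', AdaptedChart.transition_apply c c'
      (by rwa [← trans_source_eq hc hc'])]
    refine congrArg (YCoord.momForm z.2) (funext fun k => ?_)
    change _ = c.dchart y (c'.frame y _)
    rw [AdaptedChart.dchart_frame_eq c c' hy h.2]
    rfl
  -- The new momenta are by definition the values of the transported form on frames with one
  -- vertical vector, so the difference vanishes on all of these.
  have key : YCoord.momForm p' - (YCoord.momForm z.2).compLinearMap B ∈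
      horizontalForms (YCoord.vert n m) n 1 := by
    refine YCoord.mem_one_of_coord (Submodule.sub_mem _ (YCoord.momForm_mem _)
      (horizontalForms_comp (YCoord.momForm_mem _) B hB)) fun μ i => ?_
    rw [AlternatingMap.sub_apply, ← hp]
    exact sub_eq_zero.2 (AdaptedChart.sum_dyx_apply p' μ i)
  have key2 := horizontalForms_comp key A hA
  intro v s hs
  have h1 := key2 (fun i => (v i).1) {s} (by simp)
    fun i hi => by obtain rfl := Finset.mem_singleton.1 hi; exact hs
  rw [AlternatingMap.compLinearMap_apply, AlternatingMap.sub_apply,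
    AlternatingMap.compLinearMap_apply] at h1
  rw [AlternatingMap.sub_apply]
  refine Eq.trans (congrArg₂ _ ?_ ?_) h1
  · rw [AlternatingMap.compLinearMap_apply]
    change (MCoord.thetaL n m _).toAlternatingMap _ = _
    rw [MCoord.thetaL_toAlternatingMap, AlternatingMap.compLinearMap_apply]
    refine congrArg _ (funext fun i => ?_)
    exact fderiv_trans_fst hc hc' he he' hz (v i)
  · change (MCoord.thetaL n m _).toAlternatingMap _ = _
    rw [MCoord.thetaL_toAlternatingMap, AlternatingMap.compLinearMap_apply]
    refine congrArg _ (funext fun i => ?_)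
    exact (hBA _).symm

end

/-- Differentiate `φ^*Θ = Θ + f dⁿx`; pullback commutes with `d`, and the error becomes `df ∧ dⁿx`.
-/
theorem isCanonical_trans {e e' : OpenPartialHomeomorph P.Reduced (MCoord n m)}
    (he : e ∈ atlas (MCoord n m) P.Reduced) (he' : e' ∈ atlas (MCoord n m) P.Reduced)
    {z : MCoord n m} (hz : z ∈ (e.symm.trans e').source) :
    MCoord.IsCanonical (chartTransEquiv he he' hz) := by
  obtain ⟨c, hc⟩ := (P.mem_atlas_iff e).1 he
  obtain ⟨c', hc'⟩ := (P.mem_atlas_iff e').1 he'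
  refine ⟨fun v => ⟨fun hv => ?_, fun hv => isVert_fderiv_trans hc hc' he he' hz hv⟩, ?_⟩
  · have := isVert_fderiv_trans hc' hc he' he (chart_trans_mem hz) hv
    rwa [show fderiv ℝ (e'.symm.trans e) (e.symm.trans e' z) (chartTransEquiv he he' hz v) = v from
      fderiv_chart_trans_comp he he' hz v] at this
  · set φ := e.symm.trans e' with hφ
    let Θ : MCoord n m → MCoord n m [⋀^Fin n]→L[ℝ] ℝ := fun z =>
      (MCoord.theta n m (φ z)).compContinuousLinearMap (fderiv ℝ φ z)
    -- Evaluation on `(∂/∂x¹, …, ∂/∂xⁿ)`, where `dⁿx` equals `1`, recovers the factor and shows that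
    -- it is differentiable.
    let f : MCoord n m → ℝ := fun z => Θ z MCoord.ex - MCoord.theta n m z MCoord.ex
    have hdx : MCoord.dxs n m MCoord.ex = 1 := by
      rw [MCoord.dxs, covecWedge_apply, ← Matrix.det_one (n := Fin n)]
      congr 1
      ext a b
      simp [MCoord.dx_ex, Matrix.one_apply, eq_comm]
    have hΘ : Θ =ᶠ[𝓝 z] fun z => MCoord.theta n m z + f z • toCont (MCoord.dxs n m) := by
      refine Filter.eventually_of_mem (φ.open_source.mem_nhds hz) fun w hw => ?_
      obtain ⟨d, hd⟩ := MCoord.eq_smul_dxs (theta_trans hc hc' he he' hw)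
      have hd' : (Θ w).toAlternatingMap - (MCoord.theta n m w).toAlternatingMap =
        d • MCoord.dxs n m := hd
      have hfd : f w = d := by
        have := congrArg (fun η : Alt (MCoord n m) n => η MCoord.ex) hd'
        simpa [hdx] using this
      ext v
      have := congrArg (fun η : Alt (MCoord n m) n => η v) hd'
      rw [← hfd] at this
      exact eq_add_of_sub_eq' this
    have hdiff : DifferentiableAt ℝ Θ z := by
      refine DifferentiableAt.continuousAlternatingMapCompContinuousLinearMap ?_ ?_
      · exact (MCoord.hasFDerivAt_theta _).differentiableAt.comp z
          (differentiableAt_chart_trans he he' hz)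
      · exact ((contDiffAt_chart_trans he he' hz).fderiv_right (m := ∞) (by simp)).differentiableAt
          (by simp)
    have hf : DifferentiableAt ℝ f z :=
      (hdiff.continuousAlternatingMap_apply_const _).sub
        ((MCoord.hasFDerivAt_theta z).differentiableAt.continuousAlternatingMap_apply_const _)
    refine ⟨(fderiv ℝ f z).toLinearMap, ?_⟩
    have h1 := extDeriv_pullback (r := ∞) (MCoord.hasFDerivAt_theta (φ z)).differentiableAt
      (contDiffAt_chart_trans he he' hz) minSmoothness_two_le
    have h2 : extDeriv Θ z = _ := hΘ.extDeriv_eq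
    have h0 : ∀ w, (extDeriv (MCoord.theta n m) w).toAlternatingMap = MCoord.Omega n m := by
      intro w
      rw [extDeriv_toAlternatingMap, altDeriv, (MCoord.hasFDerivAt_theta w).fderiv]
      exact MCoord.alternatize_thetaL
    have h3 : (extDeriv (fun z => MCoord.theta n m z + f z • toCont (MCoord.dxs n m))
        z).toAlternatingMap = MCoord.Omega n m +
          covecWedge (Matrix.vecCons (fderiv ℝ f z).toLinearMap MCoord.dx) := by
      rw [extDeriv_fun_add (MCoord.hasFDerivAt_theta z).differentiableAt (hf.smul_const _)]
      change (extDeriv (MCoord.theta n m) z).toAlternatingMap + (extDeriv _ z).toAlternatingMap = _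
      rw [h0, extDeriv_toAlternatingMap, altDeriv, fderiv_smul_const hf,
        ← alternatizeUncurryFin_smulRight]
      rfl
    rw [← h3, ← h2]
    refine Eq.trans ?_ (congrArg ContinuousAlternatingMap.toAlternatingMap h1).symm
    rw [← h0 (φ z)]
    rfl

end FiberedManifold
end Transitions

/-! ### Lie derivatives along Hamiltonian vector fields, at a point -/

section LieAlgebraic

variable {V : Type*} [AddCommGroup V] [Module ℝ V]

open AlternatingMap (alternatizeUncurryFin alternatizeUncurryFin_apply)

theorem neg_one_pow_mul_vecCons_removeNth {k : ℕ} (η : Alt V (k + 1)) (i : Fin (k + 1)) (u : V)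
    (v : Fin (k + 1) → V) :
    (-1 : ℝ) ^ (i : ℕ) * η (Matrix.vecCons u (i.removeNth v)) = η (Function.update v i u) := by
  have h := η.neg_one_pow_smul_map_insertNth i u (i.removeNth v)
  rw [Fin.insertNth_removeNth] at h
  rw [← h]
  rcases Nat.even_or_odd (i : ℕ) with hi | hi <;> simp [hi.neg_one_pow]

/-- Separates the derivative along `w` from the others. In the latter, `w` is moved into the slot
vacated by `v i`, which absorbs the alternating sign. -/
theorem alternatizeUncurryFin_vecCons {k : ℕ} (D : V →ₗ[ℝ] Alt V (k + 1)) (w : V)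
    (v : Fin (k + 1) → V) : alternatizeUncurryFin D (Matrix.vecCons w v) =
      D w v - ∑ i, D (v i) (Function.update v i w) := by
  rw [alternatizeUncurryFin_apply, Fin.sum_univ_succ, sub_eq_add_neg, ← Finset.sum_neg_distrib]
  congr 1
  · simp
  · refine Finset.sum_congr rfl fun i _ => ?_
    rw [← neg_one_pow_mul_vecCons_removeNth]
    have h : i.succ.removeNth (Matrix.vecCons w v : Fin (k + 2) → V) =
        Matrix.vecCons w (i.removeNth v) := by
      ext j
      refine Fin.cases ?_ (fun j => ?_) j <;> simp [Fin.removeNth]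
    rw [h]
    simp [pow_succ]

/-- The algebraic form of Cartan's formula `d ι_X η = L_X η` for a closed form `η`. -/
theorem alternatizeUncurryFin_interior {k : ℕ} (D : V →ₗ[ℝ] Alt V (k + 1))
    (hD : alternatizeUncurryFin D = 0) (η : Alt V (k + 1)) (x : V) (T : V →ₗ[ℝ] V)
    (G : V →ₗ[ℝ] Alt V k) (hG : ∀ w, G w = (D w).curryLeft x + η.curryLeft (T w))
    (v : Fin (k + 1) → V) : alternatizeUncurryFin G v =
      D x v + ∑ i, η (Function.update v i (T (v i))) := by
  have h := alternatizeUncurryFin_vecCons D x v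
  rw [hD, AlternatingMap.zero_apply, eq_comm, sub_eq_zero] at h
  rw [h, alternatizeUncurryFin_apply, ← Finset.sum_add_distrib]
  refine Finset.sum_congr rfl fun i _ => ?_
  rw [hG, ← neg_one_pow_mul_vecCons_removeNth, ← neg_one_pow_mul_vecCons_removeNth, ← mul_add]
  simp [mul_add]

end LieAlgebraic

/-! ### The linear part of a Hamiltonian vector field and its action on forms. -/

namespace MCoord

variable {n m b : ℕ}

theorem sharpTop_apply_update {w : MCoord n m × Alt (MCoord n m) n} (hw : w ∈ sharpTop n m)
    (μ : Fin n) (i : Fin m) : w.2 (Function.update ex μ (ey i)) = -dp μ i w.1 := by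
  induction hw using Submodule.span_induction with
  | zero => simp
  | add x y _ _ hx hy => rw [Prod.snd_add, AlternatingMap.add_apply, hx, hy, Prod.fst_add, map_add,
      neg_add]
  | smul c x _ hx => rw [Prod.smul_snd, AlternatingMap.smul_apply, hx, Prod.smul_fst, map_smul,
      smul_neg]
  | mem w hw =>
    rcases hw with (rfl | ⟨⟨ν, j⟩, rfl⟩) | ⟨j, rfl⟩
    · simp [dxs_update (isVert_ey _)]
    · simp only [dyx_update _ _ _ (isVert_ey _), dy_ey, map_neg, dp_ep, neg_neg]
      by_cases h : ν = μ
      · simp [h, eq_comm]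
      · simp [h, Ne.symm h]
    · simp [dpx_update _ _ (isVert_ey _), dp_ey]

theorem sharpTop_apply_update_ep {w : MCoord n m × Alt (MCoord n m) n} (hw : w ∈ sharpTop n m)
    (μ ν : Fin n) (i : Fin m) :
    w.2 (Function.update ex μ (ep ν i)) = if μ = ν then dy i w.1 else 0 := by
  induction hw using Submodule.span_induction with
  | zero => simp
  | add x y _ _ hx hy =>
    rw [Prod.snd_add, AlternatingMap.add_apply, hx, hy, Prod.fst_add, map_add]
    split_ifs <;> simp
  | smul c x _ hx =>
    rw [Prod.smul_snd, AlternatingMap.smul_apply, hx, Prod.smul_fst, map_smul]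
    split_ifs <;> simp
  | mem w hw =>
    rcases hw with (rfl | ⟨⟨ν, j⟩, rfl⟩) | ⟨j, rfl⟩
    · simp [dxs_update (isVert_ep _ _)]
    · simp [dyx_update _ _ _ (isVert_ep _ _), dy_ep]
    · simp only [dpx_update _ _ (isVert_ep _ _), dp_ep, dy_ey]
      by_cases h : ν = μ
      · simp [h, eq_comm]
      · simp [Ne.symm h]

section

variable {D : MCoord (b + 1) m →ₗ[ℝ] Alt (MCoord (b + 1) m) (b + 1)}
  (hS : ∀ w, D w ∈ S (b + 1) m (b + 1)) (hD : AlternatingMap.alternatizeUncurryFin D = 0)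
include hS hD

/-- The linear part of a Hamiltonian vector field at a point: `∂/∂p^ν_j ↦ M_j^k ∂/∂p^ν_k`. -/
theorem sharpVec_derivative_ep (hb : 1 ≤ b) (ν : Fin (b + 1)) (j : Fin m) :
    sharpVec b m (D (ep ν j)) = ∑ k, (-dy j (sharpVec b m (D (ey k)))) • ep ν k := by
  have hmem := fun w => sharpVec_mem (hS w)
  have hcl : ∀ w v, D w v = ∑ i, D (v i) (Function.update v i w) := fun w v => by
    have h := alternatizeUncurryFin_vecCons D w v
    rwa [hD, AlternatingMap.zero_apply, eq_comm, sub_eq_zero] at h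
  -- Closedness, tested on one vertical vector among the `∂/∂x^ρ`. Replacing another slot leaves two
  -- vertical arguments and gives zero, so only the exchange of `u` and `w` remains.
  have hone : ∀ {u w : MCoord (b + 1) m} (_ : IsVert u) (_ : IsVert w) (μ : Fin (b + 1)),
      D w (Function.update ex μ u) = D u (Function.update ex μ w) := by
    intro u w hu hw μ
    rw [hcl, Finset.sum_eq_single μ]
    · simp
    · intro l _ hl
      rw [Function.update_of_ne hl]
      refine S_le_horiz2 _ (hS _) _ μ l hl.symm ⟨?_, ?_⟩
      · simpa [Function.update_of_ne hl.symm] using hu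
      · simpa using hw
    · simp
  -- The `∂/∂y^i`-component can be read off in any slot `μ`. A slot different from `ν`, available
  -- since `n ≥ 2`, turns it by symmetry into an off-diagonal coefficient, which is zero.
  have hy : ∀ i, dy i (sharpVec b m (D (ep ν j))) = 0 := by
    intro i
    obtain ⟨μ, hμ⟩ : ∃ μ : Fin (b + 1), μ ≠ ν :=
      haveI : Nontrivial (Fin (b + 1)) := Fin.nontrivial_iff_two_le.2 (by omega)
      exists_ne ν
    have h1 := sharpTop_apply_update_ep (hmem (ep ν j)) μ μ i
    rw [if_pos rfl] at h1
    rw [← h1]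
    change D (ep ν j) _ = 0
    rw [hone (isVert_ep μ i) (isVert_ep ν j) μ]
    have h2 := sharpTop_apply_update_ep (hmem (ep μ i)) μ ν j
    rwa [if_neg hμ] at h2
  -- The same symmetry exchanges `∂/∂p^ν_j` and `∂/∂y^i`; the diagonal shape of the `dp`-part of `D
  -- (ey i)` yields the condition `μ = ν`.
  have hp : ∀ μ i, dp μ i (sharpVec b m (D (ep ν j))) =
      if μ = ν then -dy j (sharpVec b m (D (ey i))) else 0 := by
    intro μ i
    have h1 := sharpTop_apply_update (hmem (ep ν j)) μ i
    have h2 := sharpTop_apply_update_ep (hmem (ey i)) μ ν j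
    rw [eq_neg_iff_add_eq_zero, add_comm, ← eq_neg_iff_add_eq_zero] at h1
    rw [h1]
    change -(D (ep ν j) _) = _
    rw [hone (isVert_ey i) (isVert_ep ν j) μ]
    change -(sharpVec b m (D (ey i)), D (ey i)).2 _ = _
    rw [h2]
    split_ifs <;> simp
  conv_lhs => rw [eq_sum (sharpVec b m (D (ep ν j)))]
  simp [hy, hp, (isVert_sharpVec _).dx]

theorem isMomVert_sharpVec_derivative (hb : 1 ≤ b) {w : MCoord (b + 1) m} (hw : IsMomVert w) :
    IsMomVert (sharpVec b m (D w)) := by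
  have h : IsMomVert (sharpVec b m (D (∑ μ, ∑ i, dp μ i w • ep μ i))) := by
    simp only [map_sum, map_smul, sharpVec_derivative_ep hS hD hb]
    change (∑ μ, _ : MCoord (b + 1) m).1 = 0
    simp only [Prod.fst_sum, Prod.smul_fst]
    simp [ep]
  have h2 := eq_sum w
  simp only [hw.isVert.dx, hw.dy, zero_smul, Finset.sum_const_zero, zero_add] at h2
  rwa [← h2] at h

end

/-- Replacing arguments by vertical ones preserves `horiz2`. -/
theorem sum_update_mem_horiz2 {k : ℕ} {η σ : Alt (MCoord n m) k} (hη : η ∈ horiz2 n m k)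
    {T : MCoord n m → MCoord n m} (hT : ∀ w, IsVert (T w))
    (hσ : ∀ v, σ v = ∑ i, η (Function.update v i (T (v i)))) : σ ∈ horiz2 n m k := by
  intro v s t hst ⟨hs, ht⟩
  rw [hσ]
  refine Finset.sum_eq_zero fun i _ => hη _ s t hst ⟨?_, ?_⟩
  · by_cases h : s = i
    · subst h; simpa using hT _
    · simpa [Function.update_of_ne h] using hs
  · by_cases h : t = i
    · subst h; simpa using hT _
    · simpa [Function.update_of_ne h] using ht

theorem sum_update_mem_dxdySpan {a : ℕ} {η σ : Alt (MCoord n m) (a + 1)} (hη : η ∈ dxdySpan n m a)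
    {T : MCoord n m → MCoord n m} (hT : ∀ w, IsVert (T w))
    (hT' : ∀ w, IsMomVert w → IsMomVert (T w))
    (hσ : ∀ v, σ v = ∑ i, η (Function.update v i (T (v i)))) : σ ∈ dxdySpan n m a := by
  rw [mem_dxdySpan_iff] at hη ⊢
  refine ⟨fun v s hs => ?_, sum_update_mem_horiz2 hη.2 hT hσ⟩
  rw [hσ]
  refine Finset.sum_eq_zero fun i _ => hη.1 _ s ?_
  by_cases h : s = i
  · subst h; simpa using hT' _ hs
  · simpa [Function.update_of_ne h] using hs

/-- The linear part keeps the upper index of `∂/∂p^ν_j` and mixes lower indices independently of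
`ν`, so the diagonal shape of the `dp`-coefficients persists. -/
theorem sum_update_mem_S {D : MCoord (b + 1) m →ₗ[ℝ] Alt (MCoord (b + 1) m) (b + 1)}
    (hS : ∀ w, D w ∈ S (b + 1) m (b + 1)) (hD : AlternatingMap.alternatizeUncurryFin D = 0)
    {η σ : Alt (MCoord (b + 1) m) (b + 1)} (hη : η ∈ S (b + 1) m (b + 1))
    (hσ : ∀ v, σ v = ∑ i, η (Function.update v i (sharpVec b m (D (v i))))) :
    σ ∈ S (b + 1) m (b + 1) := by
  have h2 := sum_update_mem_horiz2 (S_le_horiz2 _ hη) (fun w => isVert_sharpVec (D w)) hσ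
  rcases Nat.eq_zero_or_pos b with rfl | hb
  -- For `n = 1` there is a single upper index, and the diagonal condition is vacuous.
  · refine mem_S_top h2 (fun j => σ (Function.update ex 0 (ep 0 j))) fun μ ν j => ?_
    obtain rfl : μ = 0 := Fin.ext (by omega)
    obtain rfl : ν = 0 := Fin.ext (by omega)
    rw [if_pos rfl]
  · rw [S_self] at hη
    obtain ⟨A, hA⟩ := exists_of_mem_topS hη
    refine mem_S_top h2 (fun j => ∑ k, -dy j (sharpVec b m (D (ey k))) * A k) fun μ ν j => ?_
    -- Acting on a slot other than `μ` gives two vertical arguments, hence zero.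
    rw [hσ, Finset.sum_eq_single μ]
    · rw [Function.update_self, Function.update_idem, sharpVec_derivative_ep hS hD hb,
        η.map_update_sum]
      simp only [η.map_update_smul, hA]
      split_ifs <;> simp
    · intro l _ hl
      rw [← S_self] at hη
      refine S_le_horiz2 _ hη _ μ l hl.symm ⟨?_, ?_⟩
      · simpa [Function.update_of_ne hl.symm] using isVert_ep ν j
      · simpa using isVert_sharpVec _
    · simp

end MCoord

/-! ### Operations on differential forms -/

section Operations

variable {E F : Type*} [NormedAddCommGroup E] [NormedSpace ℝ E] [FiniteDimensional ℝ E]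
  [NormedAddCommGroup F] [NormedSpace ℝ F]

/-- The exterior product as a continuous bilinear map. -/
def wedgeL (E : Type*) [NormedAddCommGroup E] [NormedSpace ℝ E] [FiniteDimensional ℝ E] (a b : ℕ) :
    E [⋀^Fin a]→L[ℝ] ℝ →L[ℝ] E [⋀^Fin b]→L[ℝ] ℝ →L[ℝ] E [⋀^Fin (a + b)]→L[ℝ] ℝ :=
  (((wedgeAlt (V := E) (a := a) (b := b)).compl₁₂ (toContL (E := E) (k := a)).symm.toLinearMap
    (toContL (E := E) (k := b)).symm.toLinearMap).compr₂
      (toContL (E := E) (k := a + b)).toLinearMap).toContinuousBilinearMap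

/-- The interior product as a continuous bilinear map. -/
def interiorL (E : Type*) [NormedAddCommGroup E] [NormedSpace ℝ E] [FiniteDimensional ℝ E] (a : ℕ) :
    E [⋀^Fin (a + 1)]→L[ℝ] ℝ →L[ℝ] E →L[ℝ] E [⋀^Fin a]→L[ℝ] ℝ :=
  (((AlternatingMap.curryLeftLinearMap (R := ℝ) (M := E) (N := ℝ) (n := a)).comp
    (toContL (E := E) (k := a + 1)).symm.toLinearMap).compr₂
      (toContL (E := E) (k := a)).toLinearMap).toContinuousBilinearMap

/-- For closed `ε`, `d(α ∧ ε) = dα ∧ ε`. -/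
theorem extDeriv_wedgeForm {a k : ℕ} {α : E → E [⋀^Fin a]→L[ℝ] ℝ} {ε : E → E [⋀^Fin k]→L[ℝ] ℝ}
    {z : E} (hα : DifferentiableAt ℝ α z) (hε : DifferentiableAt ℝ ε z) (hcl : extDeriv ε z = 0) :
    (extDeriv (fun z => wedgeForm (α z) (ε z)) z).toAlternatingMap =
      (wedgeAlt (extDeriv α z).toAlternatingMap (ε z).toAlternatingMap).domDomCongr
        (finCongr (Nat.succ_add_eq_add_succ a k)) := by
  have h : altDeriv (fun z => wedgeForm (α z) (ε z)) z =
      wedgeAlt (α z).toAlternatingMap ∘ₗ altDeriv ε z +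
        (wedgeAlt (b := k)).flip (ε z).toAlternatingMap ∘ₗ altDeriv α z := by
    rw [altDeriv]
    change _ ∘ₗ (fderiv ℝ (fun z => wedgeL E a k (α z) (ε z)) z).toLinearMap = _
    rw [(wedgeL E a k).fderiv_of_bilinear hα hε]
    rfl
  have hcl' : AlternatingMap.alternatizeUncurryFin (altDeriv ε z) = 0 := by
    rw [← extDeriv_toAlternatingMap, hcl]; rfl
  rw [extDeriv_toAlternatingMap, h, AlternatingMap.alternatizeUncurryFin_add,
    alternatizeUncurryFin_wedgeAlt_right, hcl', map_zero, smul_zero, zero_add,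
    alternatizeUncurryFin_wedgeAlt_left, extDeriv_toAlternatingMap]

/-- Cartan's formula for the derivative of `ι_X η`, where `η` is closed and `X = L ζ`. -/
theorem extDeriv_interior {a k : ℕ} (L : Alt E k →ₗ[ℝ] E) {η : E → E [⋀^Fin (a + 1)]→L[ℝ] ℝ}
    {ζ : E → E [⋀^Fin k]→L[ℝ] ℝ} {z : E} (hη : DifferentiableAt ℝ η z)
    (hζ : DifferentiableAt ℝ ζ z) (hcl : extDeriv η z = 0) (v : Fin (a + 1) → E) :
    extDeriv (fun z => toCont ((η z).toAlternatingMap.curryLeft (L (ζ z).toAlternatingMap))) z v =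
      altDeriv η z (L (ζ z).toAlternatingMap) v +
        ∑ i, (η z).toAlternatingMap (Function.update v i (L (altDeriv ζ z (v i)))) := by
  let L' : E [⋀^Fin k]→L[ℝ] ℝ →L[ℝ] E :=
    (L ∘ₗ (toContL (E := E) (k := k)).symm.toLinearMap).toContinuousLinearMap
  have hcl' : AlternatingMap.alternatizeUncurryFin (altDeriv η z) = 0 := by
    rw [← extDeriv_toAlternatingMap, hcl]; rfl
  have hX : HasFDerivAt (fun z => L' (ζ z)) (L'.comp (fderiv ℝ ζ z)) z :=
    L'.hasFDerivAt.comp z hζ.hasFDerivAt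
  have hG : ∀ w, altDeriv (fun z => interiorL E a (η z) (L' (ζ z))) z w =
      (altDeriv η z w).curryLeft (L' (ζ z)) +
        (η z).toAlternatingMap.curryLeft ((L ∘ₗ altDeriv ζ z) w) := by
    intro w
    rw [altDeriv, (interiorL E a).fderiv_of_bilinear hη hX.differentiableAt, hX.fderiv, add_comm]
    rfl
  have h := alternatizeUncurryFin_interior (altDeriv η z) hcl' (η z).toAlternatingMap (L' (ζ z))
    (L ∘ₗ altDeriv ζ z) _ hG v
  rw [← extDeriv_toAlternatingMap] at h
  exact h

/-- The derivative of a form with values in a subspace takes values in this subspace. -/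
theorem altDeriv_mem {k : ℕ} {α : E → E [⋀^Fin k]→L[ℝ] ℝ} {z : E} (T : Submodule ℝ (Alt E k))
    (hα : DifferentiableAt ℝ α z) (h : ∀ᶠ w in 𝓝 z, (α w).toAlternatingMap ∈ T) (w : E) :
    altDeriv α z w ∈ T := by
  by_contra hn
  -- A functional that vanishes on `T` but not at the derivative; composed with `α` it is locally
  -- zero, which is a contradiction.
  obtain ⟨f, hf, hT⟩ := Submodule.exists_le_ker_of_notMem hn
  let L : E [⋀^Fin k]→L[ℝ] ℝ →L[ℝ] ℝ :=
    (f ∘ₗ (toContL (E := E) (k := k)).symm.toLinearMap).toContinuousLinearMap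
  have h0 : (fun w => L (α w)) =ᶠ[𝓝 z] fun _ => 0 := h.mono fun w hw => hT hw
  have h1 : fderiv ℝ (fun w => L (α w)) z = 0 := h0.fderiv_eq.trans (fderiv_const_apply 0)
  have h2 : fderiv ℝ (fun w => L (α w)) z = L.comp (fderiv ℝ α z) :=
    (L.hasFDerivAt.comp z hα.hasFDerivAt).fderiv
  rw [h2] at h1
  exact hf (DFunLike.congr_fun h1 w)

variable {N : Type*} [TopologicalSpace N] [ChartedSpace E N]

omit [FiniteDimensional ℝ E] in
theorem IsForm.differentiableAt {k : ℕ} {α : FormRep E N k} (hα : IsForm α)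
    {e : OpenPartialHomeomorph N E} (he : e ∈ atlas E N) {z : E} (hz : z ∈ e.target) :
    DifferentiableAt ℝ (α e) z :=
  (hα.contDiffAt he hz).differentiableAt (by simp)

theorem IsForm.wedge {a k : ℕ} {α : FormRep E N a} {ε : FormRep E N k} (hα : IsForm α)
    (hε : IsForm ε) : IsForm fun e z => wedgeForm (α e z) (ε e z) := by
  refine ⟨fun e he => ?_, fun e he e' he' z hz => ?_⟩
  · exact ((wedgeL E a k).contDiff.comp_contDiffOn (hα.1 e he)).clm_apply (hε.1 e he)
  · apply ContinuousAlternatingMap.toAlternatingMap_injective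
    change wedgeAlt _ _ = (wedgeAlt _ _).compLinearMap (fderiv ℝ (e.symm.trans e') z).toLinearMap
    rw [wedgeAlt_compLinearMap, hα.2 e he e' he' z hz, hε.2 e he e' he' z hz]
    rfl

omit [FiniteDimensional ℝ E] in
theorem IsForm.congr {k : ℕ} {α β : FormRep E N k} (hα : IsForm α)
    (h : ∀ e ∈ atlas E N, ∀ z ∈ e.target, α e z = β e z) : IsForm β := by
  refine ⟨fun e he => (hα.1 e he).congr fun z hz => (h e he z hz).symm,
    fun e he e' he' z hz => ?_⟩
  have hz1 : z ∈ e.target := by simp at hz; exact hz.1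
  have hz2 : e.symm.trans e' z ∈ e'.target := by
    have := chart_trans_mem hz
    simp only [OpenPartialHomeomorph.trans_source] at this
    exact this.1
  rw [← h e he z hz1, ← h e' he' _ hz2]
  exact hα.2 e he e' he' z hz

omit [FiniteDimensional ℝ E] in
theorem extDeriv_congr_on {k : ℕ} {α β : E → E [⋀^Fin k]→L[ℝ] ℝ} {s : Set E} (hs : IsOpen s)
    (h : ∀ z ∈ s, α z = β z) {z : E} (hz : z ∈ s) : extDeriv α z = extDeriv β z :=
  Filter.EventuallyEq.extDeriv_eq (Filter.eventually_of_mem (hs.mem_nhds hz) h)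

variable (N) in
/-- The forms whose exterior derivative takes values in `T`. -/
def formsWith {a : ℕ} (T : Submodule ℝ (Alt E (a + 1))) : Submodule ℝ (FormRep E N a) where
  carrier := {α | IsForm α ∧ ∀ e ∈ atlas E N, ∀ z ∈ e.target, (extDeriv (α e) z).toAlternatingMap ∈ T}
  add_mem' := by
    rintro α β ⟨hα, hα'⟩ ⟨hβ, hβ'⟩
    refine ⟨⟨fun e he => (hα.1 e he).add (hβ.1 e he), fun e he e' he' z hz => ?_⟩,
      fun e he z hz => ?_⟩
    · change α e z + β e z = _
      rw [hα.2 e he e' he' z hz, hβ.2 e he e' he' z hz]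
      rfl
    · change (extDeriv (α e + β e) z).toAlternatingMap ∈ T
      rw [extDeriv_add (hα.differentiableAt he hz) (hβ.differentiableAt he hz)]
      exact T.add_mem (hα' e he z hz) (hβ' e he z hz)
  zero_mem' := by
    refine ⟨⟨fun e he => contDiffOn_const, fun e he e' he' z hz => rfl⟩, fun e he z hz => ?_⟩
    have : extDeriv ((0 : FormRep E N a) e) z = 0 := by
      have h := extDeriv_smul (x := z) (0 : ℝ) ((0 : FormRep E N a) e)
      rw [zero_smul, zero_smul] at h
      exact h
    rw [this]
    exact T.zero_mem
  smul_mem' := by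
    rintro c α ⟨hα, hα'⟩
    refine ⟨⟨fun e he => (hα.1 e he).const_smul c, fun e he e' he' z hz => ?_⟩,
      fun e he z hz => ?_⟩
    · change c • α e z = _
      rw [hα.2 e he e' he' z hz]
      rfl
    · change (extDeriv (c • α e) z).toAlternatingMap ∈ T
      rw [extDeriv_smul]
      exact T.smul_mem c (hα' e he z hz)

omit [FiniteDimensional ℝ E] in
theorem formsWith_congr {a : ℕ} {T : Submodule ℝ (Alt E (a + 1))} {α β : FormRep E N a}
    (hα : α ∈ formsWith N T) (h : ∀ e ∈ atlas E N, ∀ z ∈ e.target, α e z = β e z) :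
    β ∈ formsWith N T := by
  refine ⟨hα.1.congr h, fun e he z hz => ?_⟩
  rw [← extDeriv_congr_on e.open_target (h e he) hz]
  exact hα.2 e he z hz

end Operations

/-! ### Brackets of Hamiltonian forms -/

section Brackets

variable {n m : ℕ}

namespace MCoord

/-- The values of the exterior derivatives of special Hamiltonian forms of degree `a`. -/
def specialS (n m a : ℕ) : Submodule ℝ (Alt (MCoord n m) (a + 1)) :=
  open Classical in if a + 1 = n then S n m (a + 1) else dxdySpan n m a

theorem specialS_le {a : ℕ} (ha : a < n) : specialS n m a ≤ S n m (a + 1) := by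
  rw [specialS]
  split_ifs
  · exact le_rfl
  · exact dxdySpan_le_S ha

theorem sum_update_mem_specialS {a b : ℕ} (ha : a < b + 1)
    {D : MCoord (b + 1) m →ₗ[ℝ] Alt (MCoord (b + 1) m) (b + 1)}
    (hS : ∀ w, D w ∈ S (b + 1) m (b + 1)) (hD : AlternatingMap.alternatizeUncurryFin D = 0)
    {η σ : Alt (MCoord (b + 1) m) (a + 1)} (hη : η ∈ specialS (b + 1) m a)
    (hσ : ∀ v, σ v = ∑ i, η (Function.update v i (sharpVec b m (D (v i))))) :
    σ ∈ specialS (b + 1) m a := by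
  by_cases h : a = b
  · subst h
    rw [specialS, if_pos rfl] at hη ⊢
    exact sum_update_mem_S hS hD hη hσ
  · rw [specialS, if_neg (by omega)] at hη ⊢
    exact sum_update_mem_dxdySpan hη (fun w => isVert_sharpVec (D w))
      (fun w hw => isMomVert_sharpVec_derivative hS hD (by omega) hw) hσ

end MCoord

/-! ### Local brackets fit together to forms on `M`. -/

namespace FiberedManifold

variable {X Y : Type*} [TopologicalSpace X] [ChartedSpace (Euc n) X]
  [TopologicalSpace Y] [ChartedSpace (Euc (n + m)) Y] {P : FiberedManifold n m X Y}

theorem extDeriv_toAlternatingMap_chart_trans {a : ℕ} {α : P.MForm a} (hα : IsForm α)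
    {e e' : OpenPartialHomeomorph P.Reduced (MCoord n m)} (he : e ∈ atlas (MCoord n m) P.Reduced)
    (he' : e' ∈ atlas (MCoord n m) P.Reduced) {z : MCoord n m}
    (hz : z ∈ (e.symm.trans e').source) : (extDeriv (α e) z).toAlternatingMap =
      (extDeriv (α e') (e.symm.trans e' z)).toAlternatingMap.compLinearMap
        (chartTransEquiv he he' hz).toLinearMap := by
  rw [extDeriv_chart_trans hα he he' hz]; rfl

theorem chart_trans_mem_target {e e' : OpenPartialHomeomorph P.Reduced (MCoord n m)} {z : MCoord n m}
    (hz : z ∈ (e.symm.trans e').source) : e.symm.trans e' z ∈ e'.target := by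
  have := chart_trans_mem hz
  simp only [OpenPartialHomeomorph.trans_source] at this
  exact this.1

theorem isForm_bracket {a b c : ℕ} (ha : a < n) (hb : b < n) (hc : c + (n - 1) = a + b)
    {α : P.MForm a} {β : P.MForm b} (hα : α ∈ formsWith P.Reduced (MCoord.S n m (a + 1)))
    (hβ : β ∈ formsWith P.Reduced (MCoord.S n m (b + 1)))
    (hsm : ∀ e ∈ atlas (MCoord n m) P.Reduced, ContDiffOn ℝ ∞ (bracket hb hc α β e) e.target) :
    IsForm (bracket hb hc α β) := by
  refine ⟨hsm, fun e he e' he' z hz => ?_⟩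
  have hz' := chart_trans_mem_target hz
  apply ContinuousAlternatingMap.toAlternatingMap_injective
  change MCoord.bracketAt hb hc _ _ = (MCoord.bracketAt hb hc _ _).compLinearMap
    (chartTransEquiv he he' hz).toLinearMap
  rw [extDeriv_toAlternatingMap_chart_trans hα.1 he he' hz,
    extDeriv_toAlternatingMap_chart_trans hβ.1 he he' hz,
    (isCanonical_trans he he' hz).bracketAt hb ha hc (hα.2 e' he' _ hz') (hβ.2 e' he' _ hz')]

/-- The bracket is defined through a choice of representatives, so smoothness and the exterior
derivative are taken from an explicit expression `γ` that agrees with it on chart targets. -/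
theorem bracket_mem_formsWith_of_eq {a b c : ℕ} (ha : a < n) (hb : b < n)
    (hc : c + (n - 1) = a + b) {α : P.MForm a} {β : P.MForm b}
    (hα : α ∈ formsWith P.Reduced (MCoord.S n m (a + 1)))
    (hβ : β ∈ formsWith P.Reduced (MCoord.S n m (b + 1))) (γ : P.MForm c)
    (hγ : ∀ e ∈ atlas (MCoord n m) P.Reduced, ∀ z ∈ e.target, bracket hb hc α β e z = γ e z)
    (hsm : ∀ e ∈ atlas (MCoord n m) P.Reduced, ContDiffOn ℝ ∞ (γ e) e.target)
    {T : Submodule ℝ (Alt (MCoord n m) (c + 1))}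
    (hT : ∀ e ∈ atlas (MCoord n m) P.Reduced, ∀ z ∈ e.target,
      (extDeriv (γ e) z).toAlternatingMap ∈ T) :
    bracket hb hc α β ∈ formsWith P.Reduced T := by
  refine ⟨isForm_bracket ha hb hc hα hβ fun e he => (hsm e he).congr fun z hz => hγ e he z hz,
    fun e he z hz => ?_⟩
  rw [extDeriv_congr_on e.open_target (hγ e he) hz]
  exact hT e he z hz

end FiberedManifold

/-! ### Brackets with a Hamiltonian form of degree `n - 1`. -/

namespace FiberedManifold

variable {b : ℕ} {X Y : Type*} [TopologicalSpace X] [ChartedSpace (Euc (b + 1)) X]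
  [TopologicalSpace Y] [ChartedSpace (Euc (b + 1 + m)) Y] {P : FiberedManifold (b + 1) m X Y}

/-- The contraction of `dα` with the Hamiltonian vector field of `β`. -/
def hamiltonianContraction {a : ℕ} (α : P.MForm a) (β : P.MForm b) : P.MForm a :=
  fun e z => toCont ((extDeriv (α e) z).toAlternatingMap.curryLeft
    (MCoord.sharpVec b m (extDeriv (β e) z).toAlternatingMap))

variable {a : ℕ} {α : P.MForm a} {β : P.MForm b} {e : OpenPartialHomeomorph P.Reduced (MCoord (b + 1) m)}

theorem contDiffOn_hamiltonianContraction (hα : IsForm α) (hβ : IsForm β)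
    (he : e ∈ atlas (MCoord (b + 1) m) P.Reduced) :
    ContDiffOn ℝ ∞ (hamiltonianContraction α β e) e.target := by
  let L : MCoord (b + 1) m [⋀^Fin (b + 1)]→L[ℝ] ℝ →L[ℝ] MCoord (b + 1) m :=
    (MCoord.sharpVec b m ∘ₗ
      (toContL (E := MCoord (b + 1) m) (k := b + 1)).symm.toLinearMap).toContinuousLinearMap
  exact ((interiorL _ a).contDiff.comp_contDiffOn (hα.contDiffOn_extDeriv he)).clm_apply
    (L.contDiff.comp_contDiffOn (hβ.contDiffOn_extDeriv he))

/-- Cartan's formula for the closed form `dα`: the derivative along `X` stays in the subspace, and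
the remaining sum is the action of the linear part of `X`, which preserves it. -/
theorem extDeriv_hamiltonianContraction_mem (ha : a < b + 1)
    (hα : α ∈ formsWith P.Reduced (MCoord.specialS (b + 1) m a))
    (hβ : β ∈ formsWith P.Reduced (MCoord.S (b + 1) m (b + 1)))
    (he : e ∈ atlas (MCoord (b + 1) m) P.Reduced) {z : MCoord (b + 1) m} (hz : z ∈ e.target) :
    (extDeriv (hamiltonianContraction α β e) z).toAlternatingMap ∈ MCoord.specialS (b + 1) m a := by
  have hη : DifferentiableAt ℝ (extDeriv (α e)) z :=
    ((hα.1.contDiffOn_extDeriv he).contDiffAt (e.open_target.mem_nhds hz)).differentiableAt (by simp)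
  have hζ : DifferentiableAt ℝ (extDeriv (β e)) z :=
    ((hβ.1.contDiffOn_extDeriv he).contDiffAt (e.open_target.mem_nhds hz)).differentiableAt (by simp)
  have hdη : extDeriv (extDeriv (α e)) z = 0 :=
    extDeriv_extDeriv_apply (hα.1.contDiffAt he hz) minSmoothness_two_le
  have hdζ : AlternatingMap.alternatizeUncurryFin (altDeriv (extDeriv (β e)) z) = 0 := by
    rw [← extDeriv_toAlternatingMap,
      extDeriv_extDeriv_apply (hβ.1.contDiffAt he hz) minSmoothness_two_le]
    rfl
  have hDη := altDeriv_mem _ hη (Filter.eventually_of_mem (e.open_target.mem_nhds hz) (hα.2 e he))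
  have hDζ := altDeriv_mem _ hζ (Filter.eventually_of_mem (e.open_target.mem_nhds hz) (hβ.2 e he))
  have key := extDeriv_interior (MCoord.sharpVec b m) hη hζ hdη
  set x := MCoord.sharpVec b m (extDeriv (β e) z).toAlternatingMap
  have h : (extDeriv (hamiltonianContraction α β e) z).toAlternatingMap -
      altDeriv (extDeriv (α e)) z x ∈ MCoord.specialS (b + 1) m a :=
    MCoord.sum_update_mem_specialS ha hDζ hdζ (hα.2 e he z hz) fun v => by
      rw [AlternatingMap.sub_apply, sub_eq_iff_eq_add']
      exact key v
  have := Submodule.add_mem _ h (hDη x)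
  rwa [sub_add_cancel] at this

theorem bracket_top_right_mem (ha : a < b + 1) (hb : b < b + 1) (hc : a + (b + 1 - 1) = a + b)
    (hα : α ∈ formsWith P.Reduced (MCoord.specialS (b + 1) m a))
    (hβ : β ∈ formsWith P.Reduced (MCoord.S (b + 1) m (b + 1))) :
    bracket hb hc α β ∈ formsWith P.Reduced (MCoord.specialS (b + 1) m a) := by
  have hα' : α ∈ formsWith P.Reduced (MCoord.S (b + 1) m (a + 1)) :=
    ⟨hα.1, fun e he z hz => MCoord.specialS_le ha (hα.2 e he z hz)⟩
  refine bracket_mem_formsWith_of_eq ha hb hc hα' hβ (hamiltonianContraction α β)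
    (fun e he z hz => ?_) (fun e he => contDiffOn_hamiltonianContraction hα.1 hβ.1 he)
    (fun e he z hz => extDeriv_hamiltonianContraction_mem ha hα hβ he hz)
  refine congrArg toCont ?_
  refine (MCoord.bracketAt_top_right hb hc (hα'.2 e he z hz)
    (MCoord.sharpVec_mem (hβ.2 e he z hz))).trans ?_
  ext v
  rw [contract_vec_apply]
  rfl

theorem bracket_top_left_mem (ha : a < b + 1) (hc : a + (b + 1 - 1) = b + a)
    (hα : α ∈ formsWith P.Reduced (MCoord.specialS (b + 1) m a))
    (hβ : β ∈ formsWith P.Reduced (MCoord.S (b + 1) m (b + 1))) :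
    bracket ha hc β α ∈ formsWith P.Reduced (MCoord.specialS (b + 1) m a) := by
  have hα' : α ∈ formsWith P.Reduced (MCoord.S (b + 1) m (a + 1)) :=
    ⟨hα.1, fun e he z hz => MCoord.specialS_le ha (hα.2 e he z hz)⟩
  refine bracket_mem_formsWith_of_eq (Nat.lt_succ_self b) ha hc hβ hα'
    (fun e => (-1 : ℝ) • hamiltonianContraction α β e)
    (fun e he z hz => ?_)
    (fun e he => contDiffOn_const.smul (contDiffOn_hamiltonianContraction hα.1 hβ.1 he))
    (fun e he z hz => ?_)
  · have h := MCoord.bracketAt_top_left ha hc (hα'.2 e he z hz)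
      (MCoord.sharpVec_mem (hβ.2 e he z hz))
    refine (congrArg toCont h).trans ?_
    ext v
    change -(contract _ _ _ v) = (-1 : ℝ) * _
    rw [contract_vec_apply, neg_one_mul]
    rfl
  · rw [extDeriv_smul]
    exact Submodule.smul_mem _ (-1) (extDeriv_hamiltonianContraction_mem ha hα hβ he hz)

end FiberedManifold

namespace FiberedManifold

variable {X Y : Type*} [TopologicalSpace X] [ChartedSpace (Euc n) X]
  [TopologicalSpace Y] [ChartedSpace (Euc (n + m)) Y] {P : FiberedManifold n m X Y}

/-- If one degree is `n - 1`, the bracket is, up to sign, an interior product with a Hamiltonian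
vector field. Otherwise it vanishes on all chart targets. -/
theorem bracket_mem {a b c : ℕ} (ha : a < n) (hb : b < n) (hc : c + (n - 1) = a + b)
    {α : P.MForm a} {β : P.MForm b} (hα : α ∈ formsWith P.Reduced (MCoord.specialS n m a))
    (hβ : β ∈ formsWith P.Reduced (MCoord.specialS n m b)) :
    bracket hb hc α β ∈ formsWith P.Reduced (MCoord.specialS n m c) := by
  by_cases h : b + 1 = n
  · subst h
    obtain rfl : c = a := by omega
    rw [MCoord.specialS, if_pos rfl] at hβ
    exact bracket_top_right_mem ha hb hc hα hβ
  by_cases h' : a + 1 = n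
  · subst h'
    obtain rfl : c = b := by omega
    rw [MCoord.specialS, if_pos rfl] at hα
    exact bracket_top_left_mem hb hc hβ hα
  refine formsWith_congr (Submodule.zero_mem _) fun e he z hz => ?_
  rw [MCoord.specialS, if_neg h'] at hα
  rw [MCoord.specialS, if_neg h] at hβ
  exact (congrArg toCont (MCoord.bracketAt_eq_zero hb ha hc (hα.2 e he z hz)
    (hβ.2 e he z hz))).symm

end FiberedManifold
end Brackets

/-! ### Exterior products of differentials of functions -/

section Differentials

variable {E F : Type*} [NormedAddCommGroup E] [NormedSpace ℝ E] [FiniteDimensional ℝ E]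
  [NormedAddCommGroup F] [NormedSpace ℝ F] {k : ℕ}

/-- A form is a finite combination of constant forms with its values on basis vectors as
coefficients. -/
theorem contDiffOn_form {f : F → E [⋀^Fin k]→L[ℝ] ℝ} {s : Set F} {r : WithTop ℕ∞}
    (h : ∀ v, ContDiffOn ℝ r (fun z => f z v) s) : ContDiffOn ℝ r f s := by
  let b := Module.finBasis ℝ E
  have hf : ∀ z, f z = (k.factorial : ℝ)⁻¹ • ∑ s : Fin k → _,
      f z (b ∘ s) • toCont (covecWedge (b.coord ∘ s)) := fun z => by
    have h1 := alt_eq_sum (c := b.coord) (b := b) (fun v => b.sum_repr v) (f z).toAlternatingMap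
    have h2 := congrArg (toContL (E := E) (k := k)) h1
    rw [map_smul, map_sum] at h2
    simp only [map_smul] at h2
    exact h2
  refine ContDiffOn.congr ?_ fun z _ => hf z
  refine ContDiffOn.const_smul _ (ContDiffOn.sum fun s _ => ?_)
  exact (h _).smul contDiffOn_const

variable {N : Type*} [TopologicalSpace N] [ChartedSpace E N]

/-- The form `dF₁ ∧ ⋯ ∧ dF_k`. -/
def differentialWedge (G : N → Fin k → ℝ) : FormRep E N k := fun e z =>
  (toCont (Matrix.detRowAlternating (R := ℝ) (n := Fin k))).compContinuousLinearMap
    (fderiv ℝ (G ∘ e.symm) z)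

omit [FiniteDimensional ℝ E] [ChartedSpace E N] in
theorem differentialWedge_toAlternatingMap (G : N → Fin k → ℝ) (e : OpenPartialHomeomorph N E)
    (z : E) : (differentialWedge G e z).toAlternatingMap =
      covecWedge fun i => LinearMap.proj i ∘ₗ (fderiv ℝ (G ∘ e.symm) z).toLinearMap := rfl

omit [FiniteDimensional ℝ E] in
-- The form is the pullback under `G` of the constant volume form of `ℝᵏ`, which is closed.
theorem isClosedForm_differentialWedge {G : N → Fin k → ℝ}
    (hG : ∀ e ∈ atlas E N, ContDiffOn ℝ ∞ (G ∘ e.symm) e.target) :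
    IsClosedForm (differentialWedge (E := E) G) := by
  intro e he z hz
  let V : (Fin k → ℝ) → (Fin k → ℝ) [⋀^Fin k]→L[ℝ] ℝ := fun _ =>
    toCont (Matrix.detRowAlternating (R := ℝ) (n := Fin k))
  have h : extDeriv (differentialWedge G e) z = (extDeriv V (G (e.symm z))).compContinuousLinearMap
      (fderiv ℝ (G ∘ e.symm) z) :=
    extDeriv_pullback (r := ∞) (f := G ∘ e.symm) (differentiableAt_const _)
      ((hG e he).contDiffAt (e.open_target.mem_nhds hz)) minSmoothness_two_le
  refine h.trans ?_
  have h0 : extDeriv V (G (e.symm z)) = 0 := by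
    apply ContinuousAlternatingMap.toAlternatingMap_injective
    have : altDeriv V (G (e.symm z)) = 0 := by
      rw [altDeriv, fderiv_const_apply]; rfl
    rw [extDeriv_toAlternatingMap, this]
    exact map_zero (AlternatingMap.alternatizeUncurryFinLM (R := ℝ))
  rw [h0]
  rfl

theorem isForm_differentialWedge {G : N → Fin k → ℝ} [IsManifold 𝓘(ℝ, E) ∞ N]
    (hG : ∀ e ∈ atlas E N, ContDiffOn ℝ ∞ (G ∘ e.symm) e.target) :
    IsForm (differentialWedge (E := E) G) := by
  refine ⟨fun e he => contDiffOn_form fun v => ?_, fun e he e' he' z hz => ?_⟩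
  · have h : ContDiffOn ℝ ∞ (fderiv ℝ (G ∘ e.symm)) e.target :=
      (hG e he).fderiv_of_isOpen e.open_target (by simp)
    change ContDiffOn ℝ ∞ (fun z => Matrix.det
      (Matrix.of fun i j => fderiv ℝ (G ∘ e.symm) z (v i) j)) e.target
    simp only [Matrix.det_apply, Matrix.of_apply]
    refine ContDiffOn.sum fun σ _ => ContDiffOn.const_smul _ (contDiffOn_prod fun i _ => ?_)
    exact (contDiff_apply ℝ ℝ i).comp_contDiffOn (h.clm_apply contDiffOn_const)
  · have hz' : e.symm.trans e' z ∈ e'.target := by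
      have := chart_trans_mem hz
      simp only [OpenPartialHomeomorph.trans_source] at this
      exact this.1
    have h1 : (G ∘ e.symm) =ᶠ[𝓝 z] (G ∘ e'.symm) ∘ (e.symm.trans e') := by
      refine Filter.eventually_of_mem ((OpenPartialHomeomorph.open_source _).mem_nhds hz)
        fun w hw => congrArg G ?_
      simp only [OpenPartialHomeomorph.trans_source, OpenPartialHomeomorph.symm_source, mem_inter_iff,
        mem_preimage] at hw
      exact (e'.left_inv hw.2).symm
    have h2 := h1.fderiv_eq.trans (fderiv_comp z
      (((hG e' he').contDiffAt (e'.open_target.mem_nhds hz')).differentiableAt (by simp))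
      (differentiableAt_chart_trans he he' hz))
    rw [differentialWedge, h2]
    rfl

end Differentials

/-! ### Extension of germs by bump functions. -/

section Bump

variable {E F N : Type*} [NormedAddCommGroup E] [NormedSpace ℝ E] [FiniteDimensional ℝ E]
  [NormedAddCommGroup F] [NormedSpace ℝ F] [TopologicalSpace N] [T2Space N] [ChartedSpace E N]
  [IsManifold 𝓘(ℝ, E) ∞ N]

/-- Every germ of a smooth map extends to a globally defined smooth map. -/
theorem exists_contMDiff_eventuallyEq {g : N → F} {s : Set N} (hs : IsOpen s)
    (hg : ContMDiffOn 𝓘(ℝ, E) 𝓘(ℝ, F) ∞ g s) {x : N} (hx : x ∈ s) :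
    ∃ f : N → F, ContMDiff 𝓘(ℝ, E) 𝓘(ℝ, F) ∞ f ∧ f =ᶠ[𝓝 x] g := by
  obtain ⟨ψ, -, hψ⟩ := (SmoothBumpFunction.nhds_basis_tsupport (I := 𝓘(ℝ, E)) x).mem_iff.1
    (hs.mem_nhds hx)
  refine ⟨fun y => ψ y • g y, contMDiff_of_tsupport fun y hy => ?_, ?_⟩
  · have hy' : y ∈ s := hψ (tsupport_smul_subset_left _ _ hy)
    exact ψ.contMDiffAt.smul ((hg y hy').contMDiffAt (hs.mem_nhds hy'))
  · filter_upwards [ψ.eventuallyEq_one] with y hy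
    rw [hy]
    simp

end Bump

/-! ### Basic forms -/

section Basic

variable {n m : ℕ}

namespace FiberedManifold

variable {X Y : Type*} [TopologicalSpace X] [ChartedSpace (Euc n) X]
  [TopologicalSpace Y] [ChartedSpace (Euc (n + m)) Y] {P : FiberedManifold n m X Y}

theorem mem_base_target {e : OpenPartialHomeomorph P.Reduced (MCoord n m)} {c : P.AdaptedChart}
    (hc : e.toPartialEquiv = c.partialEquiv) {z : MCoord n m} (hz : z ∈ e.target) :
    z.1.1 ∈ c.base.target := by
  have hz1 := (mem_target_iff hc).1 hz
  have hz' := c.chart.map_target hz1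
  have := c.base.map_source (c.proj_mem _ hz')
  rwa [c.base_proj _ hz', c.chart.right_inv hz1] at this

/-- Moving in a vertical direction does not change the base point, so the differential of the
projection kills that direction. -/
theorem IsBasic.mem_annVec {k : ℕ} {ε : P.MForm k} (hε : IsBasic ε)
    {e : OpenPartialHomeomorph P.Reduced (MCoord n m)} (he : e ∈ atlas (MCoord n m) P.Reduced)
    {z : MCoord n m} (hz : z ∈ e.target) :
    (ε e z).toAlternatingMap ∈ annVec MCoord.IsVert k := by
  obtain ⟨-, β, -, hβ⟩ := hε
  obtain ⟨c, hc⟩ := (P.mem_atlas_iff e).1 he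
  set f := chartAt (Euc n) (P.toBase (e.symm z))
  intro v s hs
  rw [hβ e he f (chart_mem_atlas _ _) z hz (mem_chart_source _ _)]
  refine (β f (f (P.toBase (e.symm z)))).map_coord_zero s ?_
  refine fderiv_apply_eq_zero_of_eventually ?_
  filter_upwards [eventually_add_smul_mem e.open_target hz (v s)] with t ht
  have hv : (v s).1.1 = 0 := hs
  simp only [Function.comp_apply]
  rw [toBase_symm hc ht, toBase_symm hc hz]
  simp [hv]

theorem contDiffOn_comp_toBase {k : ℕ} {G : X → Fin k → ℝ}
    (hG : ContMDiff 𝓘(ℝ, Euc n) 𝓘(ℝ, Fin k → ℝ) ∞ G)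
    {e : OpenPartialHomeomorph P.Reduced (MCoord n m)} (he : e ∈ atlas (MCoord n m) P.Reduced) :
    ContDiffOn ℝ ∞ ((G ∘ P.toBase) ∘ e.symm) e.target := by
  obtain ⟨c, hc⟩ := (P.mem_atlas_iff e).1 he
  have h1 : ContDiffOn ℝ ∞ (G ∘ c.base.symm) c.base.target := by
    rw [← contMDiffOn_iff_contDiffOn]
    exact hG.comp_contMDiffOn c.contMDiffOn_base_symm
  have h2 : ContDiffOn ℝ ∞ ((G ∘ c.base.symm) ∘ fun z : MCoord n m => z.1.1) e.target :=
    h1.comp (contDiff_fst.fst).contDiffOn fun z hz => mem_base_target hc hz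
  exact h2.congr fun z hz => congrArg G (toBase_symm hc hz)

/-- The forms `dG₁ ∧ ⋯ ∧ dG_k` are basic for functions `G_i` lifted from the base. -/
theorem isBasic_differentialWedge [IsManifold 𝓘(ℝ, Euc n) ∞ X] {k : ℕ} {G : X → Fin k → ℝ}
    (hG : ContMDiff 𝓘(ℝ, Euc n) 𝓘(ℝ, Fin k → ℝ) ∞ G) :
    IsBasic (P := P) (differentialWedge (G ∘ P.toBase)) := by
  have hGX : ∀ f ∈ atlas (Euc n) X, ContDiffOn ℝ ∞ (G ∘ f.symm) f.target := fun f hf => by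
    rw [← contMDiffOn_iff_contDiffOn]
    exact hG.comp_contMDiffOn
      (contMDiffOn_symm_of_mem_maximalAtlas (IsManifold.subset_maximalAtlas hf))
  refine ⟨isForm_differentialWedge fun e he => contDiffOn_comp_toBase hG he,
    differentialWedge G, isForm_differentialWedge hGX, fun e he f hf z hz hzf => ?_⟩
  obtain ⟨c, hc⟩ := (P.mem_atlas_iff e).1 he
  have hzb := mem_base_target hc hz
  have hτ : (f ∘ P.toBase ∘ e.symm) =ᶠ[𝓝 z] (f ∘ c.base.symm) ∘ fun z : MCoord n m => z.1.1 :=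
    Filter.eventually_of_mem (e.open_target.mem_nhds hz) fun w hw => congrArg f (toBase_symm hc hw)
  rw [toBase_symm hc hz] at hzf
  have hfc : DifferentiableAt ℝ (f ∘ c.base.symm) z.1.1 := by
    rw [← mdifferentiableAt_iff_differentiableAt]
    refine MDifferentiableAt.comp _ ?_ ?_ (I' := 𝓘(ℝ, Euc n))
    · exact mdifferentiableAt_atlas hf hzf
    · exact ((c.contMDiffOn_base_symm _ hzb).contMDiffAt
        (c.base.open_target.mem_nhds hzb)).mdifferentiableAt (by simp)
  have hd : DifferentiableAt ℝ (f ∘ P.toBase ∘ e.symm) z :=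
    hτ.differentiableAt_iff.2 (hfc.comp z (differentiableAt_fst.fst))
  have hnear : ∀ᶠ w in 𝓝 z, P.toBase (e.symm w) ∈ f.source := by
    have hcont : ContinuousAt (fun w : MCoord n m => c.base.symm w.1.1) z :=
      ContinuousAt.comp (f := fun w : MCoord n m => w.1.1)
        (c.base.continuousAt_symm hzb) (by fun_prop)
    filter_upwards [hcont.eventually (f.open_source.mem_nhds hzf),
      e.open_target.mem_nhds hz] with w hw hwt
    rwa [toBase_symm hc hwt]
  have h1 : ((G ∘ P.toBase) ∘ e.symm) =ᶠ[𝓝 z] (G ∘ f.symm) ∘ (f ∘ P.toBase ∘ e.symm) :=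
    hnear.mono fun w hw => congrArg G (f.left_inv hw).symm
  have h2 := h1.fderiv_eq.trans (fderiv_comp z (((hGX f hf).contDiffAt (f.open_target.mem_nhds
    (f.map_source (by rwa [← toBase_symm hc hz] at hzf)))).differentiableAt (by simp)) hd)
  rw [differentialWedge, h2]
  rfl

/-- There is a closed basic form with the value `dx^{L₁} ∧ ⋯ ∧ dx^{L_k}` at a given point. -/
theorem exists_isBasic_isClosedForm [T2Space X] [IsManifold 𝓘(ℝ, Euc n) ∞ X] {k : ℕ}
    (I : Fin k → Fin n) {e : OpenPartialHomeomorph P.Reduced (MCoord n m)}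
    (he : e ∈ atlas (MCoord n m) P.Reduced) {z : MCoord n m} (hz : z ∈ e.target) :
    ∃ ε : P.MForm k, IsBasic ε ∧ IsClosedForm ε ∧
      (ε e z).toAlternatingMap = covecWedge fun i => MCoord.dx (I i) := by
  obtain ⟨c, hc⟩ := (P.mem_atlas_iff e).1 he
  have hzb := mem_base_target hc hz
  let L : (Fin n → ℝ) →L[ℝ] (Fin k → ℝ) :=
    ContinuousLinearMap.pi fun i => ContinuousLinearMap.proj (I i)
  -- Global functions on `X` with the germs of the coordinates `x^{L_i}` at the base point; their
  -- differentials are closed and basic everywhere and take the required value there.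
  obtain ⟨G, hG, hGc⟩ := exists_contMDiff_eventuallyEq (g := L ∘ c.base) c.base.open_source
    (L.contDiff.contMDiff.comp_contMDiffOn c.contMDiffOn_base) (c.base.map_target hzb)
  refine ⟨differentialWedge (G ∘ P.toBase), isBasic_differentialWedge hG,
    isClosedForm_differentialWedge fun e he => contDiffOn_comp_toBase hG he, ?_⟩
  let L' : MCoord n m →L[ℝ] (Fin k → ℝ) :=
    L.comp ((ContinuousLinearMap.fst ℝ _ _).comp (ContinuousLinearMap.fst ℝ _ _))
  have hcont : ContinuousAt (fun w : MCoord n m => c.base.symm w.1.1) z :=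
    ContinuousAt.comp (f := fun w : MCoord n m => w.1.1)
      (c.base.continuousAt_symm hzb) (by fun_prop)
  have h1 : ((G ∘ P.toBase) ∘ e.symm) =ᶠ[𝓝 z] L' := by
    filter_upwards [hcont.eventually hGc, e.open_target.mem_nhds hz] with w hw hwt
    simp only [Function.comp_apply] at hw ⊢
    rw [toBase_symm hc hwt, hw, c.base.right_inv (mem_base_target hc hwt)]
    rfl
  rw [differentialWedge_toAlternatingMap, h1.fderiv_eq, L'.fderiv]
  rfl

end FiberedManifold
end Basic

/-! ### Special Hamiltonian forms -/

section Special

variable {n m : ℕ}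

namespace MCoord

/-- Every argument goes either to `η` or to `ε`. A vertical one kills `ε`, so a momentum direction,
or a pair of vertical vectors, would have to go entirely to `η`, which it kills. -/
theorem wedgeAlt_mem_dxdySpan {a k : ℕ} {η : Alt (MCoord n m) (a + 1)} (hη : η ∈ dxdySpan n m a)
    {ε : Alt (MCoord n m) k} (hε : ε ∈ annVec IsVert k) :
    (wedgeAlt η ε).domDomCongr (finCongr (Nat.succ_add_eq_add_succ a k)) ∈
      dxdySpan n m (a + k) := by
  rw [mem_dxdySpan_iff] at hη ⊢
  set σ := finCongr (Nat.succ_add_eq_add_succ a k)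
  have hsplit : ∀ (e : Fin (a + 1) ⊕ Fin k ≃ Fin (a + 1 + k)) (s : Fin (a + k + 1)),
      (∃ i, s = σ (e (.inl i))) ∨ ∃ j, s = σ (e (.inr j)) := by
    intro e s
    obtain ⟨t, ht⟩ := (e.trans σ).surjective s
    rcases t with i | j
    · exact .inl ⟨i, ht.symm⟩
    · exact .inr ⟨j, ht.symm⟩
  constructor
  · intro v s hs
    refine wedgeAlt_eq_zero fun e => ?_
    rcases hsplit e s with ⟨i, rfl⟩ | ⟨j, rfl⟩
    · exact .inl (hη.1 _ i hs)
    · exact .inr (hε _ j hs.isVert)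
  · intro v s t hst ⟨hs, ht⟩
    refine wedgeAlt_eq_zero fun e => ?_
    rcases hsplit e s with ⟨i, rfl⟩ | ⟨j, rfl⟩
    · rcases hsplit e t with ⟨i', rfl⟩ | ⟨j', rfl⟩
      · exact .inl (hη.2 _ i i' (fun h => hst (by rw [h])) ⟨hs, ht⟩)
      · exact .inr (hε _ j' ht)
    · exact .inr (hε _ j hs)

theorem wedgeAlt_zero_mem {a : ℕ} {T : Submodule ℝ (Alt (MCoord n m) (a + 1))}
    {η : Alt (MCoord n m) (a + 1)} (hη : η ∈ T) (ε : Alt (MCoord n m) 0) :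
    (wedgeAlt η ε).domDomCongr (finCongr (Nat.succ_add_eq_add_succ a 0)) ∈ T := by
  obtain ⟨c, rfl⟩ : ∃ c : ℝ, ε = c • covecWedge ![] := by
    refine ⟨ε ![], ?_⟩
    ext v
    rw [Subsingleton.elim v ![], AlternatingMap.smul_apply, covecWedge_apply, Matrix.det_fin_zero,
      smul_eq_mul, mul_one]
  have h : (wedgeAlt η (covecWedge ![])).domDomCongr
      (finCongr (Nat.succ_add_eq_add_succ a 0)) = η := by
    ext v
    have h := wedgeAlt_append η (![] : Fin 0 → Module.Dual ℝ (MCoord n m)) (u := v)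
      (w := ![]) (fun _ j => j.elim0)
    rw [covecWedge_apply, Matrix.det_fin_zero, mul_one] at h
    refine Eq.trans (congrArg _ ?_) h
    rw [Fin.append_right_nil _ _ rfl]
    rfl
  rw [map_smul]
  change c • (wedgeAlt η (covecWedge ![])).domDomCongr _ ∈ T
  rw [h]
  exact T.smul_mem _ hη

/-- The coefficients of the `dp`-terms of `η` vanish if the products of `η` with the forms
`dx^{L₁} ∧ ⋯ ∧ dx^{L_k}` lie in `Sⁿ`. -/
theorem mem_dxdySpan_of_wedgeAlt_mem {a k : ℕ} (hk : 1 ≤ k) (hn : a + k + 1 = n)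
    {η : Alt (MCoord n m) (a + 1)} (hη : η ∈ S n m (a + 1))
    (h : ∀ L : Fin k → Fin n, (wedgeAlt η (covecWedge fun i => dx (L i))).domDomCongr
      (finCongr (Nat.succ_add_eq_add_succ a k)) ∈ S n m (a + k + 1)) :
    η ∈ dxdySpan n m a := by
  refine mem_dxdySpan_of_frame (S_le_horiz2 _ hη) fun s hs t x ht => ?_
  by_cases hv : ∃ t', t' ≠ t ∧ ∃ y, s t' = .inr y
  · obtain ⟨t', ht', y, hy⟩ := hv
    refine S_le_horiz2 _ hη _ t t' ht'.symm ⟨?_, ?_⟩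
    · simpa [ht, frame] using isVert_ep _ _
    · rcases y with i | y
      · simpa [hy, frame] using isVert_ey _
      · simpa [hy, frame] using isVert_ep _ _
  push Not at hv
  have hx : ∀ t', t' ≠ t → ∃ μ, s t' = .inl μ := fun t' ht' => by
    cases hst : s t' with
    | inl μ => exact ⟨μ, rfl⟩
    | inr y => exact absurd hst (hv t' ht' y)
  have : Nonempty (Fin n) := ⟨x.1⟩
  choose! I hI using hx
  -- If `∂/∂x^ν` already accompanies `∂/∂p^ν_j`, membership of `η` itself in `S` suffices; otherwise
  -- `dx^ν` is supplied by the second factor.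
  by_cases hν : ∃ t', t' ≠ t ∧ I t' = x.1
  · obtain ⟨t', ht', hν⟩ := hν
    refine S_le_annPair_conj _ hη _ t t' ht'.symm ⟨x.1, x.2, ?_, ?_⟩
    · simp [ht, frame]
    · simp [hI t' ht', frame, hν]
  push Not at hν
  -- A set of `k` indices that contains `ν` and avoids the `x`-indices used by `s`. At least `n - a
  -- = k + 1` indices are free, and `k ≥ 1` leaves room for `ν`.
  obtain ⟨U, hxU, hU, hcard⟩ := Finset.exists_subsuperset_card_eq (n := k)
    (s := {x.1}) (t := ((Finset.univ.erase t).image I)ᶜ) (by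
      simp only [Finset.singleton_subset_iff, Finset.mem_compl, Finset.mem_image, Finset.mem_erase,
        Finset.mem_univ, and_true, not_exists, not_and]
      exact hν) (by simpa using hk) (by
      rw [Finset.card_compl, Fintype.card_fin]
      have h1 := Finset.card_image_le (s := Finset.univ.erase t) (f := I)
      rw [Finset.card_erase_of_mem (Finset.mem_univ _), Finset.card_univ, Fintype.card_fin] at h1
      omega)
  let L := U.orderEmbOfFin hcard
  have hL : ∀ i t', t' ≠ t → L i ≠ I t' := fun i t' ht' hi => by
    have h1 := hU (U.orderEmbOfFin_mem hcard i)
    rw [Finset.mem_compl] at h1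
    exact h1 (Finset.mem_image.2 ⟨t', by simpa using ht', hi.symm⟩)
  obtain ⟨j, hj⟩ : ∃ j, L j = x.1 := by
    have : x.1 ∈ Set.range (U.orderEmbOfFin hcard) := by
      rw [Finset.range_orderEmbOfFin]
      exact hxU (Finset.mem_singleton_self _)
    exact this
  have h0 : ∀ (i : Fin (a + 1)) (l : Fin k), dx (L l) ((frame ∘ s) i : MCoord n m) = 0 := by
    intro i l
    by_cases hi : i = t
    · simp [hi, ht, frame, dx_ep]
    · simp [hI i hi, frame, dx_ex, hL l i hi]
  have h1 := wedgeAlt_append η (fun i => dx (L i)) (u := frame ∘ s) (w := fun i => ex (L i)) h0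
  have h2 : covecWedge (fun i => dx (L i)) (fun i => ex (L i) : Fin k → MCoord n m) = 1 := by
    rw [covecWedge_apply, ← Matrix.det_one (n := Fin k)]
    congr 1
    ext i l
    simp [dx_ex, Matrix.one_apply, eq_comm]
  rw [h2, mul_one] at h1
  rw [← h1]
  have h3 := S_le_annPair_conj _ (h L)
  set σ := finCongr (Nat.succ_add_eq_add_succ a k)
  -- By `h1` the coefficient of `η` equals the value of the product on the enlarged family, which
  -- contains the conjugate pair `∂/∂p^ν_j`, `∂/∂x^ν`.
  have h4 := h3 (fun i => Fin.append (frame ∘ s) (fun i => ex (L i)) (σ.symm i))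
    (σ (Fin.castAdd k t)) (σ (Fin.natAdd (a + 1) j))
    (fun hh => by
      have := congrArg Fin.val (σ.injective hh)
      simp at this
      omega)
    ⟨x.1, x.2, by simp [ht, frame], by simp [hj]⟩
  exact (congrArg _ (funext fun i => by simp)).trans h4

end MCoord

/-! ### Special forms are those whose differential takes values in `specialS`. -/

namespace FiberedManifold

variable {X Y : Type*} [TopologicalSpace X] [ChartedSpace (Euc n) X]
  [TopologicalSpace Y] [ChartedSpace (Euc (n + m)) Y] {P : FiberedManifold n m X Y}

theorem isSpecial_of_mem {a : ℕ} (ha : a < n) {α : P.MForm a}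
    (hα : α ∈ formsWith P.Reduced (MCoord.specialS n m a)) : IsSpecial α := by
  refine ⟨⟨ha, hα.1, fun e he z hz => MCoord.specialS_le ha (hα.2 e he z hz)⟩,
    fun k hk ε hε hcl => ⟨by omega, hα.1.wedge hε.1, fun e he z hz => ?_⟩⟩
  rw [extDeriv_wedgeForm (hα.1.differentiableAt he hz) (hε.1.differentiableAt he hz)
    (hcl e he z hz)]
  have h := hα.2 e he z hz
  -- For `k = 0` the degree is `n - 1` and `ε` is a function, so the product is a multiple of `dα`;
  -- for `k ≥ 1` the value of `dα` lies in `dxdySpan`.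
  rcases Nat.eq_zero_or_pos k with rfl | hk0
  · exact MCoord.wedgeAlt_zero_mem (MCoord.specialS_le ha h) _
  · rw [MCoord.specialS, if_neg (by omega)] at h
    exact MCoord.dxdySpan_le_S (by omega) (MCoord.wedgeAlt_mem_dxdySpan h (hε.mem_annVec he hz))

/-- The condition is pointwise, so at each point and for each multi-index `L` a closed basic form
with the value `dx^{L₁} ∧ ⋯ ∧ dx^{L_k}` there is enough. -/
theorem IsSpecial.mem [T2Space X] [IsManifold 𝓘(ℝ, Euc n) ∞ X] {a : ℕ} {α : P.MForm a}
    (hα : IsSpecial α) : α ∈ formsWith P.Reduced (MCoord.specialS n m a) := by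
  obtain ⟨⟨ha, hform, hS⟩, hwedge⟩ := hα
  refine ⟨hform, fun e he z hz => ?_⟩
  rw [MCoord.specialS]
  split_ifs with h
  · exact hS e he z hz
  · obtain ⟨k, hk⟩ : ∃ k, a + k + 1 = n := ⟨n - 1 - a, by omega⟩
    refine MCoord.mem_dxdySpan_of_wedgeAlt_mem (k := k) (by omega) hk (hS e he z hz) fun L => ?_
    obtain ⟨ε, hε, hcl, hval⟩ := exists_isBasic_isClosedForm L he hz
    have h1 := (hwedge k hk ε hε hcl).2.2 e he z hz
    rwa [extDeriv_wedgeForm (hform.differentiableAt he hz) (hε.1.differentiableAt he hz)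
      (hcl e he z hz), hval] at h1

theorem isSpecial_iff [T2Space X] [IsManifold 𝓘(ℝ, Euc n) ∞ X] {a : ℕ} (ha : a < n)
    {α : P.MForm a} : IsSpecial α ↔ α ∈ formsWith P.Reduced (MCoord.specialS n m a) :=
  ⟨IsSpecial.mem, isSpecial_of_mem ha⟩

end FiberedManifold
end Special

end ReducedFieldTheory
end

theorem mainTheorem9 {n m : ℕ} {X Y : Type*}
    [TopologicalSpace X] [T2Space X] [ChartedSpace (ReducedFieldTheory.Euc n) X]
    [IsManifold 𝓘(ℝ, ReducedFieldTheory.Euc n) ∞ X]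
    [TopologicalSpace Y] [T2Space Y] [ChartedSpace (ReducedFieldTheory.Euc (n + m)) Y]
    [IsManifold 𝓘(ℝ, ReducedFieldTheory.Euc (n + m)) ∞ Y]
    (P : ReducedFieldTheory.FiberedManifold n m X Y) :
    -- special Hamiltonian forms are a graded linear subspace, closed under the bracket
    (∀ a : ℕ, a < n → ∃ V : Submodule ℝ (P.MForm a),
      ∀ α : P.MForm a, α ∈ V ↔ ReducedFieldTheory.FiberedManifold.IsSpecial α) ∧
    (∀ (a b c : ℕ) (hb : b < n) (hc : c + (n - 1) = a + b) (α : P.MForm a) (β : P.MForm b),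
      ReducedFieldTheory.FiberedManifold.IsSpecial α →
      ReducedFieldTheory.FiberedManifold.IsSpecial β →
      ReducedFieldTheory.FiberedManifold.IsSpecial
        (ReducedFieldTheory.FiberedManifold.bracket hb hc α β)) ∧
    -- in degrees `a ≤ n - 2`, the differentials have no `dp`-terms
    (∀ a : ℕ, a + 2 ≤ n → ∀ α : P.MForm a, ReducedFieldTheory.FiberedManifold.IsSpecial α →
      ∀ e ∈ atlas (ReducedFieldTheory.MCoord n m) P.Reduced, ∀ z ∈ e.target,
        (extDeriv (α e) z).toAlternatingMap ∈ ReducedFieldTheory.MCoord.dxdySpan n m a) ∧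
    -- in degree `n - 1`, every Hamiltonian form is special
    (∀ a : ℕ, a + 1 = n → ∀ α : P.MForm a,
      ReducedFieldTheory.FiberedManifold.IsSpecial α ↔
        ReducedFieldTheory.FiberedManifold.IsHamiltonian α) := by
  open ReducedFieldTheory ReducedFieldTheory.FiberedManifold in
  refine ⟨fun a ha => ⟨formsWith P.Reduced (MCoord.specialS n m a), fun α => (isSpecial_iff ha).symm⟩,
    fun a b c hb hc α β hα hβ => ?_, fun a ha α hα e he z hz => ?_, fun a ha α => ?_⟩
  · have ha := hα.1.1
    exact isSpecial_of_mem (by omega) (bracket_mem ha hb hc hα.mem hβ.mem)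
  · have h := hα.mem.2 e he z hz
    rwa [MCoord.specialS, if_neg (by omega)] at h
  · refine ⟨fun h => h.1, fun h => isSpecial_of_mem h.1 ⟨h.2.1, ?_⟩⟩
    rw [MCoord.specialS, if_pos ha]
    exact h.2.2
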